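/- Setting. Let $(\mathcal X,d)$ be a complete separable metric space, $K\ge 2$, $[K]=\{1,\dots,K\}$, $\mathcal Z=\mathcal X\times[K]$, and let $\mathcal M_+(\cdot)$ denote finite positive Borel measures. For $\nu\in\mathcal M_+(\mathcal Z)$ put $\nu_i(A)=\nu(A\times\{i\})$. Let $c:\mathcal X\times\mathcal X\to[0,\infty]$ be lower semicontinuous with $c(x,x)=0$, and suppose that whenever $(x_n)$ is a bounded sequence and $(x_n')$ is a sequence in $\mathcal X$ with $\sup_n c(x_n,x_n')<\infty$, the set $\{(x_n,x_n'):n\in\mathbb N\}$ is precompact in $\mathcal X\times\mathcal X$. (Here $c(x,x')$ is the cost of moving the data point $x$ to $x'$.) Put $c_{\mathcal Z}((x,i),(x',i'))=c(x,x')$ if $i=i'$ and $=\infty$ otherwise. For finite measures, $C(\cdot,\cdot)$ is the optimal transport cost (infimum over couplings, $\infty$ if there is none) for $c_{\mathcal Z}$ on $\mathcal Z$, respectively for $c$ on $\mathcal X$. Let $\mathcal F$ be the set of Borel maps $f=(f_1,\dots,f_K)$ from $\mathcal X$ to the probability simplex of $\mathbb R^K$, and $$R(f,\nu)=\sum_i\int(1-f_i)\,d\nu_i,\qquad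 B(f,\nu)=\sum_i\int f_i\,d\nu_i .$$ For $\mu\in\mathcal M_+(\mathcal Z)$ define the value of the generalized barycenter problem $$B^*_\mu=\inf\Big\{\lambda(\mathcal X)+\sum_iC(\mu_i,\tilde\mu_i)\;:\;\lambda,\tilde\mu_i\in\mathcal M_+(\mathcal X),\ \tilde\mu_i\le\lambda\text{ for all }i\Big\}.$$ Let $\mathcal Z_*=\mathcal Z\sqcup\{g\}$ with an isolated extra point $g$ (the ghost). For $\vec z\in\mathcal Z_*^K$ put $\hat\mu_{\vec z}=\frac1K\sum_{l:z_l\ne g}\delta_{z_l}$ and $\mathbf c(\vec z)=B^*_{\hat\mu_{\vec z}}$. For $\mu\neq0$ let $\Pi_K(\mu)$ be the set of probability measures on $\mathcal Z_*^K$ all of whose $K$ marginals equal $\bar\mu:=\frac{1}{2\mu(\mathcal Z)}\mu(\cdot\cap\mathcal Z)+\frac12\delta_g$. The MOT problem is to minimize $\int\mathbf c\,d\pi$ over $\pi\in\Pi_K(\mu)$; its dual is to maximize $$\sum_{j=1}^K\frac1{2\mu(\mathcal Z)}\int_{\mathcal Z}\phi_j\,d\mu+\frac12\sum_{j=1}^K\phi_j(g)$$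 over real functions $\phi_1,\dots,\phi_K\in L^1(\bar\mu)$ with $\sum_j\phi_j(z_j)\le\mathbf c(\vec z)$ for every $\vec z\in\mathcal Z_*^K$. Theorem. Let $\mu\in\mathcal M_+(\mathcal Z)$, $\mu\ne0$. All $\sup$ and $\inf$ below are over $f\in\mathcal F$ and $\nu\in\mathcal M_+(\mathcal Z)$. 1. $\displaystyle \inf_{\nu}\sup_{f}\{B(f,\nu)+C(\mu,\nu)\}=B^*_\mu$, and $\displaystyle \frac{B^*_\mu}{2\mu(\mathcal Z)}=\min_{\pi\in\Pi_K(\mu)}\int\mathbf c\,d\pi$, the minimum being attained. 2. There is no duality gap: $\displaystyle \sup_f\inf_\nu\{B(f,\nu)+C(\mu,\nu)\}=\inf_\nu\sup_f\{B(f,\nu)+C(\mu,\nu)\}$, and $$\inf_f\sup_\nu\{R(f,\nu)-C(\mu,\nu)\}=\sup_\nu\inf_f\{R(f,\nu)-C(\mu,\nu)\}=\mu(\mathcal Z)-B^*_\mu .$$ 3. Call a measurable family (kernel) $\vec z\mapsto\eta_{\vec z}\in\mathcal M_+(\mathcal Z)$ a family of optimal local attacks if $\sup_f\{B(f,\eta_{\vec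 z})+C(\hat\mu_{\vec z},\eta_{\vec z})\}=\mathbf c(\vec z)$ for every $\vec z\in\mathcal Z_*^K$. Such a family exists. Let $\pi^*$ be any solution of the MOT problem and $\phi^*$ any solution of its dual. For a family $S=(S_i)_{i\in[K]}$ of subsets of $\mathcal X$ put $$f^{S}_i(x')=\sup_{x\in S_i}\max\Big\{\max\Big\{\sum_j\phi^*_j(x,i)+\sum_j\phi^*_j(g),0\Big\}-c(x,x'),\,0\Big\}\qquad(\sup\emptyset=0).$$ (a) There are $S_i$ with $\mu_i(\mathcal X\setminus S_i)=0$ such that all $f^S_i$ are Borel measurable. (b) For every $S$ for which all $f_i^S$ are Borel measurable there is $f\in\mathcal F$ with $f_i\ge f^S_i$ on $\mathcal X$ for all $i$. (c) Let $S$ satisfy $\mu_i(\mathcal X\setminus S_i)=0$ for all $i$ (for instance $S_i=\operatorname{spt}\mu_i$), let $f^*\in\mathcal F$ satisfy $f^*_i\ge f^S_i$ for all $i$, let $\eta$ be a family of optimal local attacks and $\tilde\mu^*=2\mu(\mathcal Z)\int\eta_{\vec z}\,d\pi^*(\vec z)$. Then $f^*$ attains $\sup_f\inf_\nu\{B+C\}$,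 $\tilde\mu^*$ attains $\inf_\nu\sup_f\{B+C\}$, and $(f^*,\tilde\mu^*)$ is a saddle point of the original adversarial problem: $\tilde\mu^*$ is a finite measure and $$R(f^*,\nu)-C(\mu,\nu)\le R(f^*,\tilde\mu^*)-C(\mu,\tilde\mu^*)\le R(f,\tilde\mu^*)-C(\mu,\tilde\mu^*)\qquad\text{for all } f\in\mathcal F,\ \nu\in\mathcal M_+(\mathcal Z).$$ -/

import Mathlib

open MeasureTheory Set
open scoped ENNReal

noncomputable section

namespace AdvMOT

/-! ### Costs and optimal transport between two finite measures -/

/-- `IsCoupling μ ν π`: the measure `π` on `α × α` has marginals `μ` and `ν`. -/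
def IsCoupling {α : Type*} [MeasurableSpace α] (μ ν : Measure α) (π : Measure (α × α)) : Prop :=
  π.map Prod.fst = μ ∧ π.map Prod.snd = ν

/-- The optimal transport cost `C(μ, ν)`; it is `∞` when there is no coupling. -/
def transportCost {α : Type*} [MeasurableSpace α] (c : α → α → ℝ≥0∞) (μ ν : Measure α) : ℝ≥0∞ :=
  ⨅ (π : Measure (α × α)) (_ : IsCoupling μ ν π), ∫⁻ p, c p.1 p.2 ∂π

/-- The structural assumption on the cost `c x x'` of moving a data point `x` to `x'`. -/
structure CostAssumption {X : Type*} [MetricSpace X] (c : X → X → ℝ≥0∞) : Prop where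
  lsc : LowerSemicontinuous (fun p : X × X => c p.1 p.2)
  self : ∀ x, c x x = 0
  coercive : ∀ x x' : ℕ → X, Bornology.IsBounded (Set.range x) → (⨆ n, c (x n) (x' n)) < ⊤ →
    IsCompact (closure (Set.range fun n => (x n, x' n)))

section Adversarial

variable {X : Type*} [MeasurableSpace X] {K : ℕ}

/-- The label preserving cost on `X × [K]`. -/
def labelCost (c : X → X → ℝ≥0∞) (z z' : X × Fin K) : ℝ≥0∞ :=
  if z.2 = z'.2 then c z.1 z'.1 else ⊤

/-- The part `μ_i` of a measure on `X × [K]` carried by the class `i`. -/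
def classPart (μ : Measure (X × Fin K)) (i : Fin K) : Measure X :=
  (μ.restrict (Prod.snd ⁻¹' {i})).map Prod.fst

theorem classPart_apply (μ : Measure (X × Fin K)) (i : Fin K) {A : Set X} (hA : MeasurableSet A) :
    classPart μ i A = μ (A ×ˢ {i}) := by
  rw [classPart, Measure.map_apply measurable_fst hA, Measure.restrict_apply (measurable_fst hA)]
  rfl

/-! ### Classifiers, risk, classification power -/

/-- The set of Borel probabilistic classifiers. -/
def classifiers (X : Type*) [MeasurableSpace X] (K : ℕ) : Set (X → Fin K → ℝ) :=
  {f | Measurable f ∧ ∀ x, f x ∈ stdSimplex ℝ (Fin K)}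

/-- The risk of `f` under `ν` for the (extended) 0-1 loss. -/
def risk (f : X → Fin K → ℝ) (ν : Measure (X × Fin K)) : ℝ≥0∞ :=
  ∑ i, ∫⁻ x, ENNReal.ofReal (1 - f x i) ∂(classPart ν i)

/-- The classification power of `f` under `ν`. -/
def power (f : X → Fin K → ℝ) (ν : Measure (X × Fin K)) : ℝ≥0∞ :=
  ∑ i, ∫⁻ x, ENNReal.ofReal (f x i) ∂(classPart ν i)

/-- The payoff `R(f, ν) - C(μ, ν)` of the original adversarial problem. -/
def advPayoff (c : X → X → ℝ≥0∞) (μ : Measure (X × Fin K)) (f : X → Fin K → ℝ)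
    (ν : Measure (X × Fin K)) : EReal :=
  (risk f ν : EReal) - (transportCost (labelCost c) μ ν : EReal)

/-- The payoff `B(f, ν) + C(μ, ν)` of the problem written with the classification power. -/
def powerPayoff (c : X → X → ℝ≥0∞) (μ : Measure (X × Fin K)) (f : X → Fin K → ℝ)
    (ν : Measure (X × Fin K)) : ℝ≥0∞ :=
  power f ν + transportCost (labelCost c) μ ν

/-- `inf_f sup_ν {R(f, ν) - C(μ, ν)}`. -/
def advValue (c : X → X → ℝ≥0∞) (μ : Measure (X × Fin K)) : EReal :=
  ⨅ (f : X → Fin K → ℝ) (_ : f ∈ classifiers X K), ⨆ ν : FiniteMeasure (X × Fin K),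
    advPayoff c μ f ν

/-- `sup_ν inf_f {R(f, ν) - C(μ, ν)}`. -/
def advDualValue (c : X → X → ℝ≥0∞) (μ : Measure (X × Fin K)) : EReal :=
  ⨆ ν : FiniteMeasure (X × Fin K), ⨅ (f : X → Fin K → ℝ) (_ : f ∈ classifiers X K),
    advPayoff c μ f ν

/-- `inf_ν {B(f, ν) + C(μ, ν)}`, the robust classification power of `f`. -/
def robustPowerOf (c : X → X → ℝ≥0∞) (μ : Measure (X × Fin K)) (f : X → Fin K → ℝ) : ℝ≥0∞ :=
  ⨅ ν : FiniteMeasure (X × Fin K), powerPayoff c μ f ν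

/-- `sup_f {B(f, ν) + C(μ, ν)}`, the value of the attack `ν`. -/
def attackValueOf (c : X → X → ℝ≥0∞) (μ : Measure (X × Fin K)) (ν : Measure (X × Fin K)) : ℝ≥0∞ :=
  ⨆ (f : X → Fin K → ℝ) (_ : f ∈ classifiers X K), powerPayoff c μ f ν

/-- `sup_f inf_ν {B(f, ν) + C(μ, ν)}`. -/
def robustPower (c : X → X → ℝ≥0∞) (μ : Measure (X × Fin K)) : ℝ≥0∞ :=
  ⨆ (f : X → Fin K → ℝ) (_ : f ∈ classifiers X K), robustPowerOf c μ f

/-- The dual adversarial problem `inf_ν sup_f {B(f, ν) + C(μ, ν)}`. -/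
def dualAdversarial (c : X → X → ℝ≥0∞) (μ : Measure (X × Fin K)) : ℝ≥0∞ :=
  ⨅ ν : FiniteMeasure (X × Fin K), attackValueOf c μ ν

/-- `B*_μ`, the value of the generalized barycenter problem. -/
def Bstar (c : X → X → ℝ≥0∞) (μ : Measure (X × Fin K)) : ℝ≥0∞ :=
  ⨅ (lam : FiniteMeasure X) (ν : Fin K → FiniteMeasure X)
    (_ : ∀ i, (ν i : Measure X) ≤ (lam : Measure X)),
    (lam : Measure X) univ + ∑ i, transportCost c (classPart μ i) (ν i : Measure X)

/-- `(f, ν)` is a saddle point of `inf_f sup_ν {R(f, ν) - C(μ, ν)}`. -/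
def IsSaddle (c : X → X → ℝ≥0∞) (μ : Measure (X × Fin K)) (f : X → Fin K → ℝ)
    (ν : Measure (X × Fin K)) : Prop :=
  f ∈ classifiers X K ∧ IsFiniteMeasure ν ∧
    (∀ g ∈ classifiers X K, advPayoff c μ f ν ≤ advPayoff c μ g ν) ∧
    ∀ ν' : FiniteMeasure (X × Fin K), advPayoff c μ f ν' ≤ advPayoff c μ f ν

/-! ### The multimarginal problem -/

/-- The space `(X × [K]) ∪ {ghost}`; the ghost is `Sum.inr ()`. -/
abbrev ZStar (X : Type*) (K : ℕ) : Type _ := (X × Fin K) ⊕ Unit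

/-- The common marginal `μ / (2 μ(Z)) + δ_ghost / 2`. -/
def ghostMarginal (μ : Measure (X × Fin K)) : Measure (ZStar X K) :=
  (2 * μ univ)⁻¹ • μ.map Sum.inl + (2 : ℝ≥0∞)⁻¹ • Measure.dirac (Sum.inr ())

/-- The set `Π_K(μ)` of couplings. -/
def multiCouplings (μ : Measure (X × Fin K)) : Set (Measure (Fin K → ZStar X K)) :=
  {π | IsProbabilityMeasure π ∧ ∀ i, π.map (fun z => z i) = ghostMarginal μ}

/-- The measure `(1/K) ∑ δ_{z_l}`, the sum running over the `l` for which `z_l` is not the ghost. -/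
def localMeasure (z : Fin K → ZStar X K) : Measure (X × Fin K) :=
  (K : ℝ≥0∞)⁻¹ • ∑ l, Sum.elim (fun w => Measure.dirac w) (fun _ => 0) (z l)

/-- The cost of the multimarginal problem. -/
def motCost (c : X → X → ℝ≥0∞) (z : Fin K → ZStar X K) : ℝ≥0∞ :=
  Bstar c (localMeasure z)

/-- `π` solves the multimarginal problem. -/
def IsMOTSolution (c : X → X → ℝ≥0∞) (μ : Measure (X × Fin K))
    (π : Measure (Fin K → ZStar X K)) : Prop :=
  π ∈ multiCouplings μ ∧
    ∀ π' ∈ multiCouplings μ, ∫⁻ z, motCost c z ∂π ≤ ∫⁻ z, motCost c z ∂π'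

/-- The feasible set `Φ` of the dual of the multimarginal problem. -/
def dualFeasible (c : X → X → ℝ≥0∞) (μ : Measure (X × Fin K)) :
    Set (Fin K → ZStar X K → ℝ) :=
  {φ | (∀ j, Integrable (φ j) (ghostMarginal μ)) ∧
    ∀ z : Fin K → ZStar X K, ((∑ j, φ j (z j) : ℝ) : EReal) ≤ (motCost c z : EReal)}

/-- The objective of the dual of the multimarginal problem. -/
def dualObjective (μ : Measure (X × Fin K)) (φ : Fin K → ZStar X K → ℝ) : ℝ :=
  (∑ j, (1 / (2 * μ.real univ)) * ∫ z, φ j (Sum.inl z) ∂μ) + (1 / 2) * ∑ j, φ j (Sum.inr ())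

/-- `φ` solves the dual of the multimarginal problem. -/
def IsDualSolution (c : X → X → ℝ≥0∞) (μ : Measure (X × Fin K))
    (φ : Fin K → ZStar X K → ℝ) : Prop :=
  φ ∈ dualFeasible c μ ∧ ∀ φ' ∈ dualFeasible c μ, dualObjective μ φ' ≤ dualObjective μ φ

/-! ### From multimarginal solutions to a classifier and an attack -/

/-- `∑_j φ_j(x, i) + ∑_j φ_j(ghost)`. -/
def aggregate (φ : Fin K → ZStar X K → ℝ) (i : Fin K) (x : X) : ℝ :=
  ∑ j, φ j (Sum.inl (x, i)) + ∑ j, φ j (Sum.inr ())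

/-- `sup_{x ∈ S_i} max {max {∑_j φ_j(x, i) + ∑_j φ_j(ghost), 0} - c(x, x'), 0}`
(the subtraction of `ℝ≥0∞` is truncated at `0`, and the supremum over the empty set is `0`). -/
def preClassifier (c : X → X → ℝ≥0∞) (φ : Fin K → ZStar X K → ℝ) (S : Fin K → Set X)
    (i : Fin K) (x' : X) : ℝ≥0∞ :=
  ⨆ x ∈ S i, (ENNReal.ofReal (aggregate φ i x) - c x x')

/-- The classifier `f` dominates the functions `preClassifier c φ S i`. -/
def Dominates (c : X → X → ℝ≥0∞) (φ : Fin K → ZStar X K → ℝ) (S : Fin K → Set X)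
    (f : X → Fin K → ℝ) : Prop :=
  ∀ i x', preClassifier c φ S i x' ≤ ENNReal.ofReal (f x' i)

/-- A measurable family `z ↦ η z` of optimal attacks for the local problems. -/
def IsOptimalLocalAttack (c : X → X → ℝ≥0∞)
    (η : ProbabilityTheory.Kernel (Fin K → ZStar X K) (X × Fin K)) : Prop :=
  ∀ z, IsFiniteMeasure (η z) ∧ attackValueOf c (localMeasure z) (η z) = motCost c z

/-- The attack `2 μ(Z) ∫ η_z dπ(z)` assembled from local attacks. -/
def assembledAttack (μ : Measure (X × Fin K)) (π : Measure (Fin K → ZStar X K))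
    (η : ProbabilityTheory.Kernel (Fin K → ZStar X K) (X × Fin K)) : Measure (X × Fin K) :=
  (2 * μ univ) • π.bind η

end Adversarial

end AdvMOT

end

/-! Write M for μ(Z). Everything follows from one circle of inequalities, valid for each feasible φ
and each π in Π_K(μ): 2M·(dual objective of φ) ≤ sup_f inf_ν {B + C} ≤ inf_ν sup_f {B + C} = B*_μ ≤
2M ∫ c dπ. Multimarginal Kantorovich duality closes it: some π has ∫ c dπ at most the supremum of
the dual objective. All terms then coincide at the optimum, and a plan is attained.

The first inequality (`dualObjective_le_robustPowerOf`) is weak duality: if f_i(x') ≥ Φ_i(x) -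
c(x,x'), where Φ_i is the aggregated potential, then integrating against a coupling of μ and ν gives
∫Φ dμ ≤ B(f,ν) + C(μ,ν). Such an f exists because the functions f^S_i sum to at most 1
(`sum_preClassifier_le_one`). This is tested on tuples that repeat each active point equally often
and are filled up with ghosts. Borel measurability for a suitable S comes from Lusin's theorem.

The equality with B*_μ (`dualAdversarial_eq_Bstar`) says that the Bayes classifier has power equal
to the mass of the least common majorant of the ν_i. The last inequality
(`attackValueOf_assembledAttack_le`) averages optimal local attacks over π: the local measures
average to μ, the power is linear in the attack, and C is jointly convex.

Two facts about the local problem are needed: c is lower semicontinuous, and optimal local attacks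
can be chosen measurably. Both come from a finite dimensional form of B* for the measures of tuples:
mass is distributed among selections of at most one point per class, and each selection is gathered
at one location. Duality and joint convexity rely on local compactness, which the coercivity of the
cost provides.

Finally, R = M - (B + C) up to infinite costs, so an f reaching the value from below and an attack
reaching it from above form a saddle point. -/

namespace AdvMOT

/-! ### Multimarginal duality: extension of a positive functional -/

section Duality

open Filter Topology BoundedContinuousFunction

/-- A lower semicontinuous function is an increasing limit of bounded continuous functions. -/
theorem exists_monotone_boundedContinuous_iSup_eq {Z : Type*} [TopologicalSpace Z]
    [TopologicalSpace.MetrizableSpace Z] {c : Z → ℝ≥0∞} (hc : LowerSemicontinuous c) :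
    ∃ h : ℕ → Z →ᵇ ℝ, (∀ n z, 0 ≤ h n z) ∧ (∀ z, Monotone fun n => h n z) ∧
      ∀ z, ⨆ n, ENNReal.ofReal (h n z) = c z := by
  let _ := TopologicalSpace.metrizableSpaceMetric Z
  -- The Lipschitz regularization of `min c n` with constant n.
  let g : ℕ → Z → ℝ≥0∞ := fun n z => ⨅ w, (min (c w) n + n * edist z w)
  have g_le_c : ∀ n z, g n z ≤ c z := fun n z => (iInf_le _ z).trans (by simp)
  have g_le_n : ∀ n z, g n z ≤ n := fun n z => (iInf_le _ z).trans (by simp)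
  have g_top : ∀ n z, g n z ≠ ⊤ := fun n z => ne_top_of_le_ne_top (by simp) (g_le_n n z)
  have g_mono : ∀ z, Monotone fun n => g n z := by
    intro z n m hnm
    have : (n : ℝ≥0∞) ≤ m := by exact_mod_cast hnm
    refine iInf_mono fun w => ?_
    gcongr
  have g_lip : ∀ n z z', g n z ≤ g n z' + n * edist z z' := by
    intro n z z'
    simp only [g]
    rw [ENNReal.iInf_add]
    refine le_iInf fun w => (iInf_le _ w).trans ?_
    rw [add_assoc]
    gcongr
    rw [← mul_add]
    gcongr
    rw [add_comm]
    exact edist_triangle _ _ _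
  have g_cont : ∀ n : ℕ, LipschitzWith (n : NNReal) fun z => (g n z).toReal := by
    intro n
    refine LipschitzWith.of_le_add_mul _ fun z z' => ?_
    have := ENNReal.toReal_mono
      (ENNReal.add_ne_top.2 ⟨g_top n z', ENNReal.mul_ne_top (by simp) (edist_ne_top z z')⟩)
      (g_lip n z z')
    rw [ENNReal.toReal_add (g_top n z') (ENNReal.mul_ne_top (by simp) (edist_ne_top z z')),
      ENNReal.toReal_mul] at this
    simpa [edist_dist] using this
  refine ⟨fun n => BoundedContinuousFunction.ofNormedAddCommGroup _ (g_cont n).continuous n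
    fun z => ?_, fun n z => ENNReal.toReal_nonneg, fun z n m hnm =>
      ENNReal.toReal_mono (g_top _ _) (g_mono z hnm), fun z => ?_⟩
  · rw [Real.norm_of_nonneg ENNReal.toReal_nonneg]
    exact ENNReal.toReal_le_of_le_ofReal (by simp) (by simpa using g_le_n n z)
  · have : ∀ n, ENNReal.ofReal ((g n z).toReal) = g n z := fun n => ENNReal.ofReal_toReal (g_top n z)
    simp only [BoundedContinuousFunction.coe_ofNormedAddCommGroup, this]
    refine le_antisymm (iSup_le fun n => g_le_c n z) (le_of_forall_lt fun t ht => ?_)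
    obtain ⟨t', ht', ht'c⟩ := exists_between ht
    refine lt_of_lt_of_le ht' ?_
    obtain ⟨r, hr, hball⟩ := Metric.eventually_nhds_iff_ball.1 (hc z t' ht'c)
    have t'top : t' ≠ ⊤ := ht'c.ne_top
    -- Inside the ball of radius r both `c w` and n are at least t'; outside it the penalty is at
    -- least n * r. This n makes both bounds reach t'.
    obtain ⟨n, hn⟩ := exists_nat_ge (max t'.toReal (t'.toReal / r))
    have hn1 : t' ≤ n := by
      rw [← ENNReal.ofReal_toReal t'top, ← ENNReal.ofReal_natCast]
      exact ENNReal.ofReal_le_ofReal ((le_max_left _ _).trans hn)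
    have hn2 : t' ≤ n * ENNReal.ofReal r := by
      rw [← ENNReal.ofReal_toReal t'top, ← ENNReal.ofReal_natCast,
        ← ENNReal.ofReal_mul (by positivity)]
      exact ENNReal.ofReal_le_ofReal ((div_le_iff₀ hr).1 ((le_max_right _ _).trans hn))
    refine le_iSup_of_le n (le_iInf fun w => ?_)
    by_cases hw : w ∈ Metric.ball z r
    · exact le_add_right (le_min (hball w hw).le hn1)
    · refine le_add_left (hn2.trans ?_)
      gcongr
      rw [edist_dist, dist_comm]
      exact ENNReal.ofReal_le_ofReal (not_lt.1 hw)

variable {ι : Type*} [Fintype ι] {Y : Type*} [TopologicalSpace Y] [MeasurableSpace Y]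

/-- The function `z ↦ ∑ j, φ j (z j)`. -/
def coordSum (φ : ι → Y →ᵇ ℝ) : (ι → Y) →ᵇ ℝ :=
  ∑ j, (φ j).compContinuous ⟨fun z => z j, continuous_apply j⟩

omit [MeasurableSpace Y] in
@[simp]
theorem coordSum_apply (φ : ι → Y →ᵇ ℝ) (z : ι → Y) : coordSum φ z = ∑ j, φ j (z j) := by
  simp [coordSum, BoundedContinuousFunction.sum_apply]

/-- A coupling in the weak sense: a positive functional with the prescribed marginals whose value is
at most D on functions below c. It comes from the M. Riesz extension theorem in the space of pairs
(h, t), where the extra coordinate encodes the cost bound. -/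
theorem exists_positive_functional [Nonempty ι] [Nonempty Y] [BorelSpace Y]
    [SecondCountableTopology Y]
    (μ : ι → Measure Y) [∀ j, IsProbabilityMeasure (μ j)] (c : (ι → Y) → ℝ≥0∞) (D : ℝ)
    (hD : ∀ φ : ι → Y →ᵇ ℝ, (∀ z, ENNReal.ofReal (∑ j, φ j (z j)) ≤ c z) →
      ∑ j, ∫ y, φ j y ∂(μ j) ≤ D) :
    ∃ L : ((ι → Y) →ᵇ ℝ) →ₗ[ℝ] ℝ, (∀ h, (∀ z, 0 ≤ h z) → 0 ≤ L h) ∧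
      (∀ φ : ι → Y →ᵇ ℝ, L (coordSum φ) = ∑ j, ∫ y, φ j y ∂(μ j)) ∧
      ∀ h, (∀ z, ENNReal.ofReal (h z) ≤ c z) → L h ≤ D := by
  classical
  -- The cone t ≥ 0, h + t c ≥ 0. Since 0 * ∞ = 0, the condition for t = 0 reads h ≥ 0.
  let s : PointedCone ℝ (((ι → Y) →ᵇ ℝ) × ℝ) :=
    { carrier := {p | 0 ≤ p.2 ∧ ∀ z, ENNReal.ofReal (-(p.1 z)) ≤ ENNReal.ofReal p.2 * c z}
      zero_mem' := by simp
      add_mem' := by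
        rintro p q ⟨hp, hp'⟩ ⟨hq, hq'⟩
        refine ⟨add_nonneg hp hq, fun z => ?_⟩
        simp only [Prod.fst_add, Prod.snd_add, BoundedContinuousFunction.coe_add, Pi.add_apply,
          neg_add]
        rw [ENNReal.ofReal_add hp hq, add_mul]
        exact ENNReal.ofReal_add_le.trans (add_le_add (hp' z) (hq' z))
      smul_mem' := by
        rintro ⟨r, hr⟩ p ⟨hp, hp'⟩
        refine ⟨mul_nonneg hr hp, fun z => ?_⟩
        have := mul_le_mul_right (hp' z) (ENNReal.ofReal r)
        rw [← ENNReal.ofReal_mul hr, ← mul_assoc, ← ENNReal.ofReal_mul hr] at this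
        simpa using this }
  -- Integrating against the product measure gives a functional whose value on `coordSum φ` does not
  -- depend on the representing φ.
  let F : ((ι → Y) →ᵇ ℝ) × ℝ →ₗ[ℝ] ℝ :=
    { toFun := fun p => ∫ z, p.1 z ∂(Measure.pi μ) + p.2 * D
      map_add' := fun p q => by
        simp only [Prod.fst_add, Prod.snd_add, BoundedContinuousFunction.coe_add, Pi.add_apply]
        rw [integral_add (p.1.integrable _) (q.1.integrable _)]
        ring
      map_smul' := fun r p => by
        simp only [Prod.smul_fst, Prod.smul_snd, BoundedContinuousFunction.coe_smul, smul_eq_mul,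
          integral_const_mul, RingHom.id_apply]
        ring }
  have F_coord : ∀ (φ : ι → Y →ᵇ ℝ) (t : ℝ),
      F (coordSum φ, t) = ∑ j, ∫ y, φ j y ∂(μ j) + t * D := by
    intro φ t
    change ∫ z, coordSum φ z ∂(Measure.pi μ) + t * D = _
    congr 1
    simp only [coordSum_apply]
    rw [integral_finsetSum]
    · refine Finset.sum_congr rfl fun j _ => ?_
      exact integral_comp_eval (μ := μ) (i := j) (f := φ j)
        (φ j).continuous.aestronglyMeasurable
    · intro j _
      exact ((φ j).compContinuous ⟨fun z : ι → Y => z j, continuous_apply j⟩).integrable _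
  let W : Submodule ℝ (((ι → Y) →ᵇ ℝ) × ℝ) :=
    { carrier := {p | ∃ φ, p.1 = coordSum φ}
      zero_mem' := ⟨0, by ext; simp⟩
      add_mem' := by
        rintro p q ⟨φ, hφ⟩ ⟨ψ, hψ⟩
        exact ⟨φ + ψ, by ext z; simp [hφ, hψ, Finset.sum_add_distrib]⟩
      smul_mem' := by
        rintro r p ⟨φ, hφ⟩
        exact ⟨r • φ, by ext z; simp [hφ, Finset.mul_sum]⟩ }
  let f : ((ι → Y) →ᵇ ℝ) × ℝ →ₗ.[ℝ] ℝ := ⟨W, F.comp W.subtype⟩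
  have f_nonneg : ∀ x : f.domain, (x : ((ι → Y) →ᵇ ℝ) × ℝ) ∈ s → 0 ≤ f x := by
    rintro ⟨⟨h, t⟩, φ, hφ⟩ ⟨ht, hs⟩
    obtain rfl : h = coordSum φ := hφ
    change 0 ≤ F (coordSum φ, t)
    rw [F_coord]
    simp only at ht hs
    -- Weak duality applied to the scaled potentials -r φ. For t = 0 every r ≥ 0 is allowed, which
    -- forces the marginal sum to be nonnegative; for t > 0 take r = 1 / t.
    have key : ∀ r : ℝ, 0 ≤ r → r * t ≤ 1 → r * -∑ j, ∫ y, φ j y ∂(μ j) ≤ D := by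
      intro r hr hrt
      have := hD (fun j => -(r • φ j)) fun z => by
        have h1 := mul_le_mul_right (hs z) (ENNReal.ofReal r)
        rw [← ENNReal.ofReal_mul hr, ← mul_assoc, ← ENNReal.ofReal_mul hr] at h1
        have h2 : ENNReal.ofReal (r * t) * c z ≤ 1 * c z := by
          gcongr
          simpa using hrt
        rw [one_mul] at h2
        refine le_trans (le_of_eq ?_) (h1.trans h2)
        simp [Finset.mul_sum]
      simpa [integral_neg, integral_const_mul, Finset.mul_sum] using this
    set A := ∑ j, ∫ y, φ j y ∂(μ j)
    have hD0 : 0 ≤ D := by simpa using key 0 le_rfl (by simp)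
    rcases ht.eq_or_lt with rfl | ht
    · by_contra! hA
      rw [zero_mul, add_zero] at hA
      have := key ((D + 1) / -A) (by apply div_nonneg <;> linarith) (by simp)
      rw [div_mul_cancel₀ _ (by linarith)] at this
      linarith
    · have := key t⁻¹ (by positivity) (by rw [inv_mul_cancel₀ ht.ne'])
      rw [inv_mul_le_iff₀ ht] at this
      linarith
  -- Cofinality: the constant ‖h‖, placed in one slot, makes the first component nonnegative, and -t
  -- cancels the second.
  have f_dense : ∀ y, ∃ x : f.domain, (x : ((ι → Y) →ᵇ ℝ) × ℝ) + y ∈ s := by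
    rintro ⟨h, t⟩
    obtain ⟨j₀⟩ := ‹Nonempty ι›
    refine ⟨⟨(coordSum fun j => if j = j₀ then BoundedContinuousFunction.const Y ‖h‖ else 0, -t),
      _, rfl⟩, ?_, fun z => ?_⟩
    · simp
    · have h0 := h.norm_coe_le_norm z
      have h1 : -h z ≤ ‖h‖ := (neg_le_abs _).trans h0
      have h2 : ∑ j, (if j = j₀ then BoundedContinuousFunction.const Y ‖h‖ else 0) (z j) = ‖h‖ := by
        rw [Finset.sum_eq_single j₀] <;> simp +contextual
      simp [h2, ENNReal.ofReal_of_nonpos, h1]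
  obtain ⟨g, g_eq, g_nonneg⟩ := riesz_extension s f f_nonneg f_dense
  have g_W : ∀ (φ : ι → Y →ᵇ ℝ) (t : ℝ), g (coordSum φ, t) = ∑ j, ∫ y, φ j y ∂(μ j) + t * D :=
    fun φ t => (g_eq ⟨(coordSum φ, t), φ, rfl⟩).trans (F_coord φ t)
  refine ⟨g.comp (LinearMap.inl ℝ ((ι → Y) →ᵇ ℝ) ℝ), fun h hh => ?_, fun φ => ?_, fun h hh => ?_⟩
  · change 0 ≤ g (h, 0)
    exact g_nonneg _ ⟨le_rfl, fun z => by simp [ENNReal.ofReal_of_nonpos, hh z]⟩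
  · change g (coordSum φ, 0) = _
    simpa using g_W φ 0
  · change g (h, 0) ≤ D
    have h1 : 0 ≤ g (-h, 1) := g_nonneg _ ⟨zero_le_one, fun z => by simpa using hh z⟩
    have h2 := g_W 0 1
    have h3 : coordSum (0 : ι → Y →ᵇ ℝ) = 0 := by ext; simp
    rw [h3] at h2
    have h4 : ((-h, 1) : ((ι → Y) →ᵇ ℝ) × ℝ) = (0, 1) - (h, 0) := by simp
    rw [h4, map_sub, h2] at h1
    simpa using h1

end Duality

end AdvMOT

namespace AdvMOT

/-! ### Multimarginal duality: from the functional to an optimal plan -/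

section Duality

open Filter Topology BoundedContinuousFunction CompactlySupported

/-- A positive functional on bounded continuous functions that is tight is an integral. -/
theorem exists_measure_of_tight_functional {Z : Type*} [TopologicalSpace Z] [T2Space Z]
    [LocallyCompactSpace Z] [MeasurableSpace Z] [BorelSpace Z]
    (L : (Z →ᵇ ℝ) →ₗ[ℝ] ℝ) (hL : ∀ h, (∀ z, 0 ≤ h z) → 0 ≤ L h)
    (ψ : ℕ → C_c(Z, ℝ)) (hψ : ∀ n z, ψ n z ∈ Icc (0 : ℝ) 1)
    (hlim : ∀ z, Tendsto (fun n => ψ n z) atTop (𝓝 1))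
    (htight : Tendsto (fun n => L (1 - (ψ n).toBoundedContinuousFunction)) atTop (𝓝 0)) :
    ∃ π : Measure Z, IsFiniteMeasure π ∧ ∀ h, L h = ∫ z, h z ∂π := by
  have hmono : ∀ h h' : Z →ᵇ ℝ, (∀ z, h z ≤ h' z) → L h ≤ L h' := fun h h' hh => by
    have := hL (h' - h) fun z => by simpa using hh z
    rw [map_sub] at this
    linarith
  let Λ : C_c(Z, ℝ) →ₚ[ℝ] ℝ := PositiveLinearMap.mk₀
    { toFun := fun g => L g.toBoundedContinuousFunction
      map_add' := fun f g => by rw [← map_add]; rfl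
      map_smul' := fun r f => by
        simp only [RingHom.id_apply]
        rw [← map_smul]
        rfl } fun g hg => hL _ hg
  let π := RealRMK.rieszMeasure Λ
  have hπ : ∀ g : C_c(Z, ℝ), ∫ z, g z ∂π = L g.toBoundedContinuousFunction :=
    RealRMK.integral_rieszMeasure Λ
  have hint : ∀ g : C_c(Z, ℝ), Integrable g π := fun g =>
    g.continuous.integrable_of_hasCompactSupport g.hasCompactSupport
  -- Fatou's lemma along the cutoffs ψ n.
  have hfin : π univ ≤ ENNReal.ofReal (L 1) := by
    have h1 : ∀ n, ∫⁻ z, ENNReal.ofReal (ψ n z) ∂π ≤ ENNReal.ofReal (L 1) := fun n => by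
      rw [← ofReal_integral_eq_lintegral_ofReal (hint _) (ae_of_all _ fun z => (hψ n z).1), hπ]
      exact ENNReal.ofReal_le_ofReal (hmono _ _ fun z => (hψ n z).2)
    have h2 : ∫⁻ z, liminf (fun n => ENNReal.ofReal (ψ n z)) atTop ∂π ≤ ENNReal.ofReal (L 1) :=
      (lintegral_liminf_le fun n => (ψ n).continuous.measurable.ennreal_ofReal).trans
        (liminf_le_of_le (by isBoundedDefault) fun b hb => by
          obtain ⟨n, hn⟩ := hb.exists
          exact hn.trans (h1 n))
    have h3 : ∀ z, liminf (fun n => ENNReal.ofReal (ψ n z)) atTop = 1 := fun z => by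
      have := (ENNReal.continuous_ofReal.tendsto 1).comp (hlim z)
      rw [ENNReal.ofReal_one] at this
      exact this.liminf_eq
    simpa [h3] using h2
  have : IsFiniteMeasure π := ⟨hfin.trans_lt ENNReal.ofReal_lt_top⟩
  refine ⟨π, this, fun h => ?_⟩
  -- L and the integral agree on h * ψ n. The integrals converge by domination, and the values of L
  -- by tightness, since |h * ψ n - h| ≤ ‖h‖ (1 - ψ n).
  let hψ' : ℕ → C_c(Z, ℝ) := fun n => ⟨⟨fun z => h z * ψ n z, by fun_prop⟩,
    (ψ n).hasCompactSupport.mul_left⟩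
  have lim1 : Tendsto (fun n => ∫ z, hψ' n z ∂π) atTop (𝓝 (∫ z, h z ∂π)) := by
    refine tendsto_integral_of_dominated_convergence (fun _ => ‖h‖)
      (fun n => (hψ' n).continuous.aestronglyMeasurable) (integrable_const _)
      (fun n => ae_of_all _ fun z => ?_) (ae_of_all _ fun z => ?_)
    · change ‖h z * ψ n z‖ ≤ ‖h‖
      rw [norm_mul, Real.norm_of_nonneg (hψ n z).1]
      exact (mul_le_of_le_one_right (norm_nonneg _) (hψ n z).2).trans (h.norm_coe_le_norm z)
    · have := (hlim z).const_mul (h z)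
      rwa [mul_one] at this
  have lim2 : Tendsto (fun n => L (hψ' n).toBoundedContinuousFunction) atTop (𝓝 (L h)) := by
    rw [tendsto_iff_norm_sub_tendsto_zero]
    refine squeeze_zero (fun _ => norm_nonneg _) (fun n => ?_)
      (by simpa only [mul_zero] using htight.const_mul ‖h‖)
    have hb : ∀ z, |h z * ψ n z - h z| ≤ ‖h‖ * (1 - ψ n z) := fun z => by
      have : h z * ψ n z - h z = -(h z * (1 - ψ n z)) := by ring
      rw [this, abs_neg, abs_mul, abs_of_nonneg (sub_nonneg.2 (hψ n z).2)]
      exact mul_le_mul_of_nonneg_right (h.norm_coe_le_norm z) (sub_nonneg.2 (hψ n z).2)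
    have h1 := hmono ((hψ' n).toBoundedContinuousFunction - h)
      (‖h‖ • (1 - (ψ n).toBoundedContinuousFunction)) fun z => (abs_le.1 (hb z)).2
    have h2 := hmono (-(‖h‖ • (1 - (ψ n).toBoundedContinuousFunction)))
      ((hψ' n).toBoundedContinuousFunction - h) fun z => (abs_le.1 (hb z)).1
    rw [map_sub, map_smul, smul_eq_mul] at h1
    rw [map_sub, map_neg, map_smul, smul_eq_mul] at h2
    exact abs_le.2 ⟨h2, h1⟩
  simp only [hπ] at lim1
  exact tendsto_nhds_unique lim2 lim1

variable {ι : Type*} [Fintype ι] {Y : Type*} [TopologicalSpace Y] [MeasurableSpace Y]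

/-- The final inequality bounds the mass lost on the product by the masses lost in the marginals. It
holds because ψ n is 1 on the power of the compact set outside of which χ n vanishes. -/
theorem exists_cutoff_sequences (ι : Type*) [Fintype ι] (Y : Type*) [TopologicalSpace Y] [T2Space Y]
    [LocallyCompactSpace Y] [SigmaCompactSpace Y] :
    ∃ (χ : ℕ → Y →ᵇ ℝ) (ψ : ℕ → C_c(ι → Y, ℝ)), (∀ n y, χ n y ∈ Icc (0 : ℝ) 1) ∧
      (∀ n z, ψ n z ∈ Icc (0 : ℝ) 1) ∧ (∀ y, Tendsto (fun n => χ n y) atTop (𝓝 1)) ∧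
      (∀ z, Tendsto (fun n => ψ n z) atTop (𝓝 1)) ∧
      ∀ n z, 1 - ψ n z ≤ ∑ j, (1 - χ n (z j)) := by
  obtain ⟨Q⟩ := (inferInstance : Nonempty (CompactExhaustion Y))
  have h1 : ∀ n, ∃ f : C(Y, ℝ), EqOn f 1 (Q n) ∧ EqOn f 0 (interior (Q (n + 1)))ᶜ ∧
      HasCompactSupport f ∧ ∀ x, f x ∈ Icc (0 : ℝ) 1 := fun n =>
    exists_continuous_one_zero_of_isCompact (Q.isCompact n) isOpen_interior.isClosed_compl
      (disjoint_compl_right_iff_subset.2 (Q.subset_interior_succ n))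
  have h2 : ∀ n, ∃ f : C(ι → Y, ℝ), EqOn f 1 (univ.pi fun _ => Q (n + 1)) ∧ EqOn f 0 ∅ ∧
      HasCompactSupport f ∧ ∀ x, f x ∈ Icc (0 : ℝ) 1 := fun n =>
    exists_continuous_one_zero_of_isCompact (isCompact_univ_pi fun _ => Q.isCompact _)
      isClosed_empty (by simp)
  choose f f1 f0 _ fI using h1
  choose g g1 _ gc gI using h2
  have f_ev : ∀ y, ∀ᶠ n in atTop, f n y = 1 := fun y => by
    obtain ⟨m, hm⟩ := Q.exists_mem y
    filter_upwards [eventually_ge_atTop m] with n hn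
    exact f1 n (Q.subset hn hm)
  refine ⟨fun n => BoundedContinuousFunction.ofNormedAddCommGroup (f n) (f n).continuous 1
    fun y => ?_, fun n => ⟨g n, gc n⟩, fI, gI, fun y => ?_, fun z => ?_, fun n z => ?_⟩
  · rw [Real.norm_of_nonneg (fI n y).1]
    exact (fI n y).2
  · exact tendsto_const_nhds.congr' ((f_ev y).mono fun n hn => hn.symm)
  · refine tendsto_const_nhds.congr' ?_
    filter_upwards [eventually_all.2 fun j => f_ev (z j)] with n hn
    refine (g1 n fun j _ => ?_).symm
    by_contra hj
    have h0 := f0 n (show z j ∈ (interior (Q (n + 1)))ᶜ from fun h => hj (interior_subset h))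
    rw [hn j] at h0
    simp at h0
  · change 1 - g n z ≤ ∑ j, (1 - f n (z j))
    by_cases hz : ∀ j, z j ∈ Q (n + 1)
    · rw [g1 n fun j _ => hz j]
      rw [Pi.one_apply, sub_self]
      exact Finset.sum_nonneg fun j _ => sub_nonneg.2 (fI n (z j)).2
    · push Not at hz
      obtain ⟨j, hj⟩ := hz
      have h0 := f0 n (show z j ∈ (interior (Q (n + 1)))ᶜ from fun h => hj (interior_subset h))
      have h3 : 1 - f n (z j) ≤ ∑ j, (1 - f n (z j)) :=
        Finset.single_le_sum (f := fun j => 1 - f n (z j))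
          (fun j _ => sub_nonneg.2 (fI n (z j)).2) (Finset.mem_univ j)
      rw [h0, Pi.zero_apply, sub_zero] at h3
      linarith [(gI n z).1]

/-- **Multimarginal Kantorovich duality** with existence of an optimal plan. -/
theorem exists_multimarginal_plan [Nonempty ι] [Nonempty Y] [BorelSpace Y] [T2Space Y]
    [LocallyCompactSpace Y] [SecondCountableTopology Y]
    (μ : ι → Measure Y) [∀ j, IsProbabilityMeasure (μ j)] {c : (ι → Y) → ℝ≥0∞}
    (hc : LowerSemicontinuous c) (D : ℝ)
    (hD : ∀ φ : ι → Y →ᵇ ℝ, (∀ z, ENNReal.ofReal (∑ j, φ j (z j)) ≤ c z) →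
      ∑ j, ∫ y, φ j y ∂(μ j) ≤ D) :
    ∃ π : Measure (ι → Y), IsProbabilityMeasure π ∧ (∀ j, π.map (fun z => z j) = μ j) ∧
      ∫⁻ z, c z ∂π ≤ ENNReal.ofReal D := by
  classical
  obtain ⟨L, hpos, hmarg, hLD⟩ := exists_positive_functional μ c D hD
  obtain ⟨χ, ψ, hχ, hψ, hχ1, hψ1, hχψ⟩ := exists_cutoff_sequences ι Y
  -- Tightness of the functional is inherited from the marginals by positivity.
  have hLψ : ∀ n, L (1 - (ψ n).toBoundedContinuousFunction) ≤ ∑ j, ∫ y, (1 - χ n y) ∂(μ j) := by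
    intro n
    have h1 := hpos (coordSum (fun _ => 1 - χ n) - (1 - (ψ n).toBoundedContinuousFunction))
      fun z => by
        have := hχψ n z
        simpa [- Finset.sum_sub_distrib] using this
    rw [map_sub, hmarg, sub_nonneg] at h1
    simpa using h1
  have hlim : Tendsto (fun n => ∑ j, ∫ y, (1 - χ n y) ∂(μ j)) atTop (𝓝 0) := by
    have : ∀ j, Tendsto (fun n => ∫ y, (1 - χ n y) ∂(μ j)) atTop (𝓝 (∫ y, 0 ∂(μ j))) := fun j => by
      refine tendsto_integral_of_dominated_convergence (fun _ => 1)
        (fun n => (continuous_const.sub (χ n).continuous).aestronglyMeasurable) (integrable_const _)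
        (fun n => ae_of_all _ fun y => ?_) (ae_of_all _ fun y => ?_)
      · rw [Real.norm_of_nonneg (sub_nonneg.2 (hχ n y).2)]
        linarith [(hχ n y).1]
      · simpa using (hχ1 y).const_sub 1
    simpa using tendsto_finsetSum Finset.univ fun j _ => this j
  obtain ⟨π, hfin, hπ⟩ := exists_measure_of_tight_functional L hpos ψ hψ hψ1
    (squeeze_zero (fun n => hpos _ fun z => sub_nonneg.2 (hψ n z).2) hLψ hlim)
  have hmap : ∀ j, π.map (fun z => z j) = μ j := fun j => by
    refine ext_of_forall_integral_eq_of_IsFiniteMeasure fun φ => ?_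
    rw [integral_map (measurable_pi_apply j).aemeasurable φ.continuous.aestronglyMeasurable]
    have h1 := hmarg (Pi.single j φ)
    have h2 : ∀ z : ι → Y, ∑ i, (Pi.single j φ : ι → Y →ᵇ ℝ) i (z i) = φ (z j) := fun z => by
      rw [Finset.sum_eq_single j] <;> simp +contextual
    have h3 : ∑ i, ∫ y, (Pi.single j φ : ι → Y →ᵇ ℝ) i y ∂(μ i) = ∫ y, φ y ∂(μ j) := by
      rw [Finset.sum_eq_single j] <;> simp +contextual
    rw [hπ, h3] at h1
    simpa [h2] using h1
  have hprob : IsProbabilityMeasure π := by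
    obtain ⟨j⟩ := ‹Nonempty ι›
    refine ⟨?_⟩
    have := congr($(hmap j) univ)
    rwa [Measure.map_apply (measurable_pi_apply j) MeasurableSet.univ, measure_univ,
      preimage_univ] at this
  refine ⟨π, hprob, hmap, ?_⟩
  -- The functional is at most D on each bounded continuous minorant of c; monotone convergence
  -- passes to c.
  obtain ⟨h, h0, hmono, hsup⟩ := exists_monotone_boundedContinuous_iSup_eq hc
  simp_rw [← hsup]
  rw [lintegral_iSup (fun n => (h n).continuous.measurable.ennreal_ofReal)
    fun n m hnm z => ENNReal.ofReal_le_ofReal (hmono z hnm)]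
  refine iSup_le fun n => ?_
  rw [← ofReal_integral_eq_lintegral_ofReal ((h n).integrable _) (ae_of_all _ fun z => h0 n z), ← hπ]
  refine ENNReal.ofReal_le_ofReal (hLD _ fun z => ?_)
  rw [← hsup]
  exact le_iSup (fun n => ENNReal.ofReal (h n z)) n

end Duality

end AdvMOT

namespace AdvMOT

/-! ### Optimal transport between two measures: duality and joint convexity -/

section TwoMarginals

open BoundedContinuousFunction

variable {α : Type*} [MeasurableSpace α] {c : α → α → ℝ≥0∞}

theorem transportCost_le_lintegral {μ ν : Measure α} {γ : Measure (α × α)}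
    (h : IsCoupling μ ν γ) : transportCost c μ ν ≤ ∫⁻ p, c p.1 p.2 ∂γ :=
  iInf₂_le γ h

theorem exists_coupling_of_transportCost_lt {μ ν : Measure α} {r : ℝ≥0∞}
    (h : transportCost c μ ν < r) : ∃ γ, IsCoupling μ ν γ ∧ ∫⁻ p, c p.1 p.2 ∂γ < r := by
  simpa [transportCost, iInf_lt_iff] using h

theorem IsCoupling.measure_univ_eq {μ ν : Measure α} {γ : Measure (α × α)}
    (h : IsCoupling μ ν γ) : γ univ = μ univ := by
  rw [← h.1, Measure.map_apply measurable_fst MeasurableSet.univ, preimage_univ]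

theorem IsCoupling.measure_univ_eq' {μ ν : Measure α} {γ : Measure (α × α)}
    (h : IsCoupling μ ν γ) : γ univ = ν univ := by
  rw [← h.2, Measure.map_apply measurable_snd MeasurableSet.univ, preimage_univ]

theorem measure_univ_eq_of_transportCost_ne_top {μ ν : Measure α}
    (h : transportCost c μ ν ≠ ⊤) : μ univ = ν univ := by
  obtain ⟨γ, hγ, -⟩ := exists_coupling_of_transportCost_lt h.lt_top
  rw [← hγ.measure_univ_eq, hγ.measure_univ_eq']

/-- Weak duality for the transport problem. -/
theorem lintegral_add_le_transportCost {μ ν : Measure α} {a b : α → ℝ≥0∞} (ha : Measurable a)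
    (hb : Measurable b) {N : ℝ≥0∞} (h : ∀ x y, a x + b y ≤ c x y + N) :
    ∫⁻ x, a x ∂μ + ∫⁻ y, b y ∂ν ≤ transportCost c μ ν + N * μ univ := by
  simp only [transportCost, ENNReal.iInf_add]
  refine le_iInf₂ fun γ hγ => ?_
  calc ∫⁻ x, a x ∂μ + ∫⁻ y, b y ∂ν = ∫⁻ p, (a p.1 + b p.2) ∂γ := by
        have h1 := lintegral_map (μ := γ) ha measurable_fst
        have h2 := lintegral_map (μ := γ) hb measurable_snd
        rw [hγ.1] at h1
        rw [hγ.2] at h2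
        rw [h1, h2]
        exact (lintegral_add_left (ha.comp measurable_fst) _).symm
    _ ≤ ∫⁻ p, (c p.1 p.2 + N) ∂γ := lintegral_mono fun p => h p.1 p.2
    _ = _ := by rw [lintegral_add_right _ measurable_const, lintegral_const, hγ.measure_univ_eq]

theorem toReal_lintegral_add_norm [TopologicalSpace α] [OpensMeasurableSpace α] (μ : Measure α)
    [IsFiniteMeasure μ] (φ : α →ᵇ ℝ) :
    ∫⁻ x, ENNReal.ofReal (φ x + ‖φ‖) ∂μ = ENNReal.ofReal (∫ x, φ x ∂μ + ‖φ‖ * μ.real univ) ∧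
      0 ≤ ∫ x, φ x ∂μ + ‖φ‖ * μ.real univ := by
  have h0 : ∀ x, 0 ≤ φ x + ‖φ‖ := fun x => by
    linarith [neg_le_of_abs_le (φ.norm_coe_le_norm x)]
  have h1 : ∫ x, (φ x + ‖φ‖) ∂μ = ∫ x, φ x ∂μ + ‖φ‖ * μ.real univ := by
    rw [integral_add (φ.integrable μ) (integrable_const _), integral_const, smul_eq_mul, mul_comm]
  rw [← h1]
  exact ⟨(ofReal_integral_eq_lintegral_ofReal ((φ.integrable μ).add (integrable_const _))
    (ae_of_all _ h0)).symm, integral_nonneg h0⟩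

/-- Strong duality for the transport problem between finite measures of the same mass. -/
theorem transportCost_le_of_potentials [TopologicalSpace α] [T2Space α] [LocallyCompactSpace α]
    [SecondCountableTopology α] [BorelSpace α]
    (hc : LowerSemicontinuous fun p : α × α => c p.1 p.2) (μ ν : Measure α) [IsFiniteMeasure μ]
    (hmass : μ univ = ν univ) (D : ℝ≥0∞)
    (hD : ∀ a b : α → ℝ≥0∞, Measurable a → Measurable b → ∀ N : ℝ≥0∞, N ≠ ⊤ →
      (∀ x y, a x + b y ≤ c x y + N) → ∫⁻ x, a x ∂μ + ∫⁻ y, b y ∂ν ≤ D + N * μ univ) :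
    transportCost c μ ν ≤ D := by
  rcases eq_or_ne D ⊤ with rfl | hDtop
  · exact le_top
  have : IsFiniteMeasure ν := ⟨by rw [← hmass]; exact measure_lt_top _ _⟩
  rcases eq_or_ne μ 0 with rfl | hμ
  · have hν : ν = 0 := by simpa using hmass.symm
    subst hν
    refine (transportCost_le_lintegral (γ := 0) ⟨by simp, by simp⟩).trans (by simp)
  have hν : ν ≠ 0 := by
    rintro rfl
    exact hμ (by simpa using hmass)
  obtain ⟨x₀⟩ : Nonempty α := by
    by_contra h
    rw [not_nonempty_iff] at h
    exact hμ (Measure.eq_zero_of_isEmpty μ)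
  have : Nonempty α := ⟨x₀⟩
  set m := μ univ with hm
  have hm0 : m ≠ 0 := by simpa [hm] using hμ
  have hmtop : m ≠ ⊤ := measure_ne_top _ _
  have hmR : 0 < m.toReal := ENNReal.toReal_pos hm0 hmtop
  -- Both measures are normalized to probabilities, so the bound D is divided by their common mass.
  let P : Fin 2 → Measure α := ![m⁻¹ • μ, m⁻¹ • ν]
  have hP : ∀ j, IsProbabilityMeasure (P j) := by
    have : m⁻¹ * m = 1 := ENNReal.inv_mul_cancel hm0 hmtop
    refine Fin.forall_fin_two.2 ⟨⟨?_⟩, ⟨?_⟩⟩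
    · simpa [P] using this
    · simpa [P, ← hmass] using this
  have hc' : LowerSemicontinuous fun z : Fin 2 → α => c (z 0) (z 1) :=
    hc.comp (g := fun z : Fin 2 → α => (z 0, z 1)) (by fun_prop)
  obtain ⟨π, hπ, hπm, hπc⟩ := exists_multimarginal_plan P hc' (D.toReal / m.toReal) fun φ hφ => by
    -- Adding the norms makes the potentials nonnegative; the constant N = ‖φ 0‖ + ‖φ 1‖
    -- compensates.
    have h1 := hD (fun x => ENNReal.ofReal (φ 0 x + ‖φ 0‖)) (fun x => ENNReal.ofReal (φ 1 x + ‖φ 1‖))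
      (by fun_prop) (by fun_prop) (ENNReal.ofReal (‖φ 0‖ + ‖φ 1‖)) ENNReal.ofReal_ne_top
      fun x y => by
        have h0 : ∀ j x, 0 ≤ φ j x + ‖φ j‖ := fun j x => by
          linarith [neg_le_of_abs_le ((φ j).norm_coe_le_norm x)]
        have h2 := hφ ![x, y]
        simp only [Fin.sum_univ_two, Matrix.cons_val_zero, Matrix.cons_val_one] at h2
        rw [← ENNReal.ofReal_add (h0 _ _) (h0 _ _)]
        calc ENNReal.ofReal (φ 0 x + ‖φ 0‖ + (φ 1 y + ‖φ 1‖))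
            = ENNReal.ofReal ((φ 0 x + φ 1 y) + (‖φ 0‖ + ‖φ 1‖)) := by congr 1; ring
          _ ≤ _ := ENNReal.ofReal_add_le.trans (by gcongr)
    obtain ⟨e0, p0⟩ := toReal_lintegral_add_norm μ (φ 0)
    obtain ⟨e1, p1⟩ := toReal_lintegral_add_norm ν (φ 1)
    have hνr : ν.real univ = m.toReal := by rw [Measure.real, ← hmass]
    have hμr : μ.real univ = m.toReal := rfl
    rw [e0, e1, ← ENNReal.ofReal_add p0 p1, ← ENNReal.ofReal_toReal hDtop,
      ← ENNReal.ofReal_toReal hmtop, ← ENNReal.ofReal_mul (by positivity),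
      ← ENNReal.ofReal_add (by positivity) (by positivity),
      ENNReal.ofReal_le_ofReal_iff (by positivity), hνr, hμr] at h1
    have hI : ∫ x, φ 0 x ∂μ + ∫ x, φ 1 x ∂ν ≤ D.toReal := by linarith
    simp only [Fin.sum_univ_two, P, Matrix.cons_val_zero, Matrix.cons_val_one,
      integral_smul_measure, ENNReal.toReal_inv, smul_eq_mul]
    rw [le_div_iff₀ hmR]
    field_simp
    exact hI
  have hz : Measurable fun z : Fin 2 → α => (z 0, z 1) := by fun_prop
  have hcoup : IsCoupling μ ν (m • π.map fun z => (z 0, z 1)) := by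
    have key : ∀ ρ : Measure α, m • (m⁻¹ • ρ) = ρ := fun ρ => by
      rw [smul_smul, ENNReal.mul_inv_cancel hm0 hmtop, one_smul]
    constructor
    · rw [Measure.map_smul, Measure.map_map measurable_fst hz]
      exact (congrArg _ (hπm 0)).trans (key μ)
    · rw [Measure.map_smul, Measure.map_map measurable_snd hz]
      exact (congrArg _ (hπm 1)).trans (key ν)
  refine (transportCost_le_lintegral hcoup).trans ?_
  rw [lintegral_smul_measure, lintegral_map hc.measurable hz]
  calc m • ∫⁻ z, c (z 0) (z 1) ∂π ≤ m * ENNReal.ofReal (D.toReal / m.toReal) := by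
        rw [smul_eq_mul]
        gcongr
    _ = D := by
        rw [ENNReal.ofReal_div_of_pos hmR, ENNReal.ofReal_toReal hDtop, ENNReal.ofReal_toReal hmtop,
          ENNReal.mul_div_cancel hm0 hmtop]

/-- The transport cost is jointly convex: it decreases under mixtures. -/
theorem transportCost_bind_le [TopologicalSpace α] [T2Space α] [LocallyCompactSpace α]
    [SecondCountableTopology α] [BorelSpace α]
    (hc : LowerSemicontinuous fun p : α × α => c p.1 p.2) {A : Type*} [MeasurableSpace A]
    (π : Measure A) (P Q : ProbabilityTheory.Kernel A α) [IsFiniteMeasure (π.bind P)]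
    (hmass : ∀ a, P a univ = Q a univ) :
    transportCost c (π.bind P) (π.bind Q) ≤ ∫⁻ a, transportCost c (P a) (Q a) ∂π := by
  have hb : ∀ (R : ProbabilityTheory.Kernel A α) (f : α → ℝ≥0∞), Measurable f →
      ∫⁻ x, f x ∂(π.bind R) = ∫⁻ a, ∫⁻ x, f x ∂(R a) ∂π := fun R f hf =>
    Measure.lintegral_bind R.measurable.aemeasurable hf.aemeasurable
  -- The dual functional is linear in the pair of measures, so weak duality for each parameter can
  -- be integrated. No measurable choice of couplings is needed, nor measurability of the cost in
  -- the parameter.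
  refine transportCost_le_of_potentials hc _ _ ?_ _ fun a b ha hb' N _ h => ?_
  · simp only [Measure.bind_apply MeasurableSet.univ (ProbabilityTheory.Kernel.aemeasurable _), hmass]
  · rw [hb P a ha, hb Q b hb', Measure.bind_apply MeasurableSet.univ P.aemeasurable,
      ← lintegral_const_mul _ (P.measurable_coe MeasurableSet.univ),
      ← lintegral_add_left (ha.lintegral_kernel),
      ← lintegral_add_right _ ((P.measurable_coe MeasurableSet.univ).const_mul N)]
    exact lintegral_mono fun x => lintegral_add_le_transportCost ha hb' h

end TwoMarginals

end AdvMOT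

namespace AdvMOT

/-! ### Infima of semicontinuous functions and measurable selection -/

section Selection

open Filter Topology

section Infimum

variable {A P : Type*} [TopologicalSpace A] [TopologicalSpace P] {Φ : A → P → ℝ≥0∞}

/-- Locally uniform compactness of the sublevel sets of `Φ a`. -/
def LocallyInfCompact (Φ : A → P → ℝ≥0∞) : Prop :=
  ∀ a, ∀ r < ⊤, ∃ Q, IsCompact Q ∧ ∀ᶠ a' in 𝓝 a, ∀ y, Φ a' y ≤ r → y ∈ Q

/-- For parameters near a, values at most t' occur only in one compact set Q, and on the compact set
Q ∩ C the lower bound t' holds uniformly near a. -/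
theorem lowerSemicontinuous_biInf_of_locallyInfCompact
    (hΦ : LowerSemicontinuous fun p : A × P => Φ p.1 p.2) (hp : LocallyInfCompact Φ) {C : Set P}
    (hC : IsClosed C) : LowerSemicontinuous fun a => ⨅ y ∈ C, Φ a y := by
  intro a t ht
  obtain ⟨t', ht', hlt⟩ := exists_between ht
  obtain ⟨Q, hQ, hev⟩ := hp a t' (hlt.trans_le le_top)
  have h1 : ∀ᶠ a' in 𝓝 a, ∀ y ∈ Q ∩ C, t' < Φ a' y :=
    (hQ.inter_right hC).eventually_forall_of_forall_eventually fun y hy =>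
      hΦ (a, y) t' (hlt.trans_le (iInf₂_le y hy.2))
  filter_upwards [hev, h1] with a' h2 h3
  refine ht'.trans_le (le_iInf₂ fun y hy => ?_)
  by_contra! h
  exact (h3 y ⟨h2 y h.le, hy⟩).not_gt h

theorem exists_eq_biInf_of_locallyInfCompact
    (hΦ : LowerSemicontinuous fun p : A × P => Φ p.1 p.2) (hp : LocallyInfCompact Φ) {C : Set P}
    (hC : IsClosed C) (hne : C.Nonempty) (a : A) : ∃ y ∈ C, Φ a y = ⨅ y ∈ C, Φ a y := by
  rcases eq_or_ne (⨅ y ∈ C, Φ a y) ⊤ with h | h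
  · obtain ⟨y, hy⟩ := hne
    refine ⟨y, hy, ?_⟩
    rw [h]
    exact top_le_iff.1 (h ▸ iInf₂_le y hy)
  obtain ⟨r, hr, hrt⟩ := exists_between h.lt_top
  obtain ⟨Q, hQ, hev⟩ := hp a r hrt
  have hQa := hev.self_of_nhds
  obtain ⟨y₀, hy₀, hy₀r⟩ : ∃ y ∈ C, Φ a y < r := by simpa [iInf_lt_iff] using hr
  obtain ⟨y, hy, hmin⟩ := LowerSemicontinuousOn.exists_isMinOn (f := Φ a) (s := Q ∩ C)
    ⟨y₀, hQa _ hy₀r.le, hy₀⟩ (hQ.inter_right hC)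
    ((hΦ.comp (g := fun y : P => (a, y)) (by fun_prop)).lowerSemicontinuousOn _)
  refine ⟨y, hy.2, le_antisymm (le_iInf₂ fun y' hy' => ?_) (iInf₂_le y hy.2)⟩
  by_cases hyQ : y' ∈ Q
  · exact hmin ⟨hyQ, hy'⟩
  · refine (hmin ⟨hQa _ hy₀r.le, hy₀⟩).trans (hy₀r.le.trans ?_)
    by_contra! h'
    exact hyQ (hQa _ h'.le)

theorem LocallyInfCompact.of_compactSpace [CompactSpace P] : LocallyInfCompact Φ :=
  fun _ _ _ => ⟨univ, isCompact_univ, by simp⟩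

end Infimum

/-- **Kuratowski–Ryll-Nardzewski selection theorem**, for closed hitting sets. -/
theorem exists_measurable_selection {A P : Type*} [MeasurableSpace A] [MetricSpace P]
    [CompleteSpace P] [SecondCountableTopology P] [MeasurableSpace P] [BorelSpace P] [Nonempty P] (F : A → Set P)
    (hF : ∀ a, IsClosed (F a)) (hne : ∀ a, (F a).Nonempty)
    (hmeas : ∀ C, IsClosed C → MeasurableSet {a | (F a ∩ C).Nonempty}) :
    ∃ s : A → P, Measurable s ∧ ∀ a, s a ∈ F a := by
  classical
  let d := TopologicalSpace.denseSeq P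
  -- A list records, latest first, the chosen indices of a dense sequence; `B` intersects the
  -- corresponding balls, whose radii halve at each choice.
  obtain ⟨B, B_nil, B_cons⟩ : ∃ B : List ℕ → Set P, B [] = univ ∧
      ∀ n l, B (n :: l) = B l ∩ Metric.closedBall (d n) ((1 / 2 : ℝ) ^ l.length) :=
    ⟨fun l => l.rec univ fun n l B => B ∩ Metric.closedBall (d n) ((1 / 2 : ℝ) ^ l.length), rfl,
      fun _ _ => rfl⟩
  have B_closed : ∀ l, IsClosed (B l) := fun l => by
    induction l with
    | nil => exact B_nil ▸ isClosed_univ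
    | cons n l ih => exact B_cons n l ▸ ih.inter Metric.isClosed_closedBall
  -- Always the least index whose ball keeps the intersection with `F a` nonempty. Being least makes
  -- the choice measurable.
  obtain ⟨S, S_zero, S_succ⟩ : ∃ S : ℕ → A → List ℕ, (∀ a, S 0 a = []) ∧
      ∀ k a, S (k + 1) a = sInf {n | (F a ∩ B (n :: S k a)).Nonempty} :: S k a :=
    ⟨fun k a => k.rec [] fun _ l => sInf {n | (F a ∩ B (n :: l)).Nonempty} :: l, fun _ => rfl,
      fun _ _ => rfl⟩
  have S_len : ∀ k a, (S k a).length = k := fun k a => by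
    induction k with
    | zero => rw [S_zero, List.length_nil]
    | succ k ih => rw [S_succ, List.length_cons, ih]
  have ex : ∀ a l, (F a ∩ B l).Nonempty → ∃ n, (F a ∩ B (n :: l)).Nonempty := by
    rintro a l ⟨y, hyF, hyB⟩
    obtain ⟨n, hn⟩ := (TopologicalSpace.denseRange_denseSeq P).exists_dist_lt y
      (show (0 : ℝ) < (1 / 2 : ℝ) ^ l.length by positivity)
    exact ⟨n, y, hyF, B_cons n l ▸ ⟨hyB, hn.le⟩⟩
  have S_ne : ∀ k a, (F a ∩ B (S k a)).Nonempty := fun k a => by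
    induction k with
    | zero => simpa [S_zero, B_nil] using hne a
    | succ k ih => exact S_succ k a ▸ Nat.sInf_mem (ex a _ ih)
  have F_meas : ∀ l, MeasurableSet {a | (F a ∩ B l).Nonempty} := fun l => hmeas _ (B_closed l)
  have S_meas : ∀ k l, MeasurableSet {a | S k a = l} := fun k => by
    induction k with
    | zero => exact fun l => by simp only [S_zero, MeasurableSet.const]
    | succ k ih =>
      intro l
      rcases l with _ | ⟨n, l⟩
      · simp [S_succ]
      have : {a | S (k + 1) a = n :: l} = {a | S k a = l} ∩ ({a | (F a ∩ B (n :: l)).Nonempty} ∩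
          ⋂ m < n, {a | (F a ∩ B (m :: l)).Nonempty}ᶜ) := by
        ext a
        simp only [S_succ, List.cons.injEq, mem_ofPred_eq, mem_inter_iff, mem_iInter, mem_compl_iff]
        constructor
        · rintro ⟨h1, rfl⟩
          have hex := ex a _ (S_ne k a)
          exact ⟨rfl, h1 ▸ Nat.sInf_mem hex, fun m hm hm' => (Nat.sInf_le hm').not_gt (h1 ▸ hm)⟩
        · rintro ⟨rfl, h1, h2⟩
          refine ⟨le_antisymm (Nat.sInf_le h1) ?_, rfl⟩
          by_contra! hlt
          exact h2 _ hlt (Nat.sInf_mem (s := {n | (F a ∩ B (n :: S k a)).Nonempty}) ⟨n, h1⟩)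
      rw [this]
      exact (ih l).inter ((F_meas _).inter
        (MeasurableSet.iInter fun m => MeasurableSet.iInter fun _ => (F_meas _).compl))
  let p : ℕ → A → P := fun k a => d (S (k + 1) a).headI
  have p_meas : ∀ k, Measurable (p k) := fun k => by
    let _ : MeasurableSpace (List ℕ) := ⊤
    have h1 : Measurable (S (k + 1)) := measurable_to_countable' fun l => S_meas (k + 1) l
    exact (measurable_from_top (f := fun l : List ℕ => d l.headI)).comp h1
  choose y hyF hyB using S_ne
  -- A point of `F a` in the later intersections stays within (1/2)^j of the j-th centre; so the
  -- centres form a Cauchy sequence whose limit lies in the closed set `F a`.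
  have hy : ∀ a j k, j ≤ k → dist (y (k + 1) a) (p j a) ≤ (1 / 2 : ℝ) ^ j := by
    intro a j k hjk
    have mono : ∀ m, B (S (j + 1 + m) a) ⊆ B (S (j + 1) a) := fun m => by
      induction m with
      | zero => exact le_rfl
      | succ m ih =>
        rw [← add_assoc, S_succ, B_cons]
        exact inter_subset_left.trans ih
    have h1 : y (k + 1) a ∈ B (S (j + 1) a) := by
      obtain ⟨m, rfl⟩ := Nat.exists_eq_add_of_le hjk
      apply mono m
      rw [add_right_comm]
      exact hyB (j + m + 1) a
    rw [S_succ, B_cons, S_len] at h1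
    simpa [p, S_succ] using h1.2
  have hcau : ∀ a, CauchySeq fun k => p k a := fun a => by
    refine cauchySeq_of_le_geometric (1 / 2) 2 (by norm_num) fun k => ?_
    have h1 := hy a k (k + 1) (by omega)
    have h2 := hy a (k + 1) (k + 1) le_rfl
    have h3 := dist_triangle_left (p k a) (p (k + 1) a) (y (k + 1 + 1) a)
    have h4 : (1 / 2 : ℝ) ^ (k + 1) ≤ (1 / 2 : ℝ) ^ k :=
      pow_le_pow_of_le_one (by norm_num) (by norm_num) (by omega)
    linarith
  choose s hs using fun a => cauchySeq_tendsto_of_complete (hcau a)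
  refine ⟨s, measurable_of_tendsto_metrizable p_meas (tendsto_pi_nhds.2 hs), fun a => ?_⟩
  refine (hF a).mem_of_tendsto (b := atTop) (f := fun k => y (k + 1) a) ?_ (Eventually.of_forall fun k => hyF _ a)
  refine (tendsto_iff_of_dist ?_).1 (hs a)
  refine squeeze_zero (fun _ => dist_nonneg) (fun k => ?_)
    (tendsto_pow_atTop_nhds_zero_of_lt_one (r := (1 / 2 : ℝ)) (by norm_num) (by norm_num))
  rw [dist_comm]
  exact hy a k k le_rfl

/-- Measurable selection of a minimizer. -/
theorem exists_measurable_argmin {A P : Type*} [TopologicalSpace A] [MeasurableSpace A]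
    [OpensMeasurableSpace A] [TopologicalSpace P] [PolishSpace P] [MeasurableSpace P] [BorelSpace P]
    [Nonempty P] {Φ : A → P → ℝ≥0∞}
    (hΦ : LowerSemicontinuous fun p : A × P => Φ p.1 p.2) (hp : LocallyInfCompact Φ) :
    ∃ s : A → P, Measurable s ∧ ∀ a, Φ a (s a) = ⨅ y, Φ a y := by
  let _ := TopologicalSpace.upgradeIsCompletelyMetrizable P
  have huniv : ∀ a, ⨅ y, Φ a y = ⨅ y ∈ univ, Φ a y := by simp
  have hm : ∀ C : Set P, IsClosed C → Measurable fun a => ⨅ y ∈ C, Φ a y := fun C hC =>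
    (lowerSemicontinuous_biInf_of_locallyInfCompact hΦ hp hC).measurable
  obtain ⟨s, hs, hs'⟩ := exists_measurable_selection (fun a => {y | Φ a y ≤ ⨅ y, Φ a y})
    (fun a => (hΦ.comp (g := fun y : P => (a, y)) (by fun_prop)).isClosed_preimage _)
    (fun a => by
      obtain ⟨y, -, hy⟩ := exists_eq_biInf_of_locallyInfCompact hΦ hp isClosed_univ univ_nonempty a
      exact ⟨y, by simpa using hy.le⟩)
    fun C hC => by
      rcases C.eq_empty_or_nonempty with rfl | hne
      · simp
      -- The set of minimizers meets C exactly when the infimum over C is no larger than the global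
      -- one, because the infimum over C is attained.
      have : {a | ({y | Φ a y ≤ ⨅ y, Φ a y} ∩ C).Nonempty} =
          {a | ⨅ y ∈ C, Φ a y ≤ ⨅ y ∈ univ, Φ a y} := by
        ext a
        simp only [mem_ofPred_eq, ← huniv]
        constructor
        · rintro ⟨y, hy, hyC⟩
          exact (iInf₂_le y hyC).trans hy
        · intro h
          obtain ⟨y, hy, hmin⟩ := exists_eq_biInf_of_locallyInfCompact hΦ hp hC hne a
          exact ⟨y, hmin.le.trans h, hy⟩
      rw [this]
      exact measurableSet_le (hm C hC) (hm univ isClosed_univ)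
  exact ⟨s, hs, fun a => le_antisymm (hs' a) (iInf_le _ _)⟩

end Selection

end AdvMOT

namespace AdvMOT

/-! ### Class decomposition, Bayes classifiers and the barycenter problem -/

section ClassParts

variable {X : Type*} [MeasurableSpace X] {K : ℕ}

theorem sum_restrict_fiber {α : Type*} [MeasurableSpace α] (μ : Measure α) {k : α → Fin K}
    (hk : Measurable k) : ∑ i, μ.restrict (k ⁻¹' {i}) = μ := by
  rw [← Measure.sum_fintype, ← Measure.restrict_iUnion _ fun i => hk (measurableSet_singleton i),
    ← preimage_iUnion, iUnion_of_singleton, preimage_univ, Measure.restrict_univ]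
  intro i j hij
  exact (disjoint_singleton.2 hij).preimage k

theorem measurable_inClass (i : Fin K) : Measurable fun x : X => (x, i) :=
  measurable_id.prodMk measurable_const

theorem map_classPart (μ : Measure (X × Fin K)) (i : Fin K) :
    (classPart μ i).map (fun x => (x, i)) = μ.restrict (Prod.snd ⁻¹' {i}) := by
  rw [classPart, Measure.map_map (measurable_inClass i) measurable_fst]
  have : (fun x : X => (x, i)) ∘ Prod.fst =ᵐ[μ.restrict (Prod.snd ⁻¹' {i})] id := by
    filter_upwards [ae_restrict_mem (measurable_snd (measurableSet_singleton i))] with z hz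
    simp only [mem_preimage, mem_singleton_iff] at hz
    simp [← hz]
  rw [Measure.map_congr this, Measure.map_id]

theorem sum_map_classPart (μ : Measure (X × Fin K)) :
    ∑ i, (classPart μ i).map (fun x => (x, i)) = μ := by
  simp only [map_classPart]
  exact sum_restrict_fiber μ measurable_snd

theorem lintegral_eq_sum_classPart (μ : Measure (X × Fin K)) {g : X × Fin K → ℝ≥0∞}
    (hg : Measurable g) : ∫⁻ z, g z ∂μ = ∑ i, ∫⁻ x, g (x, i) ∂(classPart μ i) := by
  conv_lhs => rw [← sum_map_classPart μ]
  rw [lintegral_finsetSum_measure]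
  exact Finset.sum_congr rfl fun i _ => lintegral_map hg (measurable_inClass i)

theorem classPart_sum_map (ν : Fin K → Measure X) (i : Fin K) :
    classPart (∑ j, (ν j).map (fun x => (x, j))) i = ν i := by
  ext A hA
  rw [classPart_apply _ _ hA, Measure.finsetSum_apply, Finset.sum_eq_single i]
  · rw [Measure.map_apply (measurable_inClass i) (hA.prod (measurableSet_singleton i))]
    congr 1
    ext x
    simp
  · intro j _ hj
    rw [Measure.map_apply (measurable_inClass j) (hA.prod (measurableSet_singleton i))]
    convert measure_empty (μ := ν j)
    ext x
    simp [hj]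
  · simp

instance (μ : Measure (X × Fin K)) [IsFiniteMeasure μ] (i : Fin K) :
    IsFiniteMeasure (classPart μ i) := by
  unfold classPart
  infer_instance

theorem measurable_coord {f : X → Fin K → ℝ} (hf : Measurable f) (i : Fin K) :
    Measurable fun x => f x i :=
  (measurable_pi_apply i).comp hf

theorem measurable_uncurry_classifier {f : X → Fin K → ℝ} (hf : Measurable f) :
    Measurable fun z : X × Fin K => ENNReal.ofReal (f z.1 z.2) :=
  (measurable_from_prod_countable_left fun i => measurable_coord hf i).ennreal_ofReal

theorem power_eq_lintegral {f : X → Fin K → ℝ} (hf : Measurable f) (ν : Measure (X × Fin K)) :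
    power f ν = ∫⁻ z, ENNReal.ofReal (f z.1 z.2) ∂ν :=
  (lintegral_eq_sum_classPart ν (measurable_uncurry_classifier hf)).symm

/-- Almost optimal couplings of the class parts, each placed over its own label, add up to a label
preserving coupling. -/
theorem transportCost_labelCost_le {c : X → X → ℝ≥0∞} (hc : Measurable fun p : X × X => c p.1 p.2)
    (μ ν : Measure (X × Fin K)) :
    transportCost (labelCost c) μ ν ≤ ∑ i, transportCost c (classPart μ i) (classPart ν i) := by
  by_cases htop : ∃ i, transportCost c (classPart μ i) (classPart ν i) = ⊤
  · obtain ⟨i, hi⟩ := htop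
    rw [ENNReal.sum_eq_top.2 ⟨i, Finset.mem_univ i, hi⟩]
    exact le_top
  push Not at htop
  refine ENNReal.le_of_forall_pos_le_add fun ε hε _ => ?_
  have hε' : (ε / K : ℝ≥0∞) ≠ 0 := by simp [hε.ne']
  choose γ hγ hγc using fun i =>
    exists_coupling_of_transportCost_lt (ENNReal.lt_add_right (htop i) hε')
  let e : Fin K → X × X → (X × Fin K) × (X × Fin K) := fun i p => ((p.1, i), (p.2, i))
  have he : ∀ i, Measurable (e i) := fun i => by fun_prop
  have hcoup : IsCoupling μ ν (∑ i, (γ i).map (e i)) := by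
    constructor
    · rw [Measure.map_finset_sum' (by fun_prop)]
      conv_rhs => rw [← sum_map_classPart μ]
      refine Finset.sum_congr rfl fun i _ => ?_
      rw [Measure.map_map measurable_fst (he i), ← (hγ i).1,
        Measure.map_map (measurable_inClass i) measurable_fst]
      rfl
    · rw [Measure.map_finset_sum' (by fun_prop)]
      conv_rhs => rw [← sum_map_classPart ν]
      refine Finset.sum_congr rfl fun i _ => ?_
      rw [Measure.map_map measurable_snd (he i), ← (hγ i).2,
        Measure.map_map (measurable_inClass i) measurable_snd]
      rfl
  refine (transportCost_le_lintegral hcoup).trans ?_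
  rw [lintegral_finsetSum_measure]
  have hlab : Measurable fun p : (X × Fin K) × (X × Fin K) => labelCost c p.1 p.2 := by
    refine Measurable.ite ?_ (hc.comp (by fun_prop : Measurable
      fun p : (X × Fin K) × (X × Fin K) => (p.1.1, p.2.1))) measurable_const
    exact measurableSet_eq_fun (by fun_prop) (by fun_prop)
  calc ∑ i, ∫⁻ p, labelCost c p.1 p.2 ∂((γ i).map (e i))
      = ∑ i, ∫⁻ p, c p.1 p.2 ∂(γ i) := Finset.sum_congr rfl fun i _ => by
        rw [lintegral_map hlab (he i)]
        simp [e, labelCost]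
    _ ≤ ∑ i, (transportCost c (classPart μ i) (classPart ν i) + ε / K) :=
        Finset.sum_le_sum fun i _ => (hγc i).le
    _ ≤ _ := by
        rw [Finset.sum_add_distrib]
        gcongr
        simp only [Finset.sum_const, Finset.card_univ, Fintype.card_fin, nsmul_eq_mul]
        exact ENNReal.mul_div_le

/-- A coupling of finite cost is carried by pairs with equal labels, so its restrictions to the
labels couple the class parts. -/
theorem sum_transportCost_le {c : X → X → ℝ≥0∞} (hc : Measurable fun p : X × X => c p.1 p.2)
    (μ ν : Measure (X × Fin K)) :
    ∑ i, transportCost c (classPart μ i) (classPart ν i) ≤ transportCost (labelCost c) μ ν := by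
  refine le_iInf₂ fun γ hγ => ?_
  rcases eq_or_ne (∫⁻ p, labelCost c p.1 p.2 ∂γ) ⊤ with htop | htop
  · rw [htop]
    exact le_top
  have hm1 : Measurable fun p : (X × Fin K) × (X × Fin K) => p.1.2 := by fun_prop
  have hm2 : Measurable fun p : (X × Fin K) × (X × Fin K) => p.2.2 := by fun_prop
  have hpr : Measurable fun p : (X × Fin K) × (X × Fin K) => (p.1.1, p.2.1) := by fun_prop
  have hlab : Measurable fun p : (X × Fin K) × (X × Fin K) => labelCost c p.1 p.2 :=
    Measurable.ite (measurableSet_eq_fun hm1 hm2) (hc.comp hpr) measurable_const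
  have hae : ∀ᵐ p ∂γ, p.1.2 = p.2.2 := by
    filter_upwards [ae_lt_top hlab htop] with p hp
    by_contra h
    simp [labelCost, h] at hp
  let S : Fin K → Set ((X × Fin K) × (X × Fin K)) := fun i => (fun p => p.1.2) ⁻¹' {i}
  have hS : ∀ i, γ.restrict (S i) = γ.restrict ((fun p => p.2.2) ⁻¹' {i}) := fun i =>
    Measure.restrict_congr_set (hae.mono fun p hp => by
      simp only [S, eq_iff_iff]
      change p.1.2 = i ↔ p.2.2 = i
      rw [hp])
  have hcoup : ∀ i, IsCoupling (classPart μ i) (classPart ν i)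
      ((γ.restrict (S i)).map fun p => (p.1.1, p.2.1)) := fun i => by
    constructor
    · rw [Measure.map_map measurable_fst hpr, classPart, ← hγ.1,
        Measure.restrict_map measurable_fst (measurable_snd (measurableSet_singleton i)),
        Measure.map_map measurable_fst measurable_fst]
      rfl
    · rw [Measure.map_map measurable_snd hpr, classPart, ← hγ.2, hS,
        Measure.restrict_map measurable_snd (measurable_snd (measurableSet_singleton i)),
        Measure.map_map measurable_fst measurable_snd]
      rfl
  calc ∑ i, transportCost c (classPart μ i) (classPart ν i)
      ≤ ∑ i, ∫⁻ p, c p.1.1 p.2.1 ∂(γ.restrict (S i)) := Finset.sum_le_sum fun i _ => by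
        refine (transportCost_le_lintegral (hcoup i)).trans ?_
        rw [lintegral_map hc hpr]
    _ ≤ ∑ i, ∫⁻ p, labelCost c p.1 p.2 ∂(γ.restrict (S i)) := by
        gcongr with i _ p
        unfold labelCost
        split_ifs <;> simp
    _ = ∫⁻ p, labelCost c p.1 p.2 ∂γ := by
        rw [← lintegral_finsetSum_measure, sum_restrict_fiber γ hm1]

/-- The classification power is at most the mass of any common majorant of the class parts. -/
theorem power_le_of_classPart_le {f : X → Fin K → ℝ} (hf : f ∈ classifiers X K)
    {ν : Measure (X × Fin K)} {lam : Measure X} (h : ∀ i, classPart ν i ≤ lam) :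
    power f ν ≤ lam univ := by
  calc power f ν ≤ ∑ i, ∫⁻ x, ENNReal.ofReal (f x i) ∂lam := by
        unfold power
        gcongr with i
        exact h i
    _ = ∫⁻ x, ∑ i, ENNReal.ofReal (f x i) ∂lam :=
        (lintegral_finsetSum _ fun i _ => (measurable_coord hf.1 i).ennreal_ofReal).symm
    _ = ∫⁻ _, 1 ∂lam := by
        congr 1
        ext x
        rw [← ENNReal.ofReal_sum_of_nonneg fun i _ => (hf.2 x).1 i, (hf.2 x).2, ENNReal.ofReal_one]
    _ = lam univ := by simp

/-- The Bayes classifier attains the mass of the least common majorant of the class parts. -/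
theorem exists_classifier_power_ge (hK : 0 < K) (ν : Measure (X × Fin K)) [IsFiniteMeasure ν] :
    ∃ f ∈ classifiers X K, ∃ lam : Measure X, IsFiniteMeasure lam ∧ (∀ i, classPart ν i ≤ lam) ∧
      lam univ ≤ power f ν := by
  classical
  have : Nonempty (Fin K) := ⟨⟨0, hK⟩⟩
  let τ := ∑ i, classPart ν i
  have hle : ∀ i, classPart ν i ≤ τ := fun i A => by
    simp only [τ, Measure.finsetSum_apply]
    exact Finset.single_le_sum (f := fun j => classPart ν j A) (fun _ _ => zero_le) (Finset.mem_univ i)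
  have hτ : IsFiniteMeasure τ := by
    refine ⟨?_⟩
    simp only [τ, Measure.finsetSum_apply]
    exact ENNReal.sum_lt_top.2 fun i _ => measure_lt_top _ _
  let ρ : Fin K → X → ℝ≥0∞ := fun i => (classPart ν i).rnDeriv τ
  have hρ : ∀ i, Measurable (ρ i) := fun i => Measure.measurable_rnDeriv _ _
  have hν : ∀ i, τ.withDensity (ρ i) = classPart ν i := fun i =>
    Measure.withDensity_rnDeriv_eq _ _ (Measure.absolutelyContinuous_of_le (hle i))
  let best : Fin K → Set X := fun i => {x | ∀ j, ρ j x ≤ ρ i x}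
  have hbest : ∀ i, MeasurableSet (best i) := fun i => by
    simp only [best, ofPred_forall]
    exact MeasurableSet.iInter fun j => measurableSet_le (hρ j) (hρ i)
  -- Ties between maximal densities go to the least index, so that the sets partition the space.
  let first : Fin K → Set X := fun i => best i ∩ ⋂ j < i, (best j)ᶜ
  have hfirst : ∀ i, MeasurableSet (first i) := fun i =>
    (hbest i).inter (MeasurableSet.iInter fun j => MeasurableSet.iInter fun _ => (hbest j).compl)
  have hex : ∀ x, ∃ i, ∀ j, x ∈ first j ↔ j = i := fun x => by
    obtain ⟨i₀, hi₀⟩ := Finite.exists_max fun i => ρ i x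
    have hne : (Finset.univ.filter fun i => x ∈ best i).Nonempty := ⟨i₀, Finset.mem_filter.2 ⟨Finset.mem_univ _, hi₀⟩⟩
    have hmin : ∀ j, x ∈ best j → (Finset.univ.filter fun i => x ∈ best i).min' hne ≤ j :=
      fun j hj => Finset.min'_le _ _ (by simpa using hj)
    have hmem : x ∈ best ((Finset.univ.filter fun i => x ∈ best i).min' hne) := by
      simpa using Finset.min'_mem _ hne
    refine ⟨(Finset.univ.filter fun i => x ∈ best i).min' hne, fun j => ⟨fun hj => ?_, ?_⟩⟩
    · refine le_antisymm ?_ (hmin j hj.1)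
      by_contra! hlt
      exact (mem_iInter₂.1 hj.2 _ hlt) hmem
    · rintro rfl
      exact ⟨hmem, mem_iInter₂.2 fun j hj hj' => (hmin j hj').not_gt hj⟩
  let f : X → Fin K → ℝ := fun x i => (first i).indicator 1 x
  have hf_eq : ∀ x i₀, (∀ j, x ∈ first j ↔ j = i₀) → ∀ i, f x i = if i = i₀ then 1 else 0 :=
    fun x i₀ h i => by simp [f, indicator_apply, h i]
  have hf : f ∈ classifiers X K := by
    refine ⟨measurable_pi_lambda _ fun i => measurable_one.indicator (hfirst i), fun x => ?_⟩
    obtain ⟨i₀, hi₀⟩ := hex x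
    refine ⟨fun i => ?_, ?_⟩
    · rw [hf_eq x i₀ hi₀]
      split_ifs <;> simp
    · simp [hf_eq x i₀ hi₀]
  have hpow : power f ν = ∫⁻ x, ⨆ i, ρ i x ∂τ := by
    calc power f ν = ∑ i, ∫⁻ x, ρ i x * ENNReal.ofReal (f x i) ∂τ := by
          unfold power
          refine Finset.sum_congr rfl fun i _ => ?_
          rw [← hν i, lintegral_withDensity_eq_lintegral_mul _ (hρ i)
            (measurable_coord hf.1 i).ennreal_ofReal]
          rfl
      _ = ∫⁻ x, ∑ i, ρ i x * ENNReal.ofReal (f x i) ∂τ :=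
          (lintegral_finsetSum _ fun i _ =>
            (hρ i).mul (measurable_coord hf.1 i).ennreal_ofReal).symm
      _ = _ := by
          congr 1
          ext x
          obtain ⟨i₀, hi₀⟩ := hex x
          have hb : ∀ j, ρ j x ≤ ρ i₀ x := ((hi₀ i₀).2 rfl).1
          rw [Finset.sum_eq_single i₀]
          · rw [hf_eq x i₀ hi₀, if_pos rfl, ENNReal.ofReal_one, mul_one]
            exact le_antisymm (le_iSup (fun i => ρ i x) i₀) (iSup_le hb)
          · intro j _ hj
            rw [hf_eq x i₀ hi₀, if_neg hj]
            simp
          · simp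
  have huniv : (τ.withDensity fun x => ⨆ i, ρ i x) univ = power f ν := by
    rw [hpow, withDensity_apply _ MeasurableSet.univ, Measure.restrict_univ]
  -- The pointwise maximum of the densities defines the least common majorant, and its mass is
  -- exactly the power of f.
  refine ⟨f, hf, τ.withDensity fun x => ⨆ i, ρ i x, ⟨?_⟩, fun i => ?_, huniv.le⟩
  · rw [huniv]
    exact (power_le_of_classPart_le hf hle).trans_lt (measure_lt_top _ _)
  · conv_lhs => rw [← hν i]
    exact withDensity_mono (ae_of_all _ fun x => le_iSup (fun i => ρ i x) i)

/-- The value of an attack is at least the value of the barycenter problem. -/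
theorem Bstar_le_attackValueOf {c : X → X → ℝ≥0∞} (hc : Measurable fun p : X × X => c p.1 p.2)
    (hK : 0 < K) (μ ν : Measure (X × Fin K)) [IsFiniteMeasure ν] :
    Bstar c μ ≤ attackValueOf c μ ν := by
  obtain ⟨f, hf, lam, hlam, hle, hpow⟩ := exists_classifier_power_ge hK ν
  refine le_trans (iInf_le_of_le (⟨lam, hlam⟩ : FiniteMeasure X) (iInf₂_le_of_le
    (fun i => (⟨classPart ν i, inferInstance⟩ : FiniteMeasure X)) hle le_rfl)) ?_
  refine le_trans ?_ (le_iSup₂ (f := fun f _ => powerPayoff c μ f ν) f hf)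
  exact add_le_add hpow (sum_transportCost_le hc μ ν)

theorem attackValueOf_sum_map_le {c : X → X → ℝ≥0∞} (hc : Measurable fun p : X × X => c p.1 p.2)
    (μ : Measure (X × Fin K)) (lam : Measure X) (ν : Fin K → Measure X) (h : ∀ i, ν i ≤ lam) :
    attackValueOf c μ (∑ i, (ν i).map fun x => (x, i)) ≤
      lam univ + ∑ i, transportCost c (classPart μ i) (ν i) := by
  refine iSup₂_le fun f hf => add_le_add (power_le_of_classPart_le hf fun i => ?_) ?_
  · rw [classPart_sum_map]
    exact h i
  · refine (transportCost_labelCost_le hc _ _).trans ?_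
    simp only [classPart_sum_map, le_refl]

/-- For a fixed attack the supremum over f is the least mass of a common majorant of its class
parts, and the transport cost splits over the classes. -/
theorem dualAdversarial_eq_Bstar {c : X → X → ℝ≥0∞} (hc : Measurable fun p : X × X => c p.1 p.2)
    (hK : 0 < K) (μ : Measure (X × Fin K)) : dualAdversarial c μ = Bstar c μ := by
  refine le_antisymm (le_iInf fun lam => le_iInf₂ fun ν hν => ?_)
    (le_iInf fun ν => Bstar_le_attackValueOf hc hK μ _)
  have hfin : IsFiniteMeasure (∑ i, (ν i : Measure X).map fun x => (x, i)) := by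
    refine ⟨?_⟩
    simp only [Measure.finsetSum_apply]
    exact ENNReal.sum_lt_top.2 fun i _ => measure_lt_top _ _
  exact (iInf_le _ (⟨_, hfin⟩ : FiniteMeasure (X × Fin K))).trans
    (attackValueOf_sum_map_le hc μ lam (fun i => ν i) hν)

end ClassParts

end AdvMOT

namespace AdvMOT

/-! ### Topology of the space with a ghost -/

section SumSpaces

open Topology

instance instBorelSpaceSum {α β : Type*} [TopologicalSpace α] [MeasurableSpace α] [BorelSpace α]
    [TopologicalSpace β] [MeasurableSpace β] [BorelSpace β] : BorelSpace (α ⊕ β) := by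
  refine ⟨le_antisymm (fun s hs => ?_) ?_⟩
  · let _ : MeasurableSpace (α ⊕ β) := borel (α ⊕ β)
    have : BorelSpace (α ⊕ β) := ⟨rfl⟩
    obtain ⟨h1, h2⟩ := measurableSet_sum_iff.1 hs
    rw [← image_preimage_inl_union_image_preimage_inr s]
    exact (IsOpenEmbedding.inl.measurableEmbedding.measurableSet_image.2 h1).union
      (IsOpenEmbedding.inr.measurableEmbedding.measurableSet_image.2 h2)
  · refine MeasurableSpace.generateFrom_le fun s hs => ?_
    obtain ⟨h1, h2⟩ := isOpen_sum_iff.1 hs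
    exact measurableSet_sum_iff.2 ⟨h1.measurableSet, h2.measurableSet⟩

instance instWeaklyLocallyCompactSpaceSum {α β : Type*} [TopologicalSpace α]
    [WeaklyLocallyCompactSpace α] [TopologicalSpace β] [WeaklyLocallyCompactSpace β] :
    WeaklyLocallyCompactSpace (α ⊕ β) := by
  refine ⟨?_⟩
  rintro (x | x)
  · obtain ⟨s, hs, hx⟩ := exists_compact_mem_nhds x
    exact ⟨_, hs.image continuous_inl, IsOpenEmbedding.inl.image_mem_nhds.2 hx⟩
  · obtain ⟨s, hs, hx⟩ := exists_compact_mem_nhds x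
    exact ⟨_, hs.image continuous_inr, IsOpenEmbedding.inr.image_mem_nhds.2 hx⟩

end SumSpaces

section Semicontinuity

theorem lowerSemicontinuous_ite_top {α : Type*} [TopologicalSpace α] {p : α → Prop}
    [DecidablePred p] {f : α → ℝ≥0∞} (hp : IsClosed {a | p a}) (hf : LowerSemicontinuous f) :
    LowerSemicontinuous fun a => if p a then f a else ⊤ := by
  intro a t ht
  by_cases ha : p a
  · simp only [if_pos ha] at ht
    filter_upwards [hf a t ht] with b hb
    split_ifs
    · exact hb
    · exact hb.trans_le le_top
  · simp only [if_neg ha] at ht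
    filter_upwards [hp.isOpen_compl.mem_nhds ha] with b hb
    rwa [if_neg (show ¬ p b from hb)]

theorem lowerSemicontinuous_mul {α : Type*} [TopologicalSpace α] {f g : α → ℝ≥0∞}
    (hf : LowerSemicontinuous f) (hg : LowerSemicontinuous g) :
    LowerSemicontinuous fun a => f a * g a := by
  intro a t ht
  obtain ⟨u, hu, v, hv, huv⟩ : ∃ u < f a, ∃ v < g a, t < u * v := by
    by_contra! h
    exact ht.not_ge (ENNReal.mul_le_of_forall_lt h)
  filter_upwards [hf a u hu, hg a v hv] with b h1 h2
  exact huv.trans_le (mul_le_mul' h1.le h2.le)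

end Semicontinuity

/-! ### Compactness and semicontinuity of the cost -/

section Cost

variable {X : Type*} [MetricSpace X] {c : X → X → ℝ≥0∞}

/-- Coercivity applied to the pairs (u n, u n), whose cost is 0, makes every bounded sequence
precompact. -/
theorem CostAssumption.properSpace (hc : CostAssumption c) : ProperSpace X := by
  refine ⟨fun x r => IsSeqCompact.isCompact fun u hu => ?_⟩
  have hb : Bornology.IsBounded (range u) :=
    Metric.isBounded_closedBall.subset (range_subset_iff.2 hu)
  have hcomp := (hc.coercive u u hb (by simp [hc.self])).image continuous_fst
  obtain ⟨a, -, φ, hφ, hlim⟩ := hcomp.tendsto_subseq (x := u) fun n =>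
    ⟨(u n, u n), subset_closure (mem_range_self n), rfl⟩
  exact ⟨a, Metric.isClosed_closedBall.mem_of_tendsto hlim (Filter.Eventually.of_forall
    fun n => hu _), φ, hφ, hlim⟩

theorem CostAssumption.isCompact_sublevel (hc : CostAssumption c) (x₀ : X) (R : ℝ) {r : ℝ≥0∞}
    (hr : r < ⊤) : IsCompact {p : X × X | p.1 ∈ Metric.closedBall x₀ R ∧ c p.1 p.2 ≤ r} := by
  refine IsSeqCompact.isCompact fun u hu => ?_
  have hcomp := hc.coercive (fun n => (u n).1) (fun n => (u n).2)
    (Metric.isBounded_closedBall.subset (range_subset_iff.2 fun n => (hu n).1))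
    ((iSup_le fun n => (hu n).2).trans_lt hr)
  obtain ⟨a, -, φ, hφ, hlim⟩ := hcomp.tendsto_subseq (x := u) fun n =>
    subset_closure ⟨n, rfl⟩
  have hclosed : IsClosed {p : X × X | p.1 ∈ Metric.closedBall x₀ R ∧ c p.1 p.2 ≤ r} :=
    (Metric.isClosed_closedBall.preimage continuous_fst).inter (hc.lsc.isClosed_preimage r)
  exact ⟨a, hclosed.mem_of_tendsto hlim (Filter.Eventually.of_forall fun n => hu _), φ, hφ, hlim⟩

theorem CostAssumption.measurable [SecondCountableTopology X] [MeasurableSpace X] [BorelSpace X]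
    (hc : CostAssumption c) : Measurable fun p : X × X => c p.1 p.2 :=
  hc.lsc.measurable

theorem CostAssumption.lowerSemicontinuous_labelCost (hc : CostAssumption c) (K : ℕ) :
    LowerSemicontinuous fun p : (X × Fin K) × (X × Fin K) => labelCost c p.1 p.2 :=
  lowerSemicontinuous_ite_top (isClosed_eq (by fun_prop) (by fun_prop))
    (hc.lsc.comp (g := fun p : (X × Fin K) × (X × Fin K) => (p.1.1, p.2.1)) (by fun_prop))

end Cost

/-! ### Finite dimensional form of the local problem -/

section LocalProblem

variable {X : Type*} {K : ℕ}

/-- The class of a point of `ZStar X K`, `none` for the ghost. -/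
def classOf (w : ZStar X K) : Option (Fin K) := Sum.elim (fun p => some p.2) (fun _ => none) w

/-- The position of a point of `ZStar X K`, an arbitrary point for the ghost. -/
noncomputable def pointOf [Nonempty X] (w : ZStar X K) : X :=
  Sum.elim Prod.fst (fun _ => Classical.arbitrary X) w

theorem classOf_eq_some_iff [Nonempty X] {w : ZStar X K} {i : Fin K} :
    classOf w = some i ↔ w = Sum.inl (pointOf w, i) := by
  rcases w with ⟨x, j⟩ | _ <;> simp [classOf, pointOf]

/-- The cost of moving `w` to `y` when `w` is used as a point of class `i`. -/
noncomputable def slotCost [Nonempty X] (c : X → X → ℝ≥0∞) (i : Fin K) (w : ZStar X K) (y : X) : ℝ≥0∞ :=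
  if classOf w = some i then c (pointOf w) y else ⊤

/-- The cost of gathering at `y` the points of the tuple `z` selected by `σ`, which picks
at most one index for each class. -/
noncomputable def gatherCost [Nonempty X] (c : X → X → ℝ≥0∞) (σ : Fin K → Option (Fin K))
    (z : Fin K → ZStar X K) (y : X) : ℝ≥0∞ :=
  ∑ i, (σ i).elim 0 fun l => slotCost c i (z l) y

/-- The least cost of gathering the points of `z` selected by `σ`. -/
noncomputable def gatherMin [Nonempty X] (c : X → X → ℝ≥0∞) (σ : Fin K → Option (Fin K))
    (z : Fin K → ZStar X K) : ℝ≥0∞ :=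
  ⨅ y, gatherCost c σ z y

/-- The mass that the weights `m` give to the index `l`. -/
noncomputable def load (m : (Fin K → Option (Fin K)) → ℝ≥0∞) (l : Fin K) : ℝ≥0∞ :=
  ∑ σ, ∑ i, if σ i = some l then m σ else 0

/-- The weights `m` give mass `1 / K` to each index that is not a ghost. -/
def Balanced (z : Fin K → ZStar X K) (m : (Fin K → Option (Fin K)) → ℝ≥0∞) : Prop :=
  ∀ l, classOf (z l) ≠ none → load m l = (K : ℝ≥0∞)⁻¹

open Classical in
/-- The objective of the finite dimensional form of the local problem. -/
noncomputable def planValue [Nonempty X] (c : X → X → ℝ≥0∞) (z : Fin K → ZStar X K)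
    (m : (Fin K → Option (Fin K)) → ℝ≥0∞) : ℝ≥0∞ :=
  if Balanced z m then ∑ σ, m σ * (1 + gatherMin c σ z) else ⊤

variable [MetricSpace X] [Nonempty X] {c : X → X → ℝ≥0∞}

theorem continuous_pointOf : Continuous (pointOf : ZStar X K → X) :=
  continuous_fst.sumElim continuous_const

omit [Nonempty X] in
theorem isClopen_classOf_eq (o : Option (Fin K)) : IsClopen {w : ZStar X K | classOf w = o} := by
  have : IsClopen {j : Fin K | some j = o} := isClopen_discrete _
  exact ⟨isClosed_sum_iff.2 ⟨this.1.preimage continuous_snd, isClosed_discrete _⟩,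
    isOpen_sum_iff.2 ⟨this.2.preimage continuous_snd, isOpen_discrete _⟩⟩

theorem CostAssumption.lowerSemicontinuous_slotCost (hc : CostAssumption c) (i : Fin K) :
    LowerSemicontinuous fun p : ZStar X K × X => slotCost c i p.1 p.2 :=
  lowerSemicontinuous_ite_top ((isClopen_classOf_eq _).1.preimage continuous_fst)
    (hc.lsc.comp (g := fun p : ZStar X K × X => (pointOf p.1, p.2))
      ((continuous_pointOf.comp continuous_fst).prodMk continuous_snd))

theorem CostAssumption.lowerSemicontinuous_gatherCost (hc : CostAssumption c)
    (σ : Fin K → Option (Fin K)) :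
    LowerSemicontinuous fun p : (Fin K → ZStar X K) × X => gatherCost c σ p.1 p.2 := by
  refine lowerSemicontinuous_sum fun i _ => ?_
  rcases σ i with _ | l
  · exact lowerSemicontinuous_const
  · exact (hc.lowerSemicontinuous_slotCost i).comp
      (g := fun p : (Fin K → ZStar X K) × X => (p.1 l, p.2)) (by fun_prop)

/-- One selected point suffices: if the cost at y is at most r, then y is reached at cost at most r
from a point near `pointOf (z l)`, hence lies in a fixed compact set. The empty selection has cost 0
everywhere and is treated separately. -/
theorem CostAssumption.locallyInfCompact_gatherCost (hc : CostAssumption c)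
    {σ : Fin K → Option (Fin K)} {i l : Fin K} (hσ : σ i = some l) :
    LocallyInfCompact (gatherCost (K := K) c σ) := by
  intro z r hr
  refine ⟨_, (hc.isCompact_sublevel (pointOf (z l)) 1 hr).image continuous_snd, ?_⟩
  have hcont : Continuous fun z' : Fin K → ZStar X K => pointOf (z' l) :=
    continuous_pointOf.comp (continuous_apply l)
  filter_upwards [hcont.continuousAt.preimage_mem_nhds
    (Metric.closedBall_mem_nhds (pointOf (z l)) one_pos)] with z' hz' y hy
  have h1 : slotCost c i (z' l) y ≤ r := by
    refine le_trans ?_ hy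
    have := Finset.single_le_sum (f := fun i => (σ i).elim 0 fun l => slotCost c i (z' l) y)
      (fun _ _ => zero_le) (Finset.mem_univ i)
    simpa [hσ, gatherCost] using this
  refine ⟨(pointOf (z' l), y), ⟨hz', ?_⟩, rfl⟩
  unfold slotCost at h1
  split_ifs at h1
  · exact h1
  · exact absurd hr (top_le_iff.1 h1 ▸ lt_irrefl _)

omit [MetricSpace X] in
theorem gatherCost_eq_zero {σ : Fin K → Option (Fin K)} (hσ : ∀ i, σ i = none)
    (z : Fin K → ZStar X K) (y : X) : gatherCost c σ z y = 0 := by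
  simp [gatherCost, hσ]

theorem CostAssumption.lowerSemicontinuous_gatherMin (hc : CostAssumption c)
    (σ : Fin K → Option (Fin K)) : LowerSemicontinuous (gatherMin (K := K) c σ) := by
  by_cases h : ∃ i l, σ i = some l
  · obtain ⟨i, l, hσ⟩ := h
    have : gatherMin (K := K) c σ = fun z => ⨅ y ∈ univ, gatherCost c σ z y := by
      ext z
      simp [gatherMin]
    rw [this]
    exact lowerSemicontinuous_biInf_of_locallyInfCompact
      (hc.lowerSemicontinuous_gatherCost σ) (hc.locallyInfCompact_gatherCost hσ) isClosed_univ
  · have hσ : ∀ i, σ i = none := fun i => Option.eq_none_iff_forall_ne_some.2 fun l hl => h ⟨i, l, hl⟩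
    have : gatherMin (K := K) c σ = fun _ => 0 := by
      ext z
      simp [gatherMin, gatherCost_eq_zero hσ]
    rw [this]
    exact lowerSemicontinuous_const

omit [Nonempty X] in
theorem isClosed_balanced :
    IsClosed {p : (Fin K → ZStar X K) × ((Fin K → Option (Fin K)) → ℝ≥0∞) | Balanced p.1 p.2} := by
  simp only [Balanced, ofPred_forall]
  refine isClosed_iInter fun l => ?_
  have h1 : IsClosed {p : (Fin K → ZStar X K) × ((Fin K → Option (Fin K)) → ℝ≥0∞) |
      classOf (p.1 l) = none} :=
    (isClopen_classOf_eq none).1.preimage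
      (f := fun p : (Fin K → ZStar X K) × ((Fin K → Option (Fin K)) → ℝ≥0∞) => p.1 l) (by fun_prop)
  have h2 : IsClosed {p : (Fin K → ZStar X K) × ((Fin K → Option (Fin K)) → ℝ≥0∞) |
      load p.2 l = (K : ℝ≥0∞)⁻¹} := by
    refine isClosed_eq ?_ continuous_const
    refine continuous_finsetSum _ fun σ _ => continuous_finsetSum _ fun i _ => ?_
    split_ifs <;> fun_prop
  convert h1.union h2 using 1
  ext p
  simp only [mem_ofPred_eq, mem_union]
  tauto

theorem CostAssumption.lowerSemicontinuous_planValue (hc : CostAssumption c) :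
    LowerSemicontinuous fun p : (Fin K → ZStar X K) × ((Fin K → Option (Fin K)) → ℝ≥0∞) =>
      planValue c p.1 p.2 := by
  classical
  refine lowerSemicontinuous_ite_top isClosed_balanced (lowerSemicontinuous_sum fun σ _ => ?_)
  refine lowerSemicontinuous_mul (Continuous.lowerSemicontinuous (by fun_prop)) ?_
  exact lowerSemicontinuous_const.add ((hc.lowerSemicontinuous_gatherMin σ).comp continuous_fst)

/-- Weights take values in the compact space ℝ≥0∞, so the compactness needed for the infimum is
automatic. -/
theorem CostAssumption.lowerSemicontinuous_iInf_planValue (hc : CostAssumption c) :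
    LowerSemicontinuous fun z : Fin K → ZStar X K => ⨅ m, planValue c z m := by
  simpa using lowerSemicontinuous_biInf_of_locallyInfCompact hc.lowerSemicontinuous_planValue
    LocallyInfCompact.of_compactSpace isClosed_univ

variable [CompleteSpace X] [SecondCountableTopology X] [MeasurableSpace X] [BorelSpace X]

theorem CostAssumption.exists_measurable_gather (hc : CostAssumption c)
    (σ : Fin K → Option (Fin K)) : ∃ s : (Fin K → ZStar X K) → X, Measurable s ∧
      ∀ z, gatherCost c σ z (s z) = gatherMin c σ z := by
  by_cases h : ∃ i l, σ i = some l
  · obtain ⟨i, l, hσ⟩ := h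
    exact exists_measurable_argmin (hc.lowerSemicontinuous_gatherCost σ)
      (hc.locallyInfCompact_gatherCost hσ)
  · have hσ : ∀ i, σ i = none := fun i => Option.eq_none_iff_forall_ne_some.2 fun l hl => h ⟨i, l, hl⟩
    exact ⟨fun _ => Classical.arbitrary X, measurable_const, fun z => by
      simp [gatherMin, gatherCost_eq_zero hσ]⟩

omit [CompleteSpace X] in
theorem CostAssumption.exists_measurable_plan (hc : CostAssumption c) :
    ∃ m : (Fin K → ZStar X K) → (Fin K → Option (Fin K)) → ℝ≥0∞, Measurable m ∧
      ∀ z, planValue c z (m z) = ⨅ m, planValue c z m :=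
  exists_measurable_argmin hc.lowerSemicontinuous_planValue LocallyInfCompact.of_compactSpace

end LocalProblem

end AdvMOT

namespace AdvMOT

/-! ### Upper bound: attacks built from weights on selections -/

section LocalAttack

variable {X : Type*} [MetricSpace X] [Nonempty X] [SecondCountableTopology X]
  [MeasurableSpace X] [BorelSpace X] {K : ℕ} {c : X → X → ℝ≥0∞}

/-- The attack that moves to `y σ` the mass `m σ` of each of the points selected by `σ`. -/
noncomputable def gatherAttack (m : (Fin K → Option (Fin K)) → ℝ≥0∞)
    (y : (Fin K → Option (Fin K)) → X) : Measure (X × Fin K) :=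
  ∑ σ, m σ • ∑ i, (σ i).elim 0 fun _ => Measure.dirac (y σ, i)

-- Regroups the mass by its index of origin; this identifies the first marginal of the gathering
-- coupling.
omit [MetricSpace X] [Nonempty X] [SecondCountableTopology X] [BorelSpace X] in
theorem load_smul_sum (m : (Fin K → Option (Fin K)) → ℝ≥0∞) (D : Fin K → Measure X) :
    ∑ σ, m σ • ∑ i, (σ i).elim 0 D = ∑ l, load m l • D l := by
  have h1 : ∀ (σ : Fin K → Option (Fin K)) i,
      m σ • (σ i).elim 0 D = ∑ l, (if σ i = some l then m σ else 0) • D l := fun σ i => by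
    rcases σ i with _ | l <;> simp [ite_smul]
  simp only [Finset.smul_sum, h1, load, Finset.sum_smul]
  rw [Finset.sum_comm (s := (Finset.univ : Finset (Fin K)))]
  exact Finset.sum_congr rfl fun σ _ => Finset.sum_comm

omit [MetricSpace X] [Nonempty X] [SecondCountableTopology X] [BorelSpace X] in
theorem power_gatherAttack_le (m : (Fin K → Option (Fin K)) → ℝ≥0∞)
    (y : (Fin K → Option (Fin K)) → X) {f : X → Fin K → ℝ} (hf : f ∈ classifiers X K) :
    power f (gatherAttack m y) ≤ ∑ σ, m σ := by
  rw [power_eq_lintegral hf.1, gatherAttack, lintegral_finsetSum_measure]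
  refine Finset.sum_le_sum fun σ _ => ?_
  rw [lintegral_smul_measure, smul_eq_mul, lintegral_finsetSum_measure]
  refine mul_le_of_le_one_right' ?_
  calc ∑ i, ∫⁻ z, ENNReal.ofReal (f z.1 z.2) ∂((σ i).elim 0 fun _ => Measure.dirac (y σ, i))
      ≤ ∑ i, ENNReal.ofReal (f (y σ) i) := Finset.sum_le_sum fun i _ => by
        rcases σ i with _ | l
        · simp
        · simp [lintegral_dirac' _ (measurable_uncurry_classifier hf.1)]
    _ = 1 := by
        rw [← ENNReal.ofReal_sum_of_nonneg fun i _ => (hf.2 _).1 i, (hf.2 _).2, ENNReal.ofReal_one]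

/-- The coupling sends mass `m σ` from each point selected by σ to `y σ`. Its first marginal is
correct exactly because the weights are balanced. -/
theorem transportCost_gatherAttack_le (hc : CostAssumption c) {z : Fin K → ZStar X K}
    {m : (Fin K → Option (Fin K)) → ℝ≥0∞} (hm : Balanced z m)
    (y : (Fin K → Option (Fin K)) → X) :
    transportCost (labelCost c) (localMeasure z) (gatherAttack m y) ≤
      ∑ σ, m σ * gatherCost c σ z (y σ) := by
  rcases eq_or_ne (∑ σ, m σ * gatherCost c σ z (y σ)) ⊤ with htop | htop
  · exact htop ▸ le_top
  -- When the total cost is finite, a selection of nonzero weight uses every point in its own class.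
  have hcls : ∀ σ i l, σ i = some l → m σ ≠ 0 → classOf (z l) = some i := by
    intro σ i l hσ hmσ
    by_contra hne
    refine htop (ENNReal.sum_eq_top.2 ⟨σ, Finset.mem_univ σ, ?_⟩)
    have : gatherCost c σ z (y σ) = ⊤ :=
      ENNReal.sum_eq_top.2 ⟨i, Finset.mem_univ i, by simp [hσ, slotCost, hne]⟩
    rw [this, ENNReal.mul_top hmσ]
  let Γ : Measure ((X × Fin K) × (X × Fin K)) :=
    ∑ σ, m σ • ∑ i, (σ i).elim 0 fun l => Measure.dirac ((pointOf (z l), i), (y σ, i))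
  have hΓ : IsCoupling (localMeasure z) (gatherAttack m y) Γ := by
    have hmap : ∀ {β : Type _} [MeasurableSpace β] (g : (X × Fin K) × (X × Fin K) → β),
        Measurable g → Γ.map g = ∑ σ, m σ • ∑ i, (σ i).elim 0 fun l =>
          Measure.dirac (g ((pointOf (z l), i), (y σ, i))) := by
      intro β _ g hg
      rw [Measure.map_finset_sum' hg.aemeasurable]
      refine Finset.sum_congr rfl fun σ _ => ?_
      rw [Measure.map_smul, Measure.map_finset_sum' hg.aemeasurable]
      congr 1
      refine Finset.sum_congr rfl fun i _ => ?_
      rcases σ i with _ | l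
      · simp
      · simp [Measure.map_dirac' hg]
    constructor
    · rw [hmap _ measurable_fst]
      have h1 : ∀ σ, (m σ • ∑ i, (σ i).elim 0 fun l => Measure.dirac (pointOf (z l), i)) =
          m σ • ∑ i, (σ i).elim 0 fun l =>
            Sum.elim (fun w => Measure.dirac w) (fun _ => 0) (z l) := by
        intro σ
        rcases eq_or_ne (m σ) 0 with h0 | h0
        · simp [h0]
        congr 1
        refine Finset.sum_congr rfl fun i _ => ?_
        rcases h : σ i with _ | l
        · rfl
        · have := classOf_eq_some_iff.1 (hcls σ i l h h0)
          simp only [Option.elim]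
          conv_rhs => rw [this]
          rfl
      rw [Finset.sum_congr rfl fun σ _ => h1 σ, load_smul_sum, localMeasure, Finset.smul_sum]
      refine Finset.sum_congr rfl fun l _ => ?_
      rcases hz : z l with w | u
      · rw [hm l (by simp [hz, classOf])]
      · simp
    · exact hmap _ measurable_snd
  refine (transportCost_le_lintegral hΓ).trans ?_
  rw [lintegral_finsetSum_measure]
  refine Finset.sum_le_sum fun σ _ => ?_
  rw [lintegral_smul_measure, smul_eq_mul, lintegral_finsetSum_measure]
  gcongr
  unfold gatherCost
  refine Finset.sum_le_sum fun i _ => ?_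
  rcases σ i with _ | l
  · simp
  · have hle : c (pointOf (z l)) (y σ) ≤ slotCost c i (z l) (y σ) := by
      unfold slotCost
      split_ifs <;> simp
    simpa [labelCost, lintegral_dirac' _ (hc.lowerSemicontinuous_labelCost K).measurable] using hle

theorem attackValueOf_gatherAttack_le (hc : CostAssumption c) {z : Fin K → ZStar X K}
    {m : (Fin K → Option (Fin K)) → ℝ≥0∞} (hm : Balanced z m)
    (y : (Fin K → Option (Fin K)) → X) :
    attackValueOf c (localMeasure z) (gatherAttack m y) ≤
      ∑ σ, m σ * (1 + gatherCost c σ z (y σ)) := by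
  simp only [mul_add, mul_one, Finset.sum_add_distrib]
  exact iSup₂_le fun f hf => add_le_add (power_gatherAttack_le m y hf)
    (transportCost_gatherAttack_le hc hm y)

end LocalAttack

/-! ### Independent choices with prescribed marginals -/

section ProductWeights

theorem sum_prod_mul_apply {ι O R : Type*} [Fintype ι] [DecidableEq ι] [Fintype O]
    [CommSemiring R] {w : ι → O → R} (hw : ∀ i, ∑ o, w i o = 1) (i₀ : ι) (g : O → R) :
    ∑ σ : ι → O, (∏ i, w i (σ i)) * g (σ i₀) = ∑ o, w i₀ o * g o := by
  have h1 : ∀ σ : ι → O, (∏ i, w i (σ i)) * g (σ i₀) =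
      ∏ i, w i (σ i) * (if i = i₀ then g (σ i) else 1) := fun σ => by
    rw [Finset.prod_mul_distrib]
    simp
  simp only [h1]
  rw [← Fintype.prod_sum (f := fun i o => w i o * if i = i₀ then g o else 1),
    Finset.prod_eq_single i₀]
  · simp
  · intro i _ hi
    simp [hi, hw]
  · simp

theorem sum_prod_eq_one {ι O R : Type*} [Fintype ι] [DecidableEq ι] [Fintype O]
    [CommSemiring R] {w : ι → O → R} (hw : ∀ i, ∑ o, w i o = 1) :
    ∑ σ : ι → O, ∏ i, w i (σ i) = 1 := by
  rw [← Fintype.prod_sum]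
  simp [hw]

end ProductWeights

end AdvMOT

namespace AdvMOT

/-! ### Integration against the measure of a tuple -/

section LocalMeasure

variable {X : Type*} [MeasurableSpace X] {K : ℕ}

theorem lintegral_localMeasure (z : Fin K → ZStar X K) {g : X × Fin K → ℝ≥0∞} (hg : Measurable g) :
    ∫⁻ w, g w ∂(localMeasure z) = (K : ℝ≥0∞)⁻¹ * ∑ l, Sum.elim g (fun _ => 0) (z l) := by
  rw [localMeasure, lintegral_smul_measure, lintegral_finsetSum_measure, smul_eq_mul]
  congr 1
  refine Finset.sum_congr rfl fun l _ => ?_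
  rcases z l with w | u
  · simp [lintegral_dirac' _ hg]
  · simp

theorem lintegral_classPart_localMeasure [Nonempty X] (z : Fin K → ZStar X K) (i : Fin K)
    {g : X → ℝ≥0∞} (hg : Measurable g) :
    ∫⁻ x, g x ∂(classPart (localMeasure z) i) =
      (K : ℝ≥0∞)⁻¹ * ∑ l, if classOf (z l) = some i then g (pointOf (z l)) else 0 := by
  have hi : MeasurableSet (Prod.snd ⁻¹' {i} : Set (X × Fin K)) :=
    measurable_snd (measurableSet_singleton i)
  rw [classPart, lintegral_map hg measurable_fst, ← lintegral_indicator hi,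
    lintegral_localMeasure (g := (Prod.snd ⁻¹' {i}).indicator fun w => g w.1) _
      ((hg.comp measurable_fst).indicator hi)]
  congr 1
  refine Finset.sum_congr rfl fun l _ => ?_
  rcases z l with w | u
  · simp only [classOf, pointOf, Sum.elim_inl, Option.some.injEq]
    by_cases h : w.2 = i
    · rw [indicator_of_mem (by exact h), if_pos h]
    · rw [indicator_of_notMem (by exact h), if_neg h]
  · simp [classOf]

theorem localMeasure_univ_le (z : Fin K → ZStar X K) : localMeasure z univ ≤ 1 := by
  have h := lintegral_localMeasure z (g := fun _ => 1) measurable_const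
  rw [lintegral_one] at h
  rw [h]
  calc (K : ℝ≥0∞)⁻¹ * ∑ l, Sum.elim (fun _ => 1) (fun _ => 0) (z l)
      ≤ (K : ℝ≥0∞)⁻¹ * ∑ _l : Fin K, 1 := by
        gcongr with l
        rcases z l with w | u <;> simp
    _ ≤ 1 := by
        simp only [Finset.sum_const, Finset.card_univ, Fintype.card_fin, nsmul_eq_mul, mul_one]
        exact ENNReal.inv_mul_le_one _

instance (z : Fin K → ZStar X K) : IsFiniteMeasure (localMeasure z) :=
  ⟨(localMeasure_univ_le z).trans_lt ENNReal.one_lt_top⟩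

end LocalMeasure

/-! ### Lower bound for the local problem and optimal local attacks -/

section LowerBound

variable {X : Type*} [MetricSpace X] [CompleteSpace X] [Nonempty X] [SecondCountableTopology X]
  [MeasurableSpace X] [BorelSpace X] {K : ℕ} {c : X → X → ℝ≥0∞}

/-- A coupling whose first marginal is a class part of `localMeasure z` splits along the
points of `z`. -/
theorem exists_split_coupling (z : Fin K → ZStar X K) (i : Fin K) {ν : Measure X}
    {γ : Measure (X × X)} (hγ : IsCoupling (classPart (localMeasure z) i) ν γ) :
    ∃ q : Fin K → Measure X, (∀ l, classOf (z l) ≠ some i → q l = 0) ∧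
      (∀ l, classOf (z l) = some i → q l univ = (K : ℝ≥0∞)⁻¹) ∧
      (∀ h : X × X → ℝ≥0∞, Measurable h →
        ∫⁻ p, h p ∂γ = ∑ l, ∫⁻ y, h (pointOf (z l), y) ∂(q l)) ∧ ∑ l, q l = ν := by
  have hfin : IsFiniteMeasure γ := ⟨by rw [hγ.measure_univ_eq]; exact measure_lt_top _ _⟩
  -- Disintegration along the first marginal; indices at the same point of the same class get equal
  -- shares of its conditional law.
  let q : Fin K → Measure X := fun l =>
    if classOf (z l) = some i then (K : ℝ≥0∞)⁻¹ • γ.condKernel (pointOf (z l)) else 0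
  have hq : ∀ h : X × X → ℝ≥0∞, Measurable h →
      ∫⁻ p, h p ∂γ = ∑ l, ∫⁻ y, h (pointOf (z l), y) ∂(q l) := by
    intro h hh
    have hfst : γ.fst = classPart (localMeasure z) i := hγ.1
    have hm : Measurable fun x => ∫⁻ y, h (x, y) ∂(γ.condKernel x) := hh.lintegral_kernel_prod_right'
    rw [← Measure.lintegral_condKernel hh, hfst, lintegral_classPart_localMeasure z i hm,
      Finset.mul_sum]
    refine Finset.sum_congr rfl fun l _ => ?_
    by_cases hl : classOf (z l) = some i <;> simp [q, hl]
  refine ⟨q, fun l hl => by simp [q, hl], fun l hl => by simp [q, hl], hq, ?_⟩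
  ext A hA
  have h1 := hq ((Prod.snd ⁻¹' A).indicator 1) (measurable_one.indicator (measurable_snd hA))
  rw [lintegral_indicator_one (measurable_snd hA), ← Measure.map_apply measurable_snd hA, hγ.2] at h1
  rw [h1, Measure.finsetSum_apply]
  refine Finset.sum_congr rfl fun l _ => ?_
  rw [← lintegral_indicator_one hA]
  rfl

omit [CompleteSpace X] [Nonempty X] [BorelSpace X] in
theorem sum_le_one_ae_of_withDensity {lam : Measure X} [IsFiniteMeasure lam] {ν : Measure X}
    (hν : ν ≤ lam) {q : Fin K → Measure X} (hq : ∑ l, q l = ν) {r : Fin K → X → ℝ≥0∞}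
    (hr : ∀ l, Measurable (r l)) (hqr : ∀ l, lam.withDensity (r l) = q l) :
    ∀ᵐ y ∂lam, ∑ l, r l y ≤ 1 := by
  refine ae_le_of_forall_setLIntegral_le_of_sigmaFinite (f := fun y => ∑ l, r l y)
    (Finset.measurable_fun_sum _ fun l _ => hr l) fun s hs _ => ?_
  rw [lintegral_finsetSum _ fun l _ => hr l]
  calc ∑ l, ∫⁻ y in s, r l y ∂lam = ν s := by
        rw [← hq, Measure.finsetSum_apply]
        exact Finset.sum_congr rfl fun l _ => by rw [← hqr l, withDensity_apply _ hs]
    _ ≤ lam s := hν s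
    _ = _ := by simp

/-- At a location y, the mass of class i arriving from the index l has a density with respect to
lam, and these densities sum over l to at most 1. They give, with `none` for the deficit, a random
index for each class. Choosing independently over the classes splits lam into parts labelled by
selections σ; their masses are the weights. Loads and costs involve one class at a time, so the
product law reproduces them. -/
theorem iInf_planValue_le_of_coupling (hc : CostAssumption c) (z : Fin K → ZStar X K)
    (lam : Measure X) [IsFiniteMeasure lam] (ν : Fin K → Measure X) (hν : ∀ i, ν i ≤ lam)
    (γ : Fin K → Measure (X × X))
    (hγ : ∀ i, IsCoupling (classPart (localMeasure z) i) (ν i) (γ i)) :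
    ⨅ m, planValue c z m ≤ lam univ + ∑ i, ∫⁻ p, c p.1 p.2 ∂(γ i) := by
  classical
  choose q hq0 hq1 hqint hqsum using fun i => exists_split_coupling z i (hγ i)
  have hqle : ∀ i l, q i l ≤ lam := fun i l => le_trans (fun A => by
    rw [← hqsum i, Measure.finsetSum_apply]
    exact Finset.single_le_sum (f := fun l => q i l A) (fun _ _ => zero_le) (Finset.mem_univ l)) (hν i)
  have hqfin : ∀ i l, IsFiniteMeasure (q i l) := fun i l => isFiniteMeasure_of_le lam (hqle i l)
  -- The density is exactly 0 for indices outside class i, so that 0 * ∞ = 0 removes the infinite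
  -- slot costs at every point.
  let r : Fin K → Fin K → X → ℝ≥0∞ := fun i l =>
    if classOf (z l) = some i then (q i l).rnDeriv lam else 0
  have hr : ∀ i l, Measurable (r i l) := fun i l => by
    simp only [r]
    split_ifs
    exacts [Measure.measurable_rnDeriv _ _, measurable_zero]
  have hqr : ∀ i l, lam.withDensity (r i l) = q i l := fun i l => by
    simp only [r]
    split_ifs with h
    · exact Measure.withDensity_rnDeriv_eq _ _ (Measure.absolutelyContinuous_of_le (hqle i l))
    · rw [withDensity_zero, hq0 i l h]
  have hrle : ∀ᵐ y ∂lam, ∀ i, ∑ l, r i l y ≤ 1 :=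
    ae_all_iff.2 fun i => sum_le_one_ae_of_withDensity (hν i) (hqsum i) (hr i) (hqr i)
  let w : X → Fin K → Option (Fin K) → ℝ≥0∞ := fun y i o =>
    o.elim (1 - ∑ l, r i l y) fun l => r i l y
  have hw : ∀ i o, Measurable fun y => w y i o := fun i o => by
    rcases o with _ | l
    · exact measurable_const.sub (Finset.measurable_fun_sum _ fun l _ => hr i l)
    · exact hr i l
  have hw1 : ∀ᵐ y ∂lam, ∀ i, ∑ o, w y i o = 1 := by
    filter_upwards [hrle] with y hy i
    rw [Fintype.sum_option]
    exact tsub_add_cancel_of_le (hy i)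
  let W : (Fin K → Option (Fin K)) → X → ℝ≥0∞ := fun σ y => ∏ i, w y i (σ i)
  have hW : ∀ σ, Measurable (W σ) := fun σ => Finset.measurable_fun_prod _ fun i _ => hw i (σ i)
  let m : (Fin K → Option (Fin K)) → ℝ≥0∞ := fun σ => ∫⁻ y, W σ y ∂lam
  have hbal : Balanced z m := by
    intro l hl
    obtain ⟨i₀, hi₀⟩ := Option.ne_none_iff_exists'.1 hl
    calc load m l = ∑ i, ∑ σ, ∫⁻ y, W σ y * (if σ i = some l then 1 else 0) ∂lam := by
          rw [load, Finset.sum_comm]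
          refine Finset.sum_congr rfl fun i _ => Finset.sum_congr rfl fun σ _ => ?_
          split_ifs <;> simp [m]
      _ = ∑ i, ∫⁻ y, r i l y ∂lam := by
          refine Finset.sum_congr rfl fun i _ => ?_
          rw [← lintegral_finsetSum _ fun σ _ => (hW σ).mul_const _]
          refine lintegral_congr_ae ?_
          filter_upwards [hw1] with y hy
          rw [sum_prod_mul_apply hy i fun o => if o = some l then 1 else 0]
          simp [w]
      _ = ∑ i, q i l univ := by
          refine Finset.sum_congr rfl fun i _ => ?_
          rw [← hqr i l, withDensity_apply _ MeasurableSet.univ, Measure.restrict_univ]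
      _ = (K : ℝ≥0∞)⁻¹ := by
          rw [Finset.sum_eq_single i₀]
          · exact hq1 _ _ hi₀
          · intro i _ hi
            rw [hq0 i l fun h => hi (Option.some_injective _ (h.symm.trans hi₀))]
            rfl
          · simp
  have hslot : ∀ i l, Measurable fun y => slotCost c i (z l) y := fun i l =>
    ((hc.lowerSemicontinuous_slotCost i).comp
      (g := fun y : X => (z l, y)) (by fun_prop)).measurable
  have hgather : ∀ σ, Measurable fun y => gatherCost c σ z y := fun σ =>
    ((hc.lowerSemicontinuous_gatherCost σ).comp
      (g := fun y : X => (z, y)) (by fun_prop)).measurable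
  have hWg : ∀ σ, Measurable fun y => W σ y * (1 + gatherCost c σ z y) := fun σ =>
    (hW σ).mul ((hgather σ).const_add 1)
  have hrs : ∀ i l, Measurable fun y => r i l y * slotCost c i (z l) y := fun i l =>
    (hr i l).mul (hslot i l)
  have hpoint : ∀ᵐ y ∂lam, ∑ σ, W σ y * (1 + gatherCost c σ z y) =
      1 + ∑ i, ∑ l, r i l y * slotCost c i (z l) y := by
    filter_upwards [hw1] with y hy
    simp only [mul_add, mul_one, Finset.sum_add_distrib, gatherCost, Finset.mul_sum]
    rw [Finset.sum_comm, sum_prod_eq_one hy]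
    congr 1
    refine Finset.sum_congr rfl fun i _ => ?_
    rw [sum_prod_mul_apply hy i fun o => o.elim 0 fun l => slotCost c i (z l) y,
      Fintype.sum_option]
    simp [w]
  have hterm : ∀ i l, ∫⁻ y, r i l y * slotCost c i (z l) y ∂lam =
      ∫⁻ y, c (pointOf (z l)) y ∂(q i l) := fun i l => by
    have hcm : Measurable fun y => c (pointOf (z l)) y := hc.measurable.comp measurable_prodMk_left
    rw [← hqr i l, lintegral_withDensity_eq_lintegral_mul _ (hr i l) hcm]
    refine lintegral_congr fun y => ?_
    by_cases h : classOf (z l) = some i <;> simp [r, h, slotCost]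
  calc ⨅ m, planValue c z m ≤ planValue c z m := iInf_le _ m
    _ = ∑ σ, m σ * (1 + gatherMin c σ z) := if_pos hbal
    _ ≤ ∑ σ, ∫⁻ y, W σ y * (1 + gatherCost c σ z y) ∂lam := by
        refine Finset.sum_le_sum fun σ _ => ?_
        rw [← lintegral_mul_const _ (hW σ)]
        gcongr with y
        exact iInf_le _ y
    _ = ∫⁻ y, (1 + ∑ i, ∑ l, r i l y * slotCost c i (z l) y) ∂lam := by
        rw [← lintegral_finsetSum _ fun σ _ => hWg σ]
        exact lintegral_congr_ae hpoint
    _ = lam univ + ∑ i, ∑ l, ∫⁻ y, r i l y * slotCost c i (z l) y ∂lam := by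
        rw [lintegral_add_left measurable_const, lintegral_one, lintegral_finsetSum _ fun i _ =>
          Finset.measurable_fun_sum _ fun l _ => hrs i l]
        congr 1
        exact Finset.sum_congr rfl fun i _ => lintegral_finsetSum _ fun l _ => hrs i l
    _ = lam univ + ∑ i, ∫⁻ p, c p.1 p.2 ∂(γ i) := by
        congr 1
        refine Finset.sum_congr rfl fun i _ => ?_
        rw [hqint i _ hc.measurable]
        exact Finset.sum_congr rfl fun l _ => hterm i l

theorem CostAssumption.iInf_planValue_le_motCost (hc : CostAssumption c) (z : Fin K → ZStar X K) :
    ⨅ m, planValue c z m ≤ motCost c z := by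
  refine le_iInf fun lam => le_iInf₂ fun ν hν => ?_
  by_cases htop : ∃ i, transportCost c (classPart (localMeasure z) i) (ν i) = ⊤
  · obtain ⟨i, hi⟩ := htop
    rw [ENNReal.sum_eq_top.2 ⟨i, Finset.mem_univ i, hi⟩, add_top]
    exact le_top
  push Not at htop
  refine ENNReal.le_of_forall_pos_le_add fun ε hε _ => ?_
  have hε' : (ε / K : ℝ≥0∞) ≠ 0 := by simp [hε.ne']
  choose γ hγ hγc using fun i =>
    exists_coupling_of_transportCost_lt (ENNReal.lt_add_right (htop i) hε')
  refine (iInf_planValue_le_of_coupling hc z lam (fun i => ν i) hν γ hγ).trans ?_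
  rw [add_assoc]
  gcongr
  refine (Finset.sum_le_sum fun i _ => (hγc i).le).trans ?_
  rw [Finset.sum_add_distrib]
  gcongr
  simp only [Finset.sum_const, Finset.card_univ, Fintype.card_fin, nsmul_eq_mul]
  exact ENNReal.mul_div_le

theorem CostAssumption.exists_optimal_gather (hc : CostAssumption c) :
    ∃ (m : (Fin K → ZStar X K) → (Fin K → Option (Fin K)) → ℝ≥0∞)
      (y : (Fin K → Option (Fin K)) → (Fin K → ZStar X K) → X), Measurable m ∧
      (∀ σ, Measurable (y σ)) ∧ ∀ z, planValue c z (m z) = ⨅ m, planValue c z m ∧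
        ∀ σ, gatherCost c σ z (y σ z) = gatherMin c σ z := by
  obtain ⟨m, hm, hmin⟩ := hc.exists_measurable_plan (K := K)
  choose y hy hymin using fun σ => hc.exists_measurable_gather (K := K) σ
  exact ⟨m, y, hm, hy, fun z => ⟨hmin z, fun σ => hymin σ z⟩⟩

-- The crude bound from moving nothing and taking the sum of the class parts as majorant. It serves
-- for finiteness, and for the zero cost of the tuple of ghosts.
omit [CompleteSpace X] [Nonempty X] in
theorem Bstar_le_of_finite (μ : Measure (X × Fin K)) [IsFiniteMeasure μ] (hc : CostAssumption c) :
    Bstar c μ ≤ K * μ univ := by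
  have hle : ∀ i, classPart μ i ≤ ∑ j, classPart μ j := fun i A => by
    rw [Measure.finsetSum_apply]
    exact Finset.single_le_sum (f := fun j => classPart μ j A) (fun _ _ => zero_le) (Finset.mem_univ i)
  have hu : ∀ i, classPart μ i univ ≤ μ univ := fun i => by
    rw [classPart_apply _ _ MeasurableSet.univ]
    exact measure_mono (subset_univ _)
  have hlam : (∑ j, classPart μ j) univ ≤ K * μ univ := by
    rw [Measure.finsetSum_apply]
    refine (Finset.sum_le_sum fun i _ => hu i).trans ?_
    simp
  have hself : ∀ ρ : Measure X, transportCost c ρ ρ = 0 := fun ρ => by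
    have hd : Measurable fun x : X => (x, x) := by fun_prop
    have hcoup : IsCoupling ρ ρ (ρ.map fun x => (x, x)) := by
      constructor
      · rw [Measure.map_map measurable_fst hd]
        exact Measure.map_id
      · rw [Measure.map_map measurable_snd hd]
        exact Measure.map_id
    refine le_antisymm ((transportCost_le_lintegral hcoup).trans ?_) zero_le
    rw [lintegral_map hc.measurable hd]
    simp [hc.self]
  have hfin : IsFiniteMeasure (∑ j, classPart μ j) :=
    ⟨hlam.trans_lt (ENNReal.mul_lt_top (by simp) (measure_lt_top _ _))⟩
  refine (iInf_le_of_le (⟨_, hfin⟩ : FiniteMeasure X) (iInf₂_le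
    (fun i => (⟨classPart μ i, inferInstance⟩ : FiniteMeasure X)) hle)).trans ?_
  simpa [hself] using hlam

/-- Existence of a measurable family of optimal local attacks, and semicontinuity of the cost. -/
theorem CostAssumption.exists_gatherAttack (hc : CostAssumption c) (hK : 0 < K) :
    (∀ z : Fin K → ZStar X K, motCost c z = ⨅ m, planValue c z m) ∧
    ∃ η : ProbabilityTheory.Kernel (Fin K → ZStar X K) (X × Fin K), IsOptimalLocalAttack c η := by
  obtain ⟨m, y, hm, hy, hopt⟩ := hc.exists_optimal_gather (K := K)
  have hmeas : Measurable fun z => gatherAttack (m z) fun σ => y σ z := by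
    refine Measure.measurable_of_measurable_coe _ fun A hA => ?_
    have h1 : ∀ z, gatherAttack (m z) (fun σ => y σ z) A =
        ∑ σ, m z σ * ∑ i, (σ i).elim 0 fun _ => A.indicator 1 (y σ z, i) := fun z => by
      rw [gatherAttack, Measure.finsetSum_apply]
      refine Finset.sum_congr rfl fun σ _ => ?_
      rw [Measure.smul_apply, Measure.finsetSum_apply, smul_eq_mul]
      congr 1
      refine Finset.sum_congr rfl fun i _ => ?_
      rcases σ i with _ | l
      · rfl
      · exact Measure.dirac_apply' _ hA
    simp only [h1]
    refine Finset.measurable_fun_sum _ fun σ _ => ((measurable_pi_apply σ).comp hm).mul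
      (Finset.measurable_fun_sum _ fun i _ => ?_)
    rcases σ i with _ | l
    · exact measurable_const
    · exact (measurable_one.indicator hA).comp ((hy σ).prodMk measurable_const)
  have hle : ∀ z : Fin K → ZStar X K, ⨅ m, planValue c z m ≤ motCost c z := hc.iInf_planValue_le_motCost
  have hfinite : ∀ z : Fin K → ZStar X K, motCost c z < ⊤ := fun z =>
    (Bstar_le_of_finite _ hc).trans_lt (ENNReal.mul_lt_top (by simp) (measure_lt_top _ _))
  -- Unbalanced weights have value ∞, whereas the minimum is finite.
  have hbal : ∀ z, Balanced z (m z) := fun z => by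
    by_contra h
    have := (hopt z).1.le.trans_lt ((hle z).trans_lt (hfinite z))
    simp [planValue, h] at this
  have hval : ∀ z, attackValueOf c (localMeasure z) (gatherAttack (m z) fun σ => y σ z) ≤
      ⨅ m, planValue c z m := fun z => by
    refine (attackValueOf_gatherAttack_le hc (hbal z) _).trans ?_
    rw [← (hopt z).1, planValue, if_pos (hbal z)]
    simp only [(hopt z).2, le_refl]
  -- The weights are not bounded a priori; a finite transport cost forces the attack to have the
  -- mass of the tuple's measure.
  have hfin : ∀ z, IsFiniteMeasure (gatherAttack (m z) fun σ => y σ z) := fun z => by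
    have h1 : transportCost (labelCost c) (localMeasure z) (gatherAttack (m z) fun σ => y σ z)
        ≠ ⊤ := by
      refine ne_top_of_le_ne_top ((hval z).trans_lt ((hle z).trans_lt (hfinite z))).ne ?_
      obtain ⟨f, hf, -⟩ := exists_classifier_power_ge hK (localMeasure z)
      refine le_trans ?_ (le_iSup₂ (f := fun f _ => powerPayoff c _ f _) f hf)
      exact le_add_self
    exact ⟨by rw [← measure_univ_eq_of_transportCost_ne_top h1]; exact measure_lt_top _ _⟩
  have hge : ∀ z, motCost c z ≤
      attackValueOf c (localMeasure z) (gatherAttack (m z) fun σ => y σ z) := fun z =>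
    have := hfin z
    Bstar_le_attackValueOf hc.measurable hK _ _
  exact ⟨fun z => le_antisymm ((hge z).trans (hval z)) (hle z), ⟨_, hmeas⟩, fun z =>
    ⟨hfin z, le_antisymm ((hval z).trans (hle z)) (hge z)⟩⟩

theorem CostAssumption.lowerSemicontinuous_motCost (hc : CostAssumption c) (hK : 0 < K) :
    LowerSemicontinuous fun z : Fin K → ZStar X K => motCost c z := by
  simp only [(hc.exists_gatherAttack hK).1]
  exact hc.lowerSemicontinuous_iInf_planValue

end LowerBound

end AdvMOT

namespace AdvMOT

/-! ### Averaging local measures over a multimarginal plan -/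

section Assembly

variable {X : Type*} [MeasurableSpace X] {K : ℕ}

theorem measurable_localMeasure :
    Measurable (localMeasure : (Fin K → ZStar X K) → Measure (X × Fin K)) := by
  refine Measure.measurable_of_measurable_coe _ fun A hA => ?_
  have h : ∀ z : Fin K → ZStar X K, localMeasure z A =
      (K : ℝ≥0∞)⁻¹ * ∑ l, Sum.elim (A.indicator 1) (fun _ => 0) (z l) := fun z => by
    rw [← lintegral_indicator_one hA, lintegral_localMeasure z (measurable_one.indicator hA)]
  simp only [h]
  refine (Finset.measurable_fun_sum _ fun l _ => ?_).const_mul _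
  exact ((measurable_one.indicator hA).sumElim measurable_const).comp (measurable_pi_apply l)

/-- The kernel `z ↦ localMeasure z`. -/
noncomputable def localKernel (X : Type*) [MeasurableSpace X] (K : ℕ) :
    ProbabilityTheory.Kernel (Fin K → ZStar X K) (X × Fin K) :=
  ⟨localMeasure, measurable_localMeasure⟩

theorem lintegral_ghostMarginal (μ : Measure (X × Fin K)) {g : ZStar X K → ℝ≥0∞}
    (hg : Measurable g) : ∫⁻ w, g w ∂(ghostMarginal μ) =
      (2 * μ univ)⁻¹ * ∫⁻ z, g (Sum.inl z) ∂μ + 2⁻¹ * g (Sum.inr ()) := by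
  rw [ghostMarginal, lintegral_add_measure, lintegral_smul_measure, lintegral_smul_measure,
    lintegral_map hg measurable_inl, lintegral_dirac' _ hg, smul_eq_mul, smul_eq_mul]

variable {μ : Measure (X × Fin K)} [IsFiniteMeasure μ]

theorem two_mul_measure_univ_ne_top : 2 * μ univ ≠ ⊤ :=
  ENNReal.mul_ne_top (by simp) (measure_ne_top _ _)

omit [IsFiniteMeasure μ] in
theorem two_mul_measure_univ_ne_zero (hμ : μ ≠ 0) : 2 * μ univ ≠ 0 :=
  mul_ne_zero (by simp) (by simpa using hμ)

theorem isProbabilityMeasure_ghostMarginal (hμ : μ ≠ 0) :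
    IsProbabilityMeasure (ghostMarginal μ) := by
  refine ⟨?_⟩
  rw [← lintegral_one, lintegral_ghostMarginal μ measurable_const, lintegral_one, mul_one,
    ENNReal.mul_inv (by simp) (by simp), mul_assoc,
    ENNReal.inv_mul_cancel (by simpa using hμ) (measure_ne_top _ _), mul_one,
    ENNReal.inv_two_add_inv_two]

/-- Local measures average to `μ`. -/
theorem bind_localKernel (hK : 0 < K) (hμ : μ ≠ 0) {π : Measure (Fin K → ZStar X K)}
    (hπ : π ∈ multiCouplings μ) : ((2 * μ univ) • π).bind (localKernel X K) = μ := by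
  ext A hA
  have hA1 : Measurable (A.indicator (1 : X × Fin K → ℝ≥0∞)) := measurable_one.indicator hA
  have hg : Measurable (Sum.elim (A.indicator (1 : X × Fin K → ℝ≥0∞)) (fun _ : Unit => 0)) :=
    hA1.sumElim measurable_const
  -- Each of the K slots contributes the same amount and the ghost nothing, so the factor 1 / K
  -- cancels.
  have h1 : ∀ l : Fin K, ∫⁻ z, Sum.elim (A.indicator (1 : X × Fin K → ℝ≥0∞)) (fun _ : Unit => 0) (z l)
      ∂π = (2 * μ univ)⁻¹ * μ A := fun l => by
    rw [← lintegral_map (f := Sum.elim (A.indicator (1 : X × Fin K → ℝ≥0∞)) (fun _ : Unit => 0))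
      hg (measurable_pi_apply l), hπ.2 l, lintegral_ghostMarginal μ hg]
    simp [lintegral_indicator_one hA]
  have h2 : ∀ z : Fin K → ZStar X K, localKernel X K z A =
      (K : ℝ≥0∞)⁻¹ * ∑ l, Sum.elim (A.indicator 1) (fun _ => 0) (z l) := fun z => by
    rw [← lintegral_localMeasure z hA1, lintegral_indicator_one hA]
    rfl
  have hm : ∀ l : Fin K, Measurable fun z : Fin K → ZStar X K =>
      Sum.elim (A.indicator (1 : X × Fin K → ℝ≥0∞)) (fun _ : Unit => 0) (z l) :=
    fun l => hg.comp (measurable_pi_apply l)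
  rw [Measure.bind_apply hA (localKernel X K).aemeasurable, lintegral_smul_measure]
  simp only [h2]
  rw [lintegral_const_mul _ (Finset.measurable_fun_sum _ fun l _ => hm l),
    lintegral_finsetSum _ fun l _ => hm l]
  simp only [h1, Finset.sum_const, Finset.card_univ, Fintype.card_fin, nsmul_eq_mul, smul_eq_mul]
  rw [← mul_assoc (K : ℝ≥0∞)⁻¹, ENNReal.inv_mul_cancel (by simpa using hK.ne') (by simp), one_mul,
    ← mul_assoc, ENNReal.mul_inv_cancel (two_mul_measure_univ_ne_zero hμ)
      two_mul_measure_univ_ne_top, one_mul]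

theorem assembledAttack_eq_bind (μ : Measure (X × Fin K)) (π : Measure (Fin K → ZStar X K))
    (η : ProbabilityTheory.Kernel (Fin K → ZStar X K) (X × Fin K)) :
    assembledAttack μ π η = ((2 * μ univ) • π).bind η := by
  rw [assembledAttack, Measure.bind_smul]

theorem exists_classifier (hK : 0 < K) (X : Type*) [MeasurableSpace X] :
    (classifiers X K).Nonempty :=
  let ⟨f, hf, _⟩ := exists_classifier_power_ge hK (0 : Measure (X × Fin K))
  ⟨f, hf⟩

theorem transportCost_le_attackValueOf {c : X → X → ℝ≥0∞} (hK : 0 < K) (μ ν : Measure (X × Fin K)) :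
    transportCost (labelCost c) μ ν ≤ attackValueOf c μ ν := by
  obtain ⟨f, hf⟩ := exists_classifier hK X
  exact le_add_self.trans (le_iSup₂ (f := fun f _ => powerPayoff c μ f ν) f hf)

end Assembly

/-! ### The assembled attack -/

section Superposition

variable {X : Type*} [MetricSpace X] [CompleteSpace X] [Nonempty X] [SecondCountableTopology X]
  [MeasurableSpace X] [BorelSpace X] {K : ℕ} {c : X → X → ℝ≥0∞} {μ : Measure (X × Fin K)}
  [IsFiniteMeasure μ] {π : Measure (Fin K → ZStar X K)}
  {η : ProbabilityTheory.Kernel (Fin K → ZStar X K) (X × Fin K)}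

omit [CompleteSpace X] [Nonempty X] in
theorem CostAssumption.motCost_ne_top (hc : CostAssumption c) (z : Fin K → ZStar X K) :
    motCost c z ≠ ⊤ :=
  ((Bstar_le_of_finite _ hc).trans_lt (ENNReal.mul_lt_top (by simp) (measure_lt_top _ _))).ne

omit [CompleteSpace X] [Nonempty X] in
theorem IsOptimalLocalAttack.measure_univ_eq (hc : CostAssumption c) (hK : 0 < K)
    (hη : IsOptimalLocalAttack c η) (z : Fin K → ZStar X K) :
    localMeasure z univ = η z univ :=
  measure_univ_eq_of_transportCost_ne_top (ne_top_of_le_ne_top (hc.motCost_ne_top z)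
    ((transportCost_le_attackValueOf hK _ _).trans (hη z).2.le))

omit [CompleteSpace X] [Nonempty X] in
theorem isFiniteMeasure_assembledAttack (hc : CostAssumption c) (hK : 0 < K) (hμ : μ ≠ 0)
    (hπ : π ∈ multiCouplings μ) (hη : IsOptimalLocalAttack c η) :
    IsFiniteMeasure (assembledAttack μ π η) := by
  refine ⟨?_⟩
  rw [assembledAttack_eq_bind, Measure.bind_apply MeasurableSet.univ η.aemeasurable]
  simp only [← hη.measure_univ_eq hc hK]
  have h := congr($(bind_localKernel hK hμ hπ) univ)
  rw [Measure.bind_apply MeasurableSet.univ (localKernel X K).aemeasurable] at h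
  exact (h.trans_lt (measure_lt_top _ _))

omit [CompleteSpace X] [Nonempty X] in
/-- The attack assembled from optimal local attacks costs at most the multimarginal cost. -/
theorem attackValueOf_assembledAttack_le (hc : CostAssumption c) (hK : 0 < K) (hμ : μ ≠ 0)
    (hπ : π ∈ multiCouplings μ) (hη : IsOptimalLocalAttack c η) :
    attackValueOf c μ (assembledAttack μ π η) ≤ 2 * μ univ * ∫⁻ z, motCost c z ∂π := by
  have := hc.properSpace
  rw [assembledAttack_eq_bind]
  set π' := (2 * μ univ) • π with hπ'
  have hbind := bind_localKernel hK hμ hπ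
  have hfin : IsFiniteMeasure (π'.bind (localKernel X K)) := by rw [hbind]; infer_instance
  have hC := transportCost_bind_le (hc.lowerSemicontinuous_labelCost K) π' (localKernel X K) η
    fun z => hη.measure_univ_eq hc hK z
  rw [hbind] at hC
  refine iSup₂_le fun f hf => ?_
  have hfm := measurable_uncurry_classifier hf.1
  calc powerPayoff c μ f (π'.bind η)
      ≤ ∫⁻ z, power f (η z) ∂π' +
        ∫⁻ z, transportCost (labelCost c) (localKernel X K z) (η z) ∂π' := by
        refine add_le_add (le_of_eq ?_) hC
        simp only [power_eq_lintegral hf.1]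
        exact Measure.lintegral_bind η.aemeasurable hfm.aemeasurable
    _ = ∫⁻ z, powerPayoff c (localMeasure z) f (η z) ∂π' := by
        refine (lintegral_add_left ?_ _).symm
        simp only [power_eq_lintegral hf.1]
        exact hfm.lintegral_kernel
    _ ≤ ∫⁻ z, motCost c z ∂π' := lintegral_mono fun z =>
        (le_iSup₂ (f := fun f _ => powerPayoff c (localMeasure z) f (η z)) f hf).trans (hη z).2.le
    _ = _ := by rw [hπ', lintegral_smul_measure, smul_eq_mul]

end Superposition

/-! ### Dominating classifiers and weak duality -/

section Domination

variable {X : Type*} [MeasurableSpace X] {K : ℕ} {c : X → X → ℝ≥0∞} {μ : Measure (X × Fin K)}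
  [IsFiniteMeasure μ] {φ : Fin K → ZStar X K → ℝ}

theorem integrable_inl_of_ghostMarginal {g : ZStar X K → ℝ} (hg : Integrable g (ghostMarginal μ)) :
    Integrable (fun z => g (Sum.inl z)) μ := by
  rcases eq_or_ne μ 0 with rfl | hμ
  · exact integrable_zero_measure
  exact ((integrable_smul_measure (ENNReal.inv_ne_zero.2 two_mul_measure_univ_ne_top)
    (ENNReal.inv_ne_top.2 (two_mul_measure_univ_ne_zero hμ))).1
      hg.left_of_add_measure).comp_measurable measurable_inl

theorem integrable_aggregate (hφ : ∀ j, Integrable (φ j) (ghostMarginal μ)) :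
    Integrable (fun z : X × Fin K => aggregate φ z.2 z.1) μ :=
  (integrable_finsetSum _ fun j _ => integrable_inl_of_ghostMarginal (hφ j)).add
    (integrable_const _)

theorem integral_aggregate (hμ : μ ≠ 0) (hφ : ∀ j, Integrable (φ j) (ghostMarginal μ)) :
    ∫ z, aggregate φ z.2 z.1 ∂μ = 2 * μ.real univ * dualObjective μ φ := by
  have hM : μ.real univ ≠ 0 := by simpa [Measure.real, ENNReal.toReal_eq_zero_iff] using hμ
  have h1 : ∫ z, aggregate φ z.2 z.1 ∂μ = ∫ z, (∑ j, φ j (Sum.inl z) + ∑ j, φ j (Sum.inr ())) ∂μ := rfl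
  rw [h1, integral_add (integrable_finsetSum _ fun j _ => integrable_inl_of_ghostMarginal (hφ j))
    (integrable_const _), integral_finsetSum _ fun j _ => integrable_inl_of_ghostMarginal (hφ j),
    integral_const, smul_eq_mul, dualObjective, ← Finset.mul_sum]
  field_simp

-- The sets S i need not be measurable, so their complements are replaced by measurable hulls.
omit [IsFiniteMeasure μ] in
theorem ae_mem_of_classPart_compl_eq_zero {S : Fin K → Set X}
    (hS : ∀ i, classPart μ i (S i)ᶜ = 0) : ∀ᵐ z ∂μ, z.1 ∈ S z.2 := by
  have h1 : {z : X × Fin K | z.1 ∉ S z.2} ⊆ ⋃ i, toMeasurable (classPart μ i) (S i)ᶜ ×ˢ {i} :=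
    fun z hz => mem_iUnion.2 ⟨z.2, subset_toMeasurable _ _ hz, rfl⟩
  refine measure_mono_null h1 (measure_iUnion_null fun i => ?_)
  rw [← classPart_apply _ _ (measurableSet_toMeasurable _ _), measure_toMeasurable, hS]

theorem ofReal_integral_le_lintegral {α : Type*} [MeasurableSpace α] {ρ : Measure α} {g : α → ℝ}
    (hg : Integrable g ρ) : ENNReal.ofReal (∫ x, g x ∂ρ) ≤ ∫⁻ x, ENNReal.ofReal (g x) ∂ρ := by
  calc ENNReal.ofReal (∫ x, g x ∂ρ) ≤ ENNReal.ofReal (∫ x, max (g x) 0 ∂ρ) :=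
        ENNReal.ofReal_le_ofReal (integral_mono hg hg.pos_part fun x => le_max_left _ _)
    _ = ∫⁻ x, ENNReal.ofReal (max (g x) 0) ∂ρ :=
        ofReal_integral_eq_lintegral_ofReal hg.pos_part (ae_of_all _ fun x => le_max_right _ _)
    _ = _ := by simp

/-- A classifier dominating the potentials of the dual has large robust power. -/
theorem dualObjective_le_robustPowerOf (hμ : μ ≠ 0) (hφ : ∀ j, Integrable (φ j) (ghostMarginal μ))
    {S : Fin K → Set X} (hS : ∀ i, classPart μ i (S i)ᶜ = 0) {f : X → Fin K → ℝ}
    (hf : f ∈ classifiers X K) (hdom : Dominates c φ S f) :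
    ENNReal.ofReal (2 * μ.real univ * dualObjective μ φ) ≤ robustPowerOf c μ f := by
  refine le_iInf fun ν => ?_
  simp only [powerPayoff, transportCost, ENNReal.add_iInf]
  refine le_iInf₂ fun γ hγ => ?_
  have hint := integrable_aggregate hφ
  rw [← integral_aggregate hμ hφ]
  refine (ofReal_integral_le_lintegral hint).trans ?_
  have hfm := measurable_uncurry_classifier hf.1
  have h1 : ∫⁻ z, ENNReal.ofReal (aggregate φ z.2 z.1) ∂μ =
      ∫⁻ p, ENNReal.ofReal (aggregate φ p.1.2 p.1.1) ∂γ := by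
    have hm : AEMeasurable (fun z : X × Fin K => ENNReal.ofReal (aggregate φ z.2 z.1))
        (γ.map Prod.fst) := by
      rw [hγ.1]
      exact hint.aemeasurable.ennreal_ofReal
    rw [← lintegral_map' hm measurable_fst.aemeasurable, hγ.1]
  have h2 : power f ν = ∫⁻ p, ENNReal.ofReal (f p.2.1 p.2.2) ∂γ := by
    rw [power_eq_lintegral hf.1, ← hγ.2, lintegral_map hfm measurable_snd]
  have hae : ∀ᵐ p ∂γ, p.1.1 ∈ S p.1.2 :=
    ae_of_ae_map measurable_fst.aemeasurable (by
      rw [hγ.1]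
      exact ae_mem_of_classPart_compl_eq_zero hS)
  rw [h1, h2]
  refine le_trans (lintegral_mono_ae ?_) (lintegral_add_left (hfm.comp measurable_snd) _).le
  -- For equal labels, domination at the source point says that the aggregated potential is at most
  -- f plus the cost; for different labels the cost is infinite.
  filter_upwards [hae] with p hp
  by_cases hlab : p.1.2 = p.2.2
  · have h3 : ENNReal.ofReal (aggregate φ p.1.2 p.1.1) - c p.1.1 p.2.1 ≤
        ENNReal.ofReal (f p.2.1 p.1.2) :=
      le_trans (le_iSup₂ (f := fun x (_ : x ∈ S p.1.2) =>
        ENNReal.ofReal (aggregate φ p.1.2 x) - c x p.2.1) p.1.1 hp) (hdom p.1.2 p.2.1)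
    rw [tsub_le_iff_right, hlab] at h3
    simpa [labelCost, hlab] using h3
  · simp [labelCost, hlab]

end Domination

end AdvMOT

namespace AdvMOT

/-! ### Feasible potentials yield classifiers -/

section FeasiblePotentials

theorem sum_iSup_le_of_forall {ι κ : Type*} [Nonempty κ] {f : ι → κ → ℝ≥0∞} {b : ℝ≥0∞}
    (s : Finset ι) (h : ∀ g : ι → κ, ∑ i ∈ s, f i (g i) ≤ b) : ∑ i ∈ s, ⨆ k, f i k ≤ b := by
  classical
  induction s using Finset.induction_on generalizing b with
  | empty => simp
  | insert a s ha ih =>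
    rcases eq_or_ne b ⊤ with rfl | hb
    · exact le_top
    rw [Finset.sum_insert ha, ENNReal.iSup_add]
    refine iSup_le fun k => ?_
    rcases le_or_gt (f a k) b with hk | hk
    · have hsub : ∑ i ∈ s, ⨆ k, f i k ≤ b - f a k := by
        refine ih fun g => ?_
        refine ENNReal.le_sub_of_add_le_left (ne_top_of_le_ne_top hb hk) ?_
        have := h (Function.update g a k)
        rw [Finset.sum_insert ha, Function.update_self] at this
        rwa [Finset.sum_congr rfl fun i hi => by
          rw [Function.update_of_ne (ne_of_mem_of_not_mem hi ha)]] at this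
      calc f a k + ∑ i ∈ s, ⨆ k, f i k ≤ f a k + (b - f a k) := by gcongr
        _ = b := add_tsub_cancel_of_le hk
    · have := h fun _ => k
      rw [Finset.sum_insert ha] at this
      exact absurd (hk.trans_le (le_self_add.trans this)) (lt_irrefl _)

variable {X : Type*} [MeasurableSpace X] {K : ℕ} {c : X → X → ℝ≥0∞}

theorem localMeasure_comp_perm (z : Fin K → ZStar X K) (σ : Equiv.Perm (Fin K)) :
    localMeasure (fun l => z (σ l)) = localMeasure z := by
  unfold localMeasure
  congr 1
  exact Equiv.sum_comp σ fun l => Sum.elim (fun w => Measure.dirac w) (fun _ => 0) (z l)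

/-- Feasible potentials may be averaged over the cyclic shifts of a tuple. -/
theorem sum_potential_le (hK : 0 < K) {φ : Fin K → ZStar X K → ℝ}
    (hφ : ∀ z, ∑ j, φ j (z j) ≤ (motCost c z).toReal) (z : Fin K → ZStar X K) :
    ∑ k, ∑ j, φ j (z k) ≤ K * (motCost c z).toReal := by
  have : NeZero K := ⟨hK.ne'⟩
  -- Each diagonal sum over j is the constraint on a shifted tuple, and the cost of a tuple is
  -- invariant under permutation.
  calc ∑ k, ∑ j, φ j (z k) = ∑ j, ∑ k, φ j (z (k + j)) := by
        rw [Finset.sum_comm]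
        exact Finset.sum_congr rfl fun j _ => (Equiv.sum_comp (Equiv.addRight j) fun k => φ j (z k)).symm
    _ = ∑ k, ∑ j, φ j (z (k + j)) := Finset.sum_comm
    _ ≤ ∑ _k : Fin K, (motCost c z).toReal := by
        refine Finset.sum_le_sum fun k _ => (hφ fun j => z (k + j)).trans_eq ?_
        rw [motCost, motCost, ← localMeasure_comp_perm z (Equiv.addLeft k)]
        rfl
    _ = K * (motCost c z).toReal := by simp

/-- Everything is gathered at y, where a point mass a dominates each class. -/
theorem Bstar_le_of_dirac (hc : Measurable fun p : X × X => c p.1 p.2) (μ : Measure (X × Fin K))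
    (y : X) {a : ℝ≥0∞} (ha : a ≠ ⊤) (h : ∀ i, classPart μ i univ ≤ a) :
    Bstar c μ ≤ a + ∫⁻ z, c z.1 y ∂μ := by
  have hm : Measurable fun x => c x y := hc.comp (measurable_id.prodMk measurable_const)
  have hfin : ∀ b : ℝ≥0∞, b ≠ ⊤ → IsFiniteMeasure (b • Measure.dirac y) := fun b hb =>
    ⟨by simpa using hb.lt_top⟩
  have := hfin a ha
  have := fun i => hfin _ (ne_top_of_le_ne_top ha (h i))
  refine le_trans (iInf_le_of_le (⟨a • Measure.dirac y, hfin a ha⟩ : FiniteMeasure X) (iInf₂_le_of_le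
    (fun i => (⟨classPart μ i univ • Measure.dirac y, this i⟩ : FiniteMeasure X))
    (fun i => ?_) le_rfl)) ?_
  · intro s
    exact mul_le_mul_left (h i) (Measure.dirac y s)
  · rw [lintegral_eq_sum_classPart μ (g := fun z => c z.1 y) (hm.comp measurable_fst)]
    refine add_le_add (by simp) (Finset.sum_le_sum fun i _ => ?_)
    have hmap : Measurable fun x : X => (x, y) := measurable_id.prodMk measurable_const
    refine (transportCost_le_lintegral (γ := (classPart μ i).map fun x => (x, y)) ⟨?_, ?_⟩).trans_eq
      (lintegral_map hc hmap)
    · rw [Measure.map_map measurable_fst hmap]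
      exact Measure.map_id
    · rw [Measure.map_map measurable_snd hmap]
      exact Measure.map_const _ _

-- The tuple has K / |I| copies of each point and K % |I| ghosts. The remainder is less than |I|,
-- and the quotient is at least 1, whence r ≤ m |I|. A general monoid M is allowed because the tuple
-- is summed both in ℝ≥0∞ and in ℝ.
omit [MeasurableSpace X] in
theorem exists_tuple (I : Finset (Fin K)) (hI : I.Nonempty) (x : Fin K → X) :
    ∃ (m r : ℕ) (w : Fin K → ZStar X K), 0 < m ∧ r ≤ m * I.card ∧
      ∀ (M : Type) [AddCommMonoid M] (g : ZStar X K → M),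
        ∑ l, g (w l) = m • ∑ i ∈ I, g (Sum.inl (x i, i)) + r • g (Sum.inr ()) := by
  have hn : 0 < I.card := hI.card_pos
  have hnK : I.card ≤ K := by simpa using I.card_le_univ
  have hm : 0 < K / I.card := Nat.div_pos hnK hn
  have e : Fin K ≃ (I × Fin (K / I.card)) ⊕ Fin (K % I.card) := Fintype.equivOfCardEq (by
    simp [Nat.div_add_mod])
  refine ⟨K / I.card, K % I.card, fun l => Sum.elim (fun p => Sum.inl (x p.1, p.1))
    (fun _ => Sum.inr ()) (e l), hm, ?_, fun M _ g => ?_⟩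
  · nlinarith [Nat.mod_lt K hn]
  · rw [Equiv.sum_comp e fun p => g (Sum.elim (fun p => Sum.inl (x p.1, p.1))
      (fun _ => Sum.inr ()) p), Fintype.sum_sum_type, Fintype.sum_prod_type]
    simp only [Sum.elim_inl, Sum.elim_inr, Finset.sum_const, Finset.card_univ, Fintype.card_fin,
      Finset.smul_sum]
    rw [Finset.sum_coe_sort I fun i => (K / I.card) • g (Sum.inl (x i, i))]

/-- The averaged constraint on the tuple of `exists_tuple` is compared with the cost of gathering
the tuple at y. Each class of I carries mass m / K, so the cost is at most (m / K)(1 + ∑ c(x i, y)),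
and the factor m cancels. -/
theorem sum_aggregate_le (hc : Measurable fun p : X × X => c p.1 p.2) (hK : 0 < K)
    {φ : Fin K → ZStar X K → ℝ} (hφ : ∀ z, ∑ j, φ j (z j) ≤ (motCost c z).toReal)
    (hghost : motCost c (fun _ : Fin K => (Sum.inr () : ZStar X K)) = 0)
    (I : Finset (Fin K)) (hI : I.Nonempty) (x : Fin K → X) (y : X) (hfin : ∀ i ∈ I, c (x i) y ≠ ⊤) :
    ∑ i ∈ I, aggregate φ i (x i) ≤ 1 + ∑ i ∈ I, (c (x i) y).toReal := by
  obtain ⟨m, r, w, hm, hr, hw⟩ := exists_tuple I hI x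
  have hK0 : (K : ℝ≥0∞) ≠ 0 := by exact_mod_cast hK.ne'
  have hcm : Measurable fun z : X × Fin K => c z.1 y :=
    hc.comp (measurable_fst.prodMk measurable_const)
  have hG : ∑ j, φ j (Sum.inr ()) ≤ 0 := by
    simpa [hghost] using hφ fun _ => Sum.inr ()
  have hcost : motCost c w ≤ (K : ℝ≥0∞)⁻¹ * m + (K : ℝ≥0∞)⁻¹ * (m * ∑ i ∈ I, c (x i) y) := by
    refine (Bstar_le_of_dirac hc _ y (a := (K : ℝ≥0∞)⁻¹ * m) ?_ fun i => ?_).trans_eq ?_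
    · exact ENNReal.mul_ne_top (ENNReal.inv_ne_top.2 hK0) (by simp)
    · have hA : MeasurableSet ((univ : Set X) ×ˢ {i} : Set (X × Fin K)) :=
        MeasurableSet.univ.prod (measurableSet_singleton i)
      rw [classPart_apply _ _ MeasurableSet.univ, ← lintegral_indicator_one hA,
        lintegral_localMeasure w (measurable_one.indicator hA), hw]
      have h1 : ∑ j ∈ I, ((univ : Set X) ×ˢ {i} : Set (X × Fin K)).indicator (1 : X × Fin K → ℝ≥0∞) (x j, j)
          ≤ 1 := by
        calc _ ≤ ∑ j, if j = i then (1 : ℝ≥0∞) else 0 := by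
              refine (Finset.sum_le_sum fun j _ => ?_).trans
                (Finset.sum_le_sum_of_subset (Finset.subset_univ I))
              simp [Set.indicator_apply]
          _ = 1 := by simp
      simp only [Sum.elim_inl, Sum.elim_inr, smul_zero, add_zero, nsmul_eq_mul]
      gcongr
      exact mul_le_of_le_one_right zero_le h1
    · rw [lintegral_localMeasure w hcm, hw]
      simp
  have hreal : K * (motCost c w).toReal ≤ m * (1 + ∑ i ∈ I, (c (x i) y).toReal) := by
    have hs : ∑ i ∈ I, c (x i) y ≠ ⊤ := ENNReal.sum_ne_top.2 hfin
    have h2 : (K : ℝ≥0∞) * motCost c w ≤ m * (1 + ∑ i ∈ I, c (x i) y) := by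
      calc (K : ℝ≥0∞) * motCost c w
          ≤ K * ((K : ℝ≥0∞)⁻¹ * m + (K : ℝ≥0∞)⁻¹ * (m * ∑ i ∈ I, c (x i) y)) := by gcongr
        _ = m * (1 + ∑ i ∈ I, c (x i) y) := by
          rw [← mul_add, ← mul_assoc, ENNReal.mul_inv_cancel hK0 (by simp), one_mul, mul_add, mul_one]
    have h3 := ENNReal.toReal_mono (ENNReal.mul_ne_top (by simp) (by simp [hs])) h2
    rwa [ENNReal.toReal_mul, ENNReal.toReal_mul, ENNReal.toReal_add (by simp) hs,
      ENNReal.toReal_sum hfin, ENNReal.toReal_natCast, ENNReal.toReal_natCast,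
      ENNReal.toReal_one] at h3
  have hsum := (sum_potential_le hK hφ w).trans hreal
  rw [hw ℝ fun v => ∑ j, φ j v] at hsum
  simp only [nsmul_eq_mul] at hsum
  have hr' : (r : ℝ) ≤ m * I.card := by exact_mod_cast hr
  simp only [aggregate, Finset.sum_add_distrib, Finset.sum_const, nsmul_eq_mul]
  refine le_of_mul_le_mul_left (a := (m : ℝ)) ?_ (by exact_mod_cast hm)
  -- The tuple has r ghosts where m |I| ghost terms are wanted. As r ≤ m |I| and the ghost sum is
  -- nonpositive, the replacement only lowers the left side.
  nlinarith [mul_nonneg (sub_nonneg.2 hr') (neg_nonneg.2 hG)]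

theorem sum_preClassifier_le_one (hc : Measurable fun p : X × X => c p.1 p.2) (hK : 0 < K)
    {φ : Fin K → ZStar X K → ℝ} (hφ : ∀ z, ∑ j, φ j (z j) ≤ (motCost c z).toReal)
    (hghost : motCost c (fun _ : Fin K => (Sum.inr () : ZStar X K)) = 0)
    (S : Fin K → Set X) (y : X) : ∑ i, preClassifier c φ S i y ≤ 1 := by
  classical
  have : Nonempty X := ⟨y⟩
  have h1 : ∀ i, preClassifier c φ S i y ≤ ⨆ x, (ENNReal.ofReal (aggregate φ i x) - c x y) :=
    fun i => iSup_mono fun x => iSup_le fun _ => le_rfl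
  refine (Finset.sum_le_sum fun i _ => h1 i).trans (sum_iSup_le_of_forall _ fun x => ?_)
  -- Only classes with a positive truncated difference matter; for these the costs are finite and
  -- the subtraction is the real one.
  set I := Finset.univ.filter fun i => ENNReal.ofReal (aggregate φ i (x i)) - c (x i) y ≠ 0 with hIdef
  have hI : ∀ i ∈ I, c (x i) y < ENNReal.ofReal (aggregate φ i (x i)) := fun i hi => by
    exact tsub_pos_iff_lt.1 (pos_iff_ne_zero.2 (Finset.mem_filter.1 hi).2)
  have hfin : ∀ i ∈ I, c (x i) y ≠ ⊤ := fun i hi => (hI i hi).ne_top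
  rw [← Finset.sum_filter_ne_zero]
  rcases I.eq_empty_or_nonempty with hemp | hne
  · rw [← hIdef, hemp]
    simp
  have hle : ∀ i ∈ I, (c (x i) y).toReal ≤ aggregate φ i (x i) := fun i hi => by
    have h := (hI i hi).le
    exact ENNReal.toReal_le_of_le_ofReal
      (ENNReal.ofReal_pos.1 (zero_le.trans_lt (hI i hi))).le h
  calc ∑ i ∈ I, (ENNReal.ofReal (aggregate φ i (x i)) - c (x i) y)
      = ∑ i ∈ I, ENNReal.ofReal (aggregate φ i (x i) - (c (x i) y).toReal) := by
        refine Finset.sum_congr rfl fun i hi => ?_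
        rw [ENNReal.ofReal_sub _ ENNReal.toReal_nonneg, ENNReal.ofReal_toReal (hfin i hi)]
    _ = ENNReal.ofReal (∑ i ∈ I, (aggregate φ i (x i) - (c (x i) y).toReal)) :=
        (ENNReal.ofReal_sum_of_nonneg fun i hi => sub_nonneg.2 (hle i hi)).symm
    _ ≤ 1 := by
        rw [Finset.sum_sub_distrib, ENNReal.ofReal_le_one]
        linarith [sum_aggregate_le hc hK hφ hghost I hne x y hfin]

/-- The mass missing from 1 is shared equally among the K classes. -/
theorem exists_dominating_classifier (hK : 0 < K) {φ : Fin K → ZStar X K → ℝ} {S : Fin K → Set X}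
    (hS : ∀ i, Measurable (preClassifier c φ S i)) (hsum : ∀ y, ∑ i, preClassifier c φ S i y ≤ 1) :
    ∃ f ∈ classifiers X K, Dominates c φ S f := by
  have hKr : (0 : ℝ) < K := by exact_mod_cast hK
  have hfin : ∀ y, ∀ i ∈ Finset.univ, preClassifier c φ S i y ≠ ⊤ := fun y i hi =>
    ne_top_of_le_ne_top ENNReal.one_ne_top
      ((Finset.single_le_sum (f := fun i => preClassifier c φ S i y) (fun _ _ => zero_le) hi).trans
        (hsum y))
  have hle : ∀ y, ∑ i, (preClassifier c φ S i y).toReal ≤ 1 := fun y => by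
    rw [← ENNReal.toReal_sum (hfin y)]
    exact ENNReal.toReal_mono ENNReal.one_ne_top (hsum y)
  have hnn : ∀ y, 0 ≤ (1 - ∑ j, (preClassifier c φ S j y).toReal) / K := fun y =>
    div_nonneg (sub_nonneg.2 (hle y)) hKr.le
  refine ⟨fun y i => (preClassifier c φ S i y).toReal +
    (1 - ∑ j, (preClassifier c φ S j y).toReal) / K, ⟨?_, fun y => ⟨fun i => ?_, ?_⟩⟩, fun i y => ?_⟩
  · refine measurable_pi_lambda _ fun i => (hS i).ennreal_toReal.add ((measurable_const.sub ?_).div_const _)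
    exact Finset.measurable_fun_sum _ fun j _ => (hS j).ennreal_toReal
  · exact add_nonneg ENNReal.toReal_nonneg (hnn y)
  · rw [Finset.sum_add_distrib]
    simp only [Finset.sum_const, Finset.card_univ, Fintype.card_fin, nsmul_eq_mul]
    field_simp
    ring
  · calc preClassifier c φ S i y = ENNReal.ofReal (preClassifier c φ S i y).toReal :=
          (ENNReal.ofReal_toReal (hfin y i (Finset.mem_univ i))).symm
      _ ≤ _ := ENNReal.ofReal_le_ofReal (le_add_of_nonneg_right (hnn y))

end FeasiblePotentials

end AdvMOT

namespace AdvMOT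

/-! ### Lusin's theorem and compact covers -/

section Lusin

variable {X : Type*} [MetricSpace X] [MeasurableSpace X] [BorelSpace X]
  {ρ : Measure X} [IsFiniteMeasure ρ]

theorem exists_isClosed_subset_of_nullMeasurableSet {A : Set X} (hA : NullMeasurableSet A ρ)
    {ε : ℝ≥0∞} (hε : ε ≠ 0) : ∃ F ⊆ A, IsClosed F ∧ ρ (A \ F) ≤ ε := by
  obtain ⟨t, htA, ht, hae⟩ := hA.exists_measurable_subset_ae_eq
  obtain ⟨F, hFt, hF, hlt⟩ := ht.exists_isClosed_sdiff_lt (μ := ρ) (measure_ne_top _ _) hε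
  refine ⟨F, hFt.trans htA, hF, ?_⟩
  calc ρ (A \ F) = ρ (t \ F) := measure_congr (hae.symm.diff (ae_eq_refl F))
    _ ≤ ε := hlt.le

/-- **Lusin's theorem** for a finite Borel measure on a metric space. -/
theorem exists_isClosed_continuousOn {g : X → ℝ} (hg : AEMeasurable g ρ) {ε : ℝ≥0∞} (hε : ε ≠ 0) :
    ∃ C, IsClosed C ∧ ContinuousOn g C ∧ ρ Cᶜ ≤ ε := by
  obtain ⟨B, hBc, -, hB⟩ := TopologicalSpace.exists_countable_basis ℝ
  have := hBc.to_subtype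
  obtain ⟨δ, hδ, hδε⟩ := ENNReal.exists_pos_sum_of_countable' (ENNReal.half_pos hε).ne' B
  have hA : ∀ U : B, NullMeasurableSet (g ⁻¹' U) ρ := fun U =>
    hg.nullMeasurableSet_preimage (hB.isOpen U.2).measurableSet
  choose F hFA hF hρF using fun U : B => exists_isClosed_subset_of_nullMeasurableSet (hA U) (hδ U).ne'
  choose G hGA hG hρG using fun U : B =>
    exists_isClosed_subset_of_nullMeasurableSet (hA U).compl (hδ U).ne'
  -- For each basic open U the preimage and its complement are approximated from inside by closed
  -- sets F U and G U. On the intersection the preimage of U is the trace of the open set (G U)ᶜ,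
  -- which gives continuity.
  refine ⟨⋂ U, F U ∪ G U, isClosed_iInter fun U => (hF U).union (hG U), fun x hx => ?_, ?_⟩
  · rw [ContinuousWithinAt, hB.nhds_hasBasis.tendsto_right_iff]
    rintro V ⟨hV, hxV⟩
    have hxG : x ∉ G ⟨V, hV⟩ := fun h => hGA _ h hxV
    filter_upwards [self_mem_nhdsWithin, mem_nhdsWithin_of_mem_nhds ((hG _).isOpen_compl.mem_nhds hxG)]
      with y hy hyG
    exact hFA ⟨V, hV⟩ ((mem_iInter.1 hy ⟨V, hV⟩).resolve_right hyG)
  · have hsub : (⋂ U, F U ∪ G U)ᶜ ⊆ ⋃ U : B, (g ⁻¹' U \ F U) ∪ ((g ⁻¹' U)ᶜ \ G U) := fun x hx => by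
      simp only [mem_compl_iff, mem_iInter, mem_union, not_forall, not_or] at hx
      obtain ⟨U, hxF, hxG⟩ := hx
      refine mem_iUnion.2 ⟨U, ?_⟩
      by_cases h : x ∈ g ⁻¹' U
      exacts [Or.inl ⟨h, hxF⟩, Or.inr ⟨h, hxG⟩]
    calc _ ≤ _ := measure_mono hsub
      _ ≤ ∑' U : B, ρ ((g ⁻¹' U \ F U) ∪ ((g ⁻¹' U)ᶜ \ G U)) := measure_iUnion_le _
      _ ≤ ∑' U : B, (δ U + δ U) := ENNReal.tsum_le_tsum fun U =>
          (measure_union_le _ _).trans (add_le_add (hρF U) (hρG U))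
      _ = ∑' U, δ U + ∑' U, δ U := ENNReal.tsum_add
      _ ≤ ε / 2 + ε / 2 := add_le_add hδε.le hδε.le
      _ = ε := ENNReal.add_halves ε

theorem exists_isCompact_cover_continuousOn [ProperSpace X] {g : X → ℝ} (hg : AEMeasurable g ρ) :
    ∃ C : ℕ × ℕ → Set X, (∀ p, IsCompact (C p)) ∧ (∀ p, ContinuousOn g (C p)) ∧
      ρ (⋃ p, C p)ᶜ = 0 := by
  rcases isEmpty_or_nonempty X with hX | ⟨⟨x₀⟩⟩
  · exact ⟨fun _ => ∅, fun _ => isCompact_empty, fun _ => continuousOn_empty _, by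
      rw [eq_empty_of_isEmpty (⋃ _, ∅)ᶜ, measure_empty]⟩
  choose C hC hCg hCρ using fun n : ℕ =>
    exists_isClosed_continuousOn hg (ε := ((n : ℝ≥0∞) + 1)⁻¹) (by simp)
  refine ⟨fun p => C p.1 ∩ Metric.closedBall x₀ p.2, fun p => (isCompact_closedBall _ _).inter_left (hC _),
    fun p => (hCg _).mono inter_subset_left, ?_⟩
  have hU : ∀ n, C n ⊆ ⋃ p : ℕ × ℕ, C p.1 ∩ Metric.closedBall x₀ p.2 := fun n x hx => by
    obtain ⟨k, hk⟩ := exists_nat_ge (dist x x₀)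
    exact mem_iUnion.2 ⟨(n, k), hx, hk⟩
  refine le_antisymm (ENNReal.le_of_forall_pos_le_add fun ε hε _ => ?_) zero_le
  obtain ⟨n, hn⟩ := ENNReal.exists_inv_nat_lt (a := (ε : ℝ≥0∞)) (by simpa using hε.ne')
  calc _ ≤ ρ (C n)ᶜ := measure_mono (compl_subset_compl.2 (hU n))
    _ ≤ ((n : ℝ≥0∞) + 1)⁻¹ := hCρ n
    _ ≤ (n : ℝ≥0∞)⁻¹ := ENNReal.inv_le_inv.2 le_self_add
    _ ≤ 0 + ε := by rw [zero_add]; exact hn.le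

end Lusin

/-! ### Borel measurability of the pre-classifier -/

section Measurability

variable {X : Type*} [MetricSpace X] [MeasurableSpace X] [BorelSpace X] {K : ℕ}
  {c : X → X → ℝ≥0∞} {φ : Fin K → ZStar X K → ℝ}

-- The set is the projection along the compact factor C of a closed set, namely the preimage of a
-- closed epigraph under the graph of a.
omit [MeasurableSpace X] [BorelSpace X] in
theorem isClosed_setOf_exists_add_le (hc : LowerSemicontinuous fun p : X × X => c p.1 p.2)
    {C : Set X} (hC : IsCompact C) {a : X → ℝ≥0∞} (ha : ContinuousOn a C) (q : ℝ≥0∞) :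
    IsClosed {y | ∃ x ∈ C, q + c x y ≤ a x} := by
  have := isCompact_iff_compactSpace.1 hC
  have hlsc : LowerSemicontinuous fun p : C × X => c p.1 p.2 :=
    hc.comp (g := fun p : C × X => ((p.1 : X), p.2)) (by fun_prop)
  have ha' : Continuous fun p : C × X => a p.1 := ha.domRestrict.comp continuous_fst
  have hcl : IsClosed {p : C × X | q + c p.1 p.2 ≤ a p.1} := by
    have h := (lowerSemicontinuous_const.add hlsc (f := fun _ : C × X => q)).isClosed_epigraph
    exact h.preimage (f := fun p : C × X => (p, a p.1)) (continuous_id.prodMk ha')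
  convert isClosedMap_snd_of_compactSpace _ hcl using 1
  ext y
  simp

/-- A superlevel set is a countable union, over the compact pieces and rational levels, of closed
projections. -/
theorem measurable_preClassifier_of_cover (hc : LowerSemicontinuous fun p : X × X => c p.1 p.2)
    {κ : Type*} [Countable κ] {S : Fin K → Set X} {i : Fin K} {C : κ → Set X} (hS : S i = ⋃ k, C k)
    (hC : ∀ k, IsCompact (C k)) (hφ : ∀ k, ContinuousOn (aggregate φ i) (C k)) :
    Measurable (preClassifier c φ S i) := by
  refine measurable_of_Ioi fun t => ?_
  have h : preClassifier c φ S i ⁻¹' Ioi t =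
      ⋃ (k : κ) (q : ℚ) (_ : t < ENNReal.ofReal q),
        {y | ∃ x ∈ C k, ENNReal.ofReal q + c x y ≤ ENNReal.ofReal (aggregate φ i x)} := by
    ext y
    simp only [mem_preimage, mem_Ioi, preClassifier, lt_iSup_iff, hS, mem_iUnion, mem_ofPred_eq]
    constructor
    · rintro ⟨x, ⟨k, hk⟩, hlt⟩
      obtain ⟨q, -, hq1, hq2⟩ := ENNReal.lt_iff_exists_rat_btwn.1 hlt
      refine ⟨k, q, hq1, x, hk, ?_⟩
      have hle : c x y ≤ ENNReal.ofReal (aggregate φ i x) :=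
        (tsub_pos_iff_lt.1 (zero_le.trans_lt hlt)).le
      calc _ ≤ (ENNReal.ofReal (aggregate φ i x) - c x y) + c x y := by gcongr; exact hq2.le
        _ = _ := tsub_add_cancel_of_le hle
    · rintro ⟨k, q, hq, x, hk, hle⟩
      have hfin : c x y ≠ ⊤ := ne_top_of_le_ne_top ENNReal.ofReal_ne_top (le_add_self.trans hle)
      exact ⟨x, ⟨k, hk⟩, hq.trans_le (ENNReal.le_sub_of_add_le_right hfin hle)⟩
  rw [h]
  refine MeasurableSet.iUnion fun k => MeasurableSet.iUnion fun q => MeasurableSet.iUnion fun _ => ?_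
  exact (isClosed_setOf_exists_add_le hc (hC k)
    (ENNReal.continuous_ofReal.comp_continuousOn (hφ k)) _).measurableSet

variable {μ : Measure (X × Fin K)} [IsFiniteMeasure μ]

omit [MetricSpace X] [BorelSpace X] [IsFiniteMeasure μ] in
theorem aemeasurable_classPart {g : X × Fin K → ℝ} (hg : AEMeasurable g μ) (i : Fin K) :
    AEMeasurable (fun x => g (x, i)) (classPart μ i) := by
  refine AEMeasurable.comp_measurable (f := fun x => (x, i)) ?_ (measurable_inClass i)
  rw [map_classPart]
  exact hg.restrict

theorem CostAssumption.exists_measurable_preClassifier (hc : CostAssumption c)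
    (hφ : ∀ j, Integrable (φ j) (ghostMarginal μ)) :
    ∃ S : Fin K → Set X, (∀ i, classPart μ i (S i)ᶜ = 0) ∧
      ∀ i, Measurable (preClassifier c φ S i) := by
  have := hc.properSpace
  choose C hC hCφ hCμ using fun i : Fin K => exists_isCompact_cover_continuousOn
    (aemeasurable_classPart (integrable_aggregate hφ).aemeasurable i)
  exact ⟨fun i => ⋃ p, C i p, hCμ, fun i =>
    measurable_preClassifier_of_cover hc.lsc rfl (hC i) (hCφ i)⟩

end Measurability

end AdvMOT

namespace AdvMOT

/-! ### Risk and classification power; saddle points -/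

section Values

variable {X : Type*} [MeasurableSpace X] {K : ℕ} {c : X → X → ℝ≥0∞} {μ : Measure (X × Fin K)}

theorem risk_add_power {f : X → Fin K → ℝ} (hf : f ∈ classifiers X K) (ν : Measure (X × Fin K)) :
    risk f ν + power f ν = ν univ := by
  rw [risk, power, ← Finset.sum_add_distrib, ← lintegral_one,
    lintegral_eq_sum_classPart ν (g := fun _ => 1) measurable_const]
  refine Finset.sum_congr rfl fun i _ => ?_
  rw [← lintegral_add_right _ (measurable_coord hf.1 i).ennreal_ofReal]
  refine lintegral_congr fun x => ?_
  have h1 : f x i ≤ 1 := (hf.2 x).2 ▸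
    Finset.single_le_sum (f := f x) (fun j _ => (hf.2 x).1 j) (Finset.mem_univ i)
  rw [← ENNReal.ofReal_add (sub_nonneg.2 h1) ((hf.2 x).1 i)]
  simp

/-- If C(μ, ν) is infinite, both sides are -∞. Otherwise μ and ν have equal mass, and R + B is that
mass. -/
theorem advPayoff_eq [IsFiniteMeasure μ] {f : X → Fin K → ℝ} (hf : f ∈ classifiers X K)
    (ν : Measure (X × Fin K)) :
    advPayoff c μ f ν = (μ univ : EReal) - (powerPayoff c μ f ν : EReal) := by
  unfold advPayoff powerPayoff
  rcases eq_or_ne (transportCost (labelCost c) μ ν) ⊤ with h | h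
  · rw [h, add_top, EReal.coe_ennreal_top, EReal.sub_top, EReal.sub_top]
  · have hM := measure_univ_eq_of_transportCost_ne_top h
    have hs := risk_add_power hf ν
    rw [← hM] at hs
    have hfin := hs ▸ measure_ne_top μ univ
    rw [← hs]
    lift transportCost (labelCost c) μ ν to NNReal using h with t
    lift risk f ν to NNReal using (ENNReal.add_ne_top.1 hfin).1 with r
    lift power f ν to NNReal using (ENNReal.add_ne_top.1 hfin).2 with p
    rw [EReal.coe_ennreal_add, EReal.coe_ennreal_add]
    simp only [EReal.coe_nnreal_eq_coe_real]
    rw [← EReal.coe_add, ← EReal.coe_add, ← EReal.coe_sub, ← EReal.coe_sub]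
    congr 1
    ring

theorem antitone_const_sub (a : EReal) : Antitone fun x : ℝ≥0∞ => a - (x : EReal) := fun _ _ h =>
  EReal.sub_le_sub le_rfl (EReal.coe_ennreal_le_coe_ennreal_iff.2 h)

/-- Finiteness of a excludes ∞ - ∞. Continuity and antitonicity then exchange suprema and infima. -/
theorem continuous_const_sub {a : ℝ≥0∞} (ha : a ≠ ⊤) :
    Continuous fun x : ℝ≥0∞ => (a : EReal) - (x : EReal) := by
  refine continuous_iff_continuousAt.2 fun x => ?_
  have h1 : (a : EReal) ≠ ⊤ := by simpa using ha
  have h := EReal.continuousAt_add (p := ((a : EReal), -(x : EReal))) (Or.inl h1) (Or.inl (by simp))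
  exact h.comp (f := fun x : ℝ≥0∞ => ((a : EReal), -(x : EReal)))
    (continuous_const.prodMk (continuous_neg.comp continuous_coe_ennreal_ereal)).continuousAt

theorem const_sub_iSup {ι : Type*} [Nonempty ι] {a : ℝ≥0∞} (ha : a ≠ ⊤) (g : ι → ℝ≥0∞) :
    (a : EReal) - ((⨆ i, g i : ℝ≥0∞) : EReal) = ⨅ i, ((a : EReal) - (g i : EReal)) :=
  Antitone.map_ciSup_of_continuousAt (continuous_const_sub ha).continuousAt (antitone_const_sub _)
    (OrderTop.bddAbove _)

theorem const_sub_iInf {ι : Type*} [Nonempty ι] {a : ℝ≥0∞} (ha : a ≠ ⊤) (g : ι → ℝ≥0∞) :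
    (a : EReal) - ((⨅ i, g i : ℝ≥0∞) : EReal) = ⨆ i, ((a : EReal) - (g i : EReal)) :=
  Antitone.map_ciInf_of_continuousAt (continuous_const_sub ha).continuousAt (antitone_const_sub _)
    (OrderBot.bddBelow _)

theorem advValue_eq [IsFiniteMeasure μ] (hK : 0 < K) :
    advValue c μ = (μ univ : EReal) - (robustPower c μ : EReal) := by
  have := (exists_classifier hK X).to_subtype
  unfold advValue robustPower robustPowerOf
  rw [iInf_subtype', iSup_subtype', const_sub_iSup (measure_ne_top μ univ)]
  refine iInf_congr fun f => ?_
  rw [const_sub_iInf (measure_ne_top μ univ)]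
  exact iSup_congr fun ν => advPayoff_eq f.2 _

theorem advDualValue_eq [IsFiniteMeasure μ] (hK : 0 < K) :
    advDualValue c μ = (μ univ : EReal) - (dualAdversarial c μ : EReal) := by
  have := (exists_classifier hK X).to_subtype
  unfold advDualValue dualAdversarial attackValueOf
  rw [const_sub_iInf (measure_ne_top μ univ)]
  refine iSup_congr fun ν => ?_
  rw [iInf_subtype', iSup_subtype', const_sub_iSup (measure_ne_top μ univ)]
  exact iInf_congr fun f => advPayoff_eq f.2 _

theorem robustPower_le_dualAdversarial : robustPower c μ ≤ dualAdversarial c μ :=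
  iSup₂_le fun f hf => le_iInf fun ν => (iInf_le _ ν).trans
    (le_iSup₂ (f := fun f (_ : f ∈ classifiers X K) => powerPayoff c μ f ν) f hf)

/-- The payoff at (f, ν) lies between the robust power of f and the value of ν, so the hypothesis
makes all three equal. -/
theorem isSaddle_of_attackValueOf_le [IsFiniteMeasure μ] {f : X → Fin K → ℝ} {ν : Measure (X × Fin K)}
    [hν : IsFiniteMeasure ν] (hf : f ∈ classifiers X K)
    (h : attackValueOf c μ ν ≤ robustPowerOf c μ f) : IsSaddle c μ f ν := by
  have hle : ∀ g ∈ classifiers X K, powerPayoff c μ g ν ≤ attackValueOf c μ ν := fun g hg =>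
    le_iSup₂ (f := fun g (_ : g ∈ classifiers X K) => powerPayoff c μ g ν) g hg
  have hge : ∀ ν' : FiniteMeasure (X × Fin K), robustPowerOf c μ f ≤ powerPayoff c μ f ν' :=
    fun ν' => iInf_le _ ν'
  refine ⟨hf, hν, fun g hg => ?_, fun ν' => ?_⟩
  · rw [advPayoff_eq hf, advPayoff_eq hg]
    exact antitone_const_sub _ ((hle g hg).trans (h.trans (hge ⟨ν, hν⟩)))
  · rw [advPayoff_eq hf, advPayoff_eq hf]
    exact antitone_const_sub _ ((hle f hf).trans (h.trans (hge ν')))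

end Values

/-! ### Closing the circle of inequalities -/

section Duality

variable {X : Type*} [MetricSpace X] [CompleteSpace X] [Nonempty X] [SecondCountableTopology X]
  [MeasurableSpace X] [BorelSpace X] {K : ℕ} {c : X → X → ℝ≥0∞} {μ : Measure (X × Fin K)}
  [IsFiniteMeasure μ] {φ : Fin K → ZStar X K → ℝ}

omit [IsFiniteMeasure μ] in
omit [CompleteSpace X] [Nonempty X] in
theorem CostAssumption.mem_dualFeasible_iff (hc : CostAssumption c) : φ ∈ dualFeasible c μ ↔
    (∀ j, Integrable (φ j) (ghostMarginal μ)) ∧ ∀ z, ∑ j, φ j (z j) ≤ (motCost c z).toReal := by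
  refine and_congr_right fun _ => forall_congr' fun z => ?_
  rw [← EReal.coe_ennreal_toReal (hc.motCost_ne_top z), EReal.coe_le_coe_iff]

omit [CompleteSpace X] [Nonempty X] in
theorem CostAssumption.motCost_ghost (hc : CostAssumption c) :
    motCost c (fun _ : Fin K => (Sum.inr () : ZStar X K)) = 0 := by
  have h : localMeasure (fun _ : Fin K => (Sum.inr () : ZStar X K)) = 0 := by simp [localMeasure]
  have := Bstar_le_of_finite (localMeasure fun _ : Fin K => (Sum.inr () : ZStar X K)) hc
  rw [h] at this
  rw [motCost, h]
  simpa using this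

omit [IsFiniteMeasure μ] in
omit [CompleteSpace X] [Nonempty X] in
theorem CostAssumption.exists_dominating_classifier_of_dualFeasible (hc : CostAssumption c) (hK : 0 < K)
    (hφ : φ ∈ dualFeasible c μ) {S : Fin K → Set X} (hS : ∀ i, Measurable (preClassifier c φ S i)) :
    ∃ f ∈ classifiers X K, Dominates c φ S f :=
  exists_dominating_classifier hK hS
    (sum_preClassifier_le_one hc.measurable hK (hc.mem_dualFeasible_iff.1 hφ).2 hc.motCost_ghost S)

omit [CompleteSpace X] [Nonempty X] in
/-- Feasible potentials bound the robust classification power from below. -/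
theorem CostAssumption.dualObjective_le_robustPower (hc : CostAssumption c) (hK : 0 < K) (hμ : μ ≠ 0)
    (hφ : φ ∈ dualFeasible c μ) :
    ENNReal.ofReal (2 * μ.real univ * dualObjective μ φ) ≤ robustPower c μ := by
  obtain ⟨S, hS, hSm⟩ := hc.exists_measurable_preClassifier hφ.1
  obtain ⟨f, hf, hdom⟩ := hc.exists_dominating_classifier_of_dualFeasible hK hφ hSm
  exact (dualObjective_le_robustPowerOf hμ hφ.1 hS hf hdom).trans
    (le_iSup₂ (f := fun f (_ : f ∈ classifiers X K) => robustPowerOf c μ f) f hf)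

omit [CompleteSpace X] [Nonempty X] in
theorem integral_ghostMarginal (hμ : μ ≠ 0) (g : BoundedContinuousFunction (ZStar X K) ℝ) :
    ∫ w, g w ∂(ghostMarginal μ) =
      1 / (2 * μ.real univ) * ∫ z, g (Sum.inl z) ∂μ + 1 / 2 * g (Sum.inr ()) := by
  have := isProbabilityMeasure_ghostMarginal hμ
  have hint : Integrable g (ghostMarginal μ) := g.integrable _
  rw [ghostMarginal] at hint ⊢
  rw [integral_add_measure hint.left_of_add_measure hint.right_of_add_measure, integral_smul_measure,
    integral_smul_measure, integral_map measurable_inl.aemeasurable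
      g.continuous.aestronglyMeasurable, integral_dirac]
  simp [Measure.real]

omit [CompleteSpace X] [Nonempty X] in
theorem sum_integral_ghostMarginal (hμ : μ ≠ 0)
    (φ : Fin K → BoundedContinuousFunction (ZStar X K) ℝ) :
    ∑ j, ∫ w, φ j w ∂(ghostMarginal μ) = dualObjective μ fun j => φ j := by
  simp only [integral_ghostMarginal hμ, dualObjective, Finset.sum_add_distrib, Finset.mul_sum]

/-- The strong half of duality. Bounded continuous potentials are feasible competitors, so any bound
D on the dual serves. -/
theorem CostAssumption.exists_multiCoupling_le (hc : CostAssumption c) (hK : 0 < K) (hμ : μ ≠ 0) {D : ℝ}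
    (hD : ∀ φ ∈ dualFeasible c μ, dualObjective μ φ ≤ D) :
    ∃ π ∈ multiCouplings μ, ∫⁻ z, motCost c z ∂π ≤ ENNReal.ofReal D := by
  have := hc.properSpace
  have : Nonempty (Fin K) := ⟨⟨0, hK⟩⟩
  have hP := isProbabilityMeasure_ghostMarginal hμ
  obtain ⟨π, hπ, hmarg, hle⟩ := exists_multimarginal_plan (fun _ : Fin K => ghostMarginal μ)
    (hc.lowerSemicontinuous_motCost hK) D fun φ hφ => by
      rw [sum_integral_ghostMarginal hμ]
      refine hD _ (hc.mem_dualFeasible_iff.2 ⟨fun j => (φ j).integrable _, fun z => ?_⟩)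
      exact (ENNReal.ofReal_le_iff_le_toReal (hc.motCost_ne_top z)).1 (hφ z)
  exact ⟨π, ⟨hπ, hmarg⟩, hle⟩

theorem CostAssumption.Bstar_div_le_lintegral_motCost (hc : CostAssumption c) (hK : 0 < K) (hμ : μ ≠ 0)
    {π : Measure (Fin K → ZStar X K)} (hπ : π ∈ multiCouplings μ) :
    Bstar c μ / (2 * μ univ) ≤ ∫⁻ z, motCost c z ∂π := by
  obtain ⟨η, hη⟩ := (hc.exists_gatherAttack (K := K) hK).2
  have := isFiniteMeasure_assembledAttack hc hK hμ hπ hη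
  exact ENNReal.div_le_of_le_mul' ((Bstar_le_attackValueOf hc.measurable hK μ _).trans
    (attackValueOf_assembledAttack_le hc hK hμ hπ hη))

omit [MetricSpace X] [CompleteSpace X] [Nonempty X] [SecondCountableTopology X] [BorelSpace X] in
theorem ofReal_two_mul_real_mul (x : ℝ) :
    ENNReal.ofReal (2 * μ.real univ * x) = 2 * μ univ * ENNReal.ofReal x := by
  rw [ENNReal.ofReal_mul (by positivity), ENNReal.ofReal_mul (by positivity), ofReal_measureReal]
  simp

/-- Here D is the normalized robust power, which bounds the dual by `dualObjective_le_robustPower`;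
an optimal φ is not required. -/
theorem CostAssumption.exists_multiCoupling_le_robustPower (hc : CostAssumption c) (hK : 0 < K)
    (hμ : μ ≠ 0) : ∃ π ∈ multiCouplings μ,
      ∫⁻ z, motCost c z ∂π ≤ robustPower c μ / (2 * μ univ) := by
  have h0 := two_mul_measure_univ_ne_zero hμ
  have ht := two_mul_measure_univ_ne_top (μ := μ)
  have hfin : robustPower c μ / (2 * μ univ) ≠ ⊤ := by
    refine ENNReal.div_ne_top (ne_top_of_le_ne_top ?_ (robustPower_le_dualAdversarial.trans
      ((dualAdversarial_eq_Bstar hc.measurable hK μ).le.trans (Bstar_le_of_finite μ hc)))) h0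
    exact ENNReal.mul_ne_top (by simp) (measure_ne_top _ _)
  rw [← ENNReal.ofReal_toReal hfin]
  refine hc.exists_multiCoupling_le hK hμ fun φ hφ => ?_
  rw [← ENNReal.ofReal_le_iff_le_toReal hfin, ENNReal.le_div_iff_mul_le (Or.inl h0) (Or.inl ht), mul_comm,
    ← ofReal_two_mul_real_mul]
  exact hc.dualObjective_le_robustPower hK hμ hφ

theorem CostAssumption.robustPower_eq_Bstar (hc : CostAssumption c) (hK : 0 < K) (hμ : μ ≠ 0) :
    robustPower c μ = Bstar c μ := by
  refine le_antisymm (robustPower_le_dualAdversarial.trans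
    (dualAdversarial_eq_Bstar hc.measurable hK μ).le) ?_
  obtain ⟨π, hπ, hle⟩ := hc.exists_multiCoupling_le_robustPower hK hμ
  have h := (hc.Bstar_div_le_lintegral_motCost hK hμ hπ).trans hle
  rwa [ENNReal.div_le_iff (two_mul_measure_univ_ne_zero hμ) two_mul_measure_univ_ne_top,
    ENNReal.div_mul_cancel (two_mul_measure_univ_ne_zero hμ) two_mul_measure_univ_ne_top] at h

theorem CostAssumption.isLeast_lintegral_motCost (hc : CostAssumption c) (hK : 0 < K) (hμ : μ ≠ 0) :
    IsLeast ((fun π => ∫⁻ z, motCost c z ∂π) '' multiCouplings μ) (Bstar c μ / (2 * μ univ)) := by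
  refine ⟨?_, forall_mem_image.2 fun π hπ => hc.Bstar_div_le_lintegral_motCost hK hμ hπ⟩
  obtain ⟨π, hπ, hle⟩ := hc.exists_multiCoupling_le_robustPower hK hμ
  rw [hc.robustPower_eq_Bstar hK hμ] at hle
  exact ⟨π, hπ, hle.antisymm (hc.Bstar_div_le_lintegral_motCost hK hμ hπ)⟩

theorem CostAssumption.attackValueOf_assembledAttack_eq (hc : CostAssumption c) (hK : 0 < K)
    (hμ : μ ≠ 0) {π : Measure (Fin K → ZStar X K)} (hπ : IsMOTSolution c μ π)
    {η : ProbabilityTheory.Kernel (Fin K → ZStar X K) (X × Fin K)} (hη : IsOptimalLocalAttack c η) :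
    attackValueOf c μ (assembledAttack μ π η) = Bstar c μ := by
  have := isFiniteMeasure_assembledAttack hc hK hμ hπ.1 hη
  refine le_antisymm ?_ (Bstar_le_attackValueOf hc.measurable hK μ _)
  obtain ⟨π', hπ', heq⟩ := (hc.isLeast_lintegral_motCost hK hμ).1
  calc _ ≤ 2 * μ univ * ∫⁻ z, motCost c z ∂π := attackValueOf_assembledAttack_le hc hK hμ hπ.1 hη
    _ ≤ 2 * μ univ * (Bstar c μ / (2 * μ univ)) := by
      gcongr
      exact (hπ.2 π' hπ').trans heq.le
    _ = Bstar c μ := ENNReal.mul_div_cancel (two_mul_measure_univ_ne_zero hμ) two_mul_measure_univ_ne_top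

/-- The objective of the optimal φ bounds the dual, hence also ∫ c dπ for some plan, and thus B*_μ /
(2M); domination transfers this bound to f. -/
theorem CostAssumption.robustPowerOf_eq_Bstar (hc : CostAssumption c) (hK : 0 < K) (hμ : μ ≠ 0)
    (hφ : IsDualSolution c μ φ) {S : Fin K → Set X} (hS : ∀ i, classPart μ i (S i)ᶜ = 0)
    {f : X → Fin K → ℝ} (hf : f ∈ classifiers X K) (hdom : Dominates c φ S f) :
    robustPowerOf c μ f = Bstar c μ := by
  refine le_antisymm (le_trans
    (le_iSup₂ (f := fun f (_ : f ∈ classifiers X K) => robustPowerOf c μ f) f hf)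
    (hc.robustPower_eq_Bstar hK hμ).le) ?_
  obtain ⟨π, hπ, hle⟩ := hc.exists_multiCoupling_le hK hμ hφ.2
  refine le_trans ?_ (dualObjective_le_robustPowerOf hμ hφ.1.1 hS hf hdom)
  rw [ofReal_two_mul_real_mul, mul_comm, ← ENNReal.div_le_iff (two_mul_measure_univ_ne_zero hμ)
    two_mul_measure_univ_ne_top]
  exact (hc.Bstar_div_le_lintegral_motCost hK hμ hπ).trans hle

end Duality

end AdvMOT

theorem mainTheorem1 {X : Type*} [MetricSpace X] [CompleteSpace X] [SecondCountableTopology X]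
    [MeasurableSpace X] [BorelSpace X] (K : ℕ) (hK : 2 ≤ K)
    (c : X → X → ℝ≥0∞) (hc : AdvMOT.CostAssumption c)
    (μ : Measure (X × Fin K)) [IsFiniteMeasure μ] (hμ : μ ≠ 0) :
    -- the dual adversarial problem is the generalized barycenter problem, and it equals the MOT
    AdvMOT.dualAdversarial c μ = AdvMOT.Bstar c μ ∧
    IsLeast ((fun π => ∫⁻ z, AdvMOT.motCost c z ∂π) '' AdvMOT.multiCouplings μ)
      (AdvMOT.Bstar c μ / (2 * μ univ)) ∧
    -- no duality gap
    AdvMOT.robustPower c μ = AdvMOT.dualAdversarial c μ ∧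
    AdvMOT.advValue c μ = (μ univ : EReal) - (AdvMOT.Bstar c μ : EReal) ∧
    AdvMOT.advDualValue c μ = (μ univ : EReal) - (AdvMOT.Bstar c μ : EReal) ∧
    -- measurable families of optimal local attacks exist
    (∃ η : ProbabilityTheory.Kernel (Fin K → AdvMOT.ZStar X K) (X × Fin K),
      AdvMOT.IsOptimalLocalAttack c η) ∧
    -- construction of a saddle point from a primal-dual pair of MOT solutions
    ∀ (π : Measure (Fin K → AdvMOT.ZStar X K)) (φ : Fin K → AdvMOT.ZStar X K → ℝ),
      AdvMOT.IsMOTSolution c μ π → AdvMOT.IsDualSolution c μ φ →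
      (∃ S : Fin K → Set X, (∀ i, AdvMOT.classPart μ i (S i)ᶜ = 0) ∧
        ∀ i, Measurable (AdvMOT.preClassifier c φ S i)) ∧
      (∀ S : Fin K → Set X, (∀ i, Measurable (AdvMOT.preClassifier c φ S i)) →
        ∃ f ∈ AdvMOT.classifiers X K, AdvMOT.Dominates c φ S f) ∧
      (∀ (S : Fin K → Set X) (f : X → Fin K → ℝ)
        (η : ProbabilityTheory.Kernel (Fin K → AdvMOT.ZStar X K) (X × Fin K)),
        (∀ i, AdvMOT.classPart μ i (S i)ᶜ = 0) → f ∈ AdvMOT.classifiers X K →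
        AdvMOT.Dominates c φ S f → AdvMOT.IsOptimalLocalAttack c η →
        AdvMOT.robustPowerOf c μ f = AdvMOT.robustPower c μ ∧
        AdvMOT.attackValueOf c μ (AdvMOT.assembledAttack μ π η) = AdvMOT.dualAdversarial c μ ∧
        AdvMOT.IsSaddle c μ f (AdvMOT.assembledAttack μ π η)) := by
  have hK0 : 0 < K := by omega
  have hX : Nonempty X := by
    by_contra h
    rw [not_nonempty_iff] at h
    exact hμ (Measure.eq_zero_of_isEmpty μ)
  have hdual := AdvMOT.dualAdversarial_eq_Bstar hc.measurable hK0 μ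
  have hrob := hc.robustPower_eq_Bstar hK0 hμ
  refine ⟨hdual, hc.isLeast_lintegral_motCost hK0 hμ, hrob.trans hdual.symm, ?_, ?_,
    (hc.exists_gatherAttack hK0).2, fun π φ hπ hφ => ⟨hc.exists_measurable_preClassifier hφ.1.1,
      fun S hS => hc.exists_dominating_classifier_of_dualFeasible hK0 hφ.1 hS,
      fun S f η hS hf hdom hη => ?_⟩⟩
  · rw [AdvMOT.advValue_eq hK0, hrob]
  · rw [AdvMOT.advDualValue_eq hK0, hdual]
  · have hf' := hc.robustPowerOf_eq_Bstar hK0 hμ hφ hS hf hdom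
    have hη' := hc.attackValueOf_assembledAttack_eq hK0 hμ hπ hη
    have := AdvMOT.isFiniteMeasure_assembledAttack hc hK0 hμ hπ.1 hη
    exact ⟨hf'.trans hrob.symm, hη'.trans hdual.symm,
      AdvMOT.isSaddle_of_attackValueOf_le hf (hη'.trans hf'.symm).le⟩
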